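/- **Setting.** Let $p\ge 1$ be an integer and $2\le r\le p+1$ real. For $0<L_{p,f}<L_{p,g}$ and $\sigma_r,R,\varepsilon>0$ consider $\min_{x\in\mathbb R^d}F(x)=f(x)+g(x)$ (Euclidean norm), where $f,g:\mathbb R^d\to\mathbb R$ are convex and $p$ times continuously differentiable, $\|D^pf(x)-D^pf(y)\|\le L_{p,f}\|x-y\|$, $\|D^pg(x)-D^pg(y)\|\le L_{p,g}\|x-y\|$, and $F$ is $r$-uniformly convex: $F(y)\ge F(x)+\langle\nabla F(x),y-x\rangle+\frac{\sigma_r}{r}\|y-x\|^r$ for all $x,y$. Let $x_*$ be the minimizer of $F$ and let the starting point $x_0$ satisfy $\|x_0-x_*\|\le R$. Put $\Omega_p(f,x;y)=\sum_{k=0}^{p}\frac1{k!}D^kf(x)[y-x]^k$. **CATD** with parameter $H$ for an objective $\Phi=\phi+\psi$ ($\psi$ the composite part), started at $z$: set $A_0=0$, $x_0=y_0=z$; at step $k$ find $\lambda_{k+1}>0$ and $y_{k+1}$ with $$\tfrac12\le \lambda_{k+1}\tfrac{H\|y_{k+1}-\tilde x_k\|^{p-1}}{(p-1)!}\le\tfrac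 p{p+1},\qquad y_{k+1}\approx\arg\min_y\Big\{\Omega_p(\phi,\tilde x_k;y)+\tfrac{H}{p!}\|y-\tilde x_k\|^{p+1}+\psi(y)\Big\},$$ where $a_{k+1}=\frac12\big(\lambda_{k+1}+\sqrt{\lambda_{k+1}^2+4\lambda_{k+1}A_k}\big)$, $A_{k+1}=A_k+a_{k+1}$, $\tilde x_k=\frac{A_k}{A_{k+1}}y_k+\frac{a_{k+1}}{A_{k+1}}x_k$; then $x_{k+1}=x_k-a_{k+1}\nabla\Phi(y_{k+1})$. The number $\lambda_{k+1}$ is found by bisection on a logarithmic scale in a given interval, with at most $T$ trials; every trial computes its own $\tilde x_k$, $y_{k+1}$ and $\nabla\Phi(y_{k+1})$. The method stops and returns the current trial point as soon as $\|\nabla\Phi\|\le\delta$ there. **CATD with restarts**, with data $(s,\sigma,L,D,c)$, runs at most $K$ rounds of CATD, each started at the output of the one before, where round $k$ has $$\max\Big\{\Big\lceil\Big(\tfrac{s\,c\,L\,2^s}{\sigma}(D\,2^{-k})^{p+1-s}\Big)^{2/(3p+1)}\Big\rceil,1\Big\}$$ steps. **Framework.** Run CATD with restarts for $F=f+g$ with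 $g$ as composite part, $H_{p,f}=2L_{p,f}$ and data $(r,\sigma_r,L_{p,f},R,c_{\rm out})$. For every trial, compute $y_{k+1}$ approximately by CATD with restarts, started at $\tilde x_k$, on the subproblem objective $h(y)=\Omega_p(f,\tilde x_k;y)+\frac{H_{p,f}}{p!}\|y-\tilde x_k\|^{p+1}+g(y)$ (no composite part, exact inner minimizations of the regularized Taylor models), with $H=\kappa(2L_{p,f}+L_{p,g})$ and data $(s,\sigma_s,2L_{p,f}+L_{p,g},\rho R,c_{\rm in})$. Here $(s,\sigma_s)=\big(p+1,\frac{(p+1)L_{p,f}2^{1-p}}{p!}\big)$ if $L_{p,f}R^{p+1-r}\ge\sigma_r$, and $(s,\sigma_s)=(r,\sigma_r)$ otherwise. The framework uses $f$ and $g$ only through oracles that return the derivatives of orders $0,\dots,p$ at a queried point; each query is one computation of derivatives of the respective function. All queries are counted, also those made in rejected trials and for checking the stopping criteria. **Theorem.** For all $p$ and $r$ as above there are constants $c_{\rm out},c_{\rm in},\kappa,\rho,C>0$ and $m\in\mathbb N$, depending only on $p$ and $r$, and for all $L_{p,f},L_{p,g},\sigma_r,R,\varepsilon$ as above there are values, depending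 only on these numbers and on $p,r$, of the remaining parameters (accuracies $\delta>0$, search intervals for $\lambda$, maximal numbers of trials and of rounds, for the outer and for the inner method), such that for every dimension $d$ and all $f,g,x_0$ as above the framework returns a point $x_N$ with $F(x_N)-F(x_*)\le\varepsilon$ after at most $$N_f\le C\Lambda^m\Big(1+\Big(\tfrac{L_{p,f}R^{p+1-r}}{\sigma_r}\Big)^{\frac2{3p+1}}\Big)\ \text{ computations of derivatives of } f \text{ and}$$ $$N_g\le C\Lambda^m\Big(1+\Big(\tfrac{L_{p,g}R^{p+1-r}}{\sigma_r}\Big)^{\frac2{3p+1}}\Big)\ \text{ computations of derivatives of } g,$$ where $\Lambda=1+\big|\log\tfrac{L_{p,f}R^{p+1}}{\varepsilon}\big|+\big|\log\tfrac{L_{p,g}R^{p+1}}{\varepsilon}\big|+\big|\log\tfrac{\sigma_rR^{r}}{\varepsilon}\big|$. -/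

import Mathlib

open scoped Nat

noncomputable section

namespace TensorSliding

/-! ## Assumptions on the functions -/

section Assumptions

variable {E : Type*} [NormedAddCommGroup E] [InnerProductSpace ℝ E] [CompleteSpace E]

/-- `f` is convex, `p` times continuously differentiable, and its `p`-th derivative is Lipschitz
with constant `L` (operator norm on `p`-linear forms). -/
structure ConvexLipschitzDeriv (p : ℕ) (L : ℝ) (f : E → ℝ) : Prop where
  convex : ConvexOn ℝ Set.univ f
  contDiff : ContDiff ℝ p f
  lipschitz : ∀ x y, ‖iteratedFDeriv ℝ p f x - iteratedFDeriv ℝ p f y‖ ≤ L * ‖x - y‖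

/-- `F` is (differentiable and) uniformly convex of degree `r` with constant `σ`:
`F y ≥ F x + ⟨∇F x, y - x⟩ + (σ / r) ‖y - x‖ ^ r`. -/
def UniformlyConvex (r σ : ℝ) (F : E → ℝ) : Prop :=
  Differentiable ℝ F ∧
    ∀ x y, F x + inner ℝ (gradient F x) (y - x) + σ / r * ‖y - x‖ ^ r ≤ F y

end Assumptions

/-! ## Counting oracle calls -/

/-- A value together with the number `nf` of derivative computations of `f` and the number `ng` of
derivative computations of `g` that were spent to obtain it. -/
structure Tally (α : Type*) where
  val : α
  nf : ℕ
  ng : ℕ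

/-- Sequential composition adds the numbers of calls. -/
instance : Monad Tally where
  pure a := ⟨a, 0, 0⟩
  bind t k := ⟨(k t.val).val, t.nf + (k t.val).nf, t.ng + (k t.val).ng⟩

section Algorithms

variable {E : Type*} [NormedAddCommGroup E] [InnerProductSpace ℝ E] [CompleteSpace E]

/-- The answer of a derivative oracle: one `k`-linear form for each order `k`. -/
abbrev Jet (E : Type*) [NormedAddCommGroup E] [InnerProductSpace ℝ E] :=
  (k : ℕ) → ContinuousMultilinearMap ℝ (fun _ : Fin k => E) ℝ

/-- The derivatives of `f` at `x` of the orders `0, …, p`; nothing is revealed about higher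
orders. -/
def jet (p : ℕ) (f : E → ℝ) (x : E) : Jet E :=
  fun k => if k ≤ p then iteratedFDeriv ℝ k f x else 0

/-- The gradient contained in a jet (the vector that represents the first derivative). -/
def Jet.grad (J : Jet E) : E :=
  (InnerProductSpace.toDual ℝ E).symm (continuousMultilinearCurryFin1 ℝ E ℝ (J 1))

/-- The Taylor polynomial of order `p` at `x` built from a jet at `x`, evaluated at `y`. -/
def Jet.taylor (p : ℕ) (J : Jet E) (x y : E) : ℝ :=
  ∑ k ∈ Finset.range (p + 1), (1 / (k ! : ℝ)) * J k (fun _ => y - x)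

/-- The regularised Taylor model `Ω_p(x; y) + (H / p!) ‖y - x‖ ^ (p + 1)`. -/
def Jet.model (p : ℕ) (H : ℝ) (J : Jet E) (x y : E) : ℝ :=
  J.taylor p x y + H / (p ! : ℝ) * ‖y - x‖ ^ (p + 1)

/-- The derivative oracle of `f`, where a call is charged as a computation of derivatives of `f`. -/
def callF (p : ℕ) (f : E → ℝ) (x : E) : Tally (Jet E) := ⟨jet p f x, 1, 0⟩

/-- The derivative oracle of `g`, where a call is charged as a computation of derivatives of `g`. -/
def callG (p : ℕ) (g : E → ℝ) (x : E) : Tally (Jet E) := ⟨jet p g x, 0, 1⟩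

/-- A global minimiser of `q` (an arbitrary point if there is none). -/
def argmin (q : E → ℝ) : E := Classical.epsilon fun y => ∀ w, q y ≤ q w

/-! ## Composite Accelerated Taylor Descent (CATD) -/

/-- Numerical parameters of one CATD: the regularisation `H`, the accuracy `δ` (a point at which the
gradient of the objective has norm at most `δ` is returned at once), the interval `[lo, hi]` in
which the step size is searched, and the largest number `T` of step sizes tried per iteration. -/
structure CATDParams where
  H : ℝ
  δ : ℝ
  lo : ℝ
  hi : ℝ
  T : ℕ

/-- The state `(A_k, x_k, y_k)` of CATD. -/
structure CATDState (E : Type*) where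
  A : ℝ
  x : E
  y : E

/-- The computation of the pair `(λ_{k+1}, y_{k+1})` and the update of `(A_k, x_k, y_k)`, by
bisection on a logarithmic scale: `l` is the trial value of `λ_{k+1}`, `xt` is the point `x̃_k` that
belongs to it, and `y' = tensorStep xt`. The trial is accepted if
`1 / 2 ≤ λ H ‖y' - x̃‖ ^ (p - 1) / (p - 1)! ≤ p / (p + 1)`. The result is `Sum.inl y'` if the accuracy
`δ` has been reached at `y'`, and `Sum.inr s` with the next state `s` otherwise. -/
def catdStep (p : ℕ) (P : CATDParams) (tensorStep grad : E → Tally E) (s : CATDState E) :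
    ℕ → ℝ → ℝ → Tally (E ⊕ CATDState E)
  | 0, _, _ => pure (Sum.inr s)
  | n + 1, lo, hi => do
    let l := √(lo * hi)
    let a := (l + √(l ^ 2 + 4 * l * s.A)) / 2
    let A' := s.A + a
    let xt := (s.A / A') • s.y + (a / A') • s.x
    let y' ← tensorStep xt
    let v ← grad y'
    let η := l * (P.H * ‖y' - xt‖ ^ (p - 1) / ((p - 1)! : ℝ))
    if ‖v‖ ≤ P.δ then pure (Sum.inl y')
    else if η < 1 / 2 then catdStep p P tensorStep grad s n l hi
    else if (p : ℝ) / (p + 1) < η then catdStep p P tensorStep grad s n lo l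
    else pure (Sum.inr ⟨A', s.x - a • v, y'⟩)

/-- `N` iterations of CATD; `Sum.inl y` if the accuracy is reached on the way, else `Sum.inr y_N`. -/
def catd (p : ℕ) (P : CATDParams) (tensorStep grad : E → Tally E) :
    ℕ → CATDState E → Tally (E ⊕ E)
  | 0, s => pure (Sum.inr s.y)
  | N + 1, s => do
    match ← catdStep p P tensorStep grad s P.T P.lo P.hi with
    | Sum.inl y => pure (Sum.inl y)
    | Sum.inr s' => catd p P tensorStep grad N s'

/-- The number of CATD iterations between restart `k` and restart `k + 1`, with `R_k = R / 2 ^ k`: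
`max (⌈(s c L 2 ^ s R_k ^ (p + 1 - s) / σ) ^ (2 / (3 p + 1))⌉, 1)`. -/
def restartLength (p : ℕ) (s σ c L R : ℝ) (k : ℕ) : ℕ :=
  max ⌈(s * c * L * 2 ^ s / σ * (R / 2 ^ k) ^ ((p : ℝ) + 1 - s)) ^ ((2 : ℝ) / (3 * p + 1))⌉₊ 1

/-- CATD with restarts: starting at `z`, the rounds `k, k + 1, …` (`K` of them), where round `k`
consists of `N k` iterations of CATD started at the output of the round before; it stops as soon as
the accuracy `P.δ` is reached. -/
def catdRestarts (p : ℕ) (P : CATDParams) (N : ℕ → ℕ) (tensorStep grad : E → Tally E) :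
    ℕ → ℕ → E → Tally E
  | 0, _, z => pure z
  | K + 1, k, z => do
    match ← catd p P tensorStep grad (N k) ⟨0, z, z⟩ with
    | Sum.inl y => pure y
    | Sum.inr z' => catdRestarts p P N tensorStep grad K (k + 1) z'

/-- CATD with restarts for a function that is given by a derivative oracle `o` (no composite part):
the tensor step is the exact minimiser of the regularised Taylor model. -/
def plainCatdRestarts (p : ℕ) (P : CATDParams) (N : ℕ → ℕ) (o : E → Tally (Jet E)) (K : ℕ) (z : E) :
    Tally E :=
  catdRestarts p P N
    (fun xt => do
      let J ← o xt
      pure (argmin fun y => J.model p P.H xt y))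
    (fun y => do
      let J ← o y
      pure J.grad)
    K 0 z

/-! ## The combination of two tensor methods -/

/-- Parameters of the nested framework: for the outer and for the inner method the parameters of
CATD, the numbers of iterations per round, and the largest number of rounds. -/
structure FrameworkParams where
  outer : CATDParams
  outerN : ℕ → ℕ
  outerK : ℕ
  inner : CATDParams
  innerN : ℕ → ℕ
  innerK : ℕ

/-- The nested framework. It sees `f` and `g` only through the derivative oracles `oF` and `oG`.
The outer method is CATD with restarts for `f + g` with `g` as composite part. Its tensor step at
`x̃` calls `oF` at `x̃` and runs CATD with restarts, started at `x̃`, on the subproblem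
`min_y Ω_p(f, x̃; y) + (H / p!) ‖y - x̃‖ ^ (p + 1) + g y`; the derivatives of the first two terms
are known, so the inner method only calls `oG`. -/
def framework (p : ℕ) (P : FrameworkParams) (oF oG : E → Tally (Jet E)) (x₀ : E) : Tally E :=
  catdRestarts p P.outer P.outerN
    (fun xt => do
      let J ← oF xt
      plainCatdRestarts p P.inner P.innerN
        (fun w => do
          let Jg ← oG w
          pure (jet p (J.model p P.outer.H xt) w + Jg))
        P.innerK xt)
    (fun y => do
      let Jf ← oF y
      let Jg ← oG y
      pure (Jf.grad + Jg.grad))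
    P.outerK 0 x₀

end Algorithms

/-- The degree of uniform convexity of the subproblem that the inner restarts use: `p + 1` (from the
regulariser), or `r` (inherited from `f + g`) if `L_f R ^ (p + 1 - r) < σ_r`. -/
def innerDegree (p : ℕ) (r Lf σ R : ℝ) : ℝ :=
  open Classical in if σ ≤ Lf * R ^ ((p : ℝ) + 1 - r) then (p : ℝ) + 1 else r

/-- The constant of uniform convexity of the subproblem that belongs to `innerDegree`; for `p + 1`
it is that of `(L_f / p!) ‖y‖ ^ (p + 1)`. -/
def innerConst (p : ℕ) (r Lf σ R : ℝ) : ℝ :=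
  open Classical in
  if σ ≤ Lf * R ^ ((p : ℝ) + 1 - r) then ((p : ℝ) + 1) * Lf * 2 ^ (1 - (p : ℝ)) / (p ! : ℝ) else σ

/-- The logarithmic factor hidden in `Õ`. -/
def logFactor (p : ℕ) (r Lf Lg σ R ε : ℝ) : ℝ :=
  1 + |Real.log (Lf * R ^ (p + 1) / ε)| + |Real.log (Lg * R ^ (p + 1) / ε)|
    + |Real.log (σ * R ^ r / ε)|

end TensorSliding

end

noncomputable section

namespace TensorSliding

/-! ## Taylor polynomials of functions with Lipschitz derivatives -/

section MeanValue

variable {E G : Type*} [NormedAddCommGroup E] [NormedSpace ℝ E]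
  [NormedAddCommGroup G] [NormedSpace ℝ G]

/-! One abstract analysis of CATD is used twice, for the outer and for the inner method. The
gradient of a regularised Taylor model plus composite part is `modelGrad`: the gradient of the whole
objective, minus the gradient of the Taylor error, plus that of the regulariser. If the `p`-th
derivative of the expanded function has Lipschitz constant at most `H / 2`, the regulariser
dominates the error (`modelGrad_inner_ge_max`), so the model gradient is uniformly monotone of
degree `p + 1` and has a Hölder continuous inverse (`norm_sub_pow_le_of_modelGrad`). `TensorMethod`
axiomatises a convex objective with tensor steps of residual at most `δ'`; `δ'` is `0` for the inner
method and the accuracy of the inner method for the outer one.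

Rate. An accepted trial is an inexact proximal step with relative error 2/3
(`norm_smul_grad_add_le`), so the Monteiro–Svaiter potential decreases (`potential_step`). The
decrease bounds the sum of the terms `A' / l * ‖y' - x̃‖ ^ 2` by a multiple of `D ^ 2`, while `A ^
(1 / (p + 1))` grows by a negative power of each term (`growth_step`). Convexity of that power
yields the rate `N ^ (-(3 p + 1) / 2)`.

Bisection. The acceptance quantity need not be monotone in the step size. But while the gradient
exceeds `δ` the tensor step cannot be short, and by the Hölder estimate its length hardly changes
between neighbouring trials. A trial that is too low and one that is too high therefore cannot be
close to each other (`not_low_high`), and logarithmically many halvings suffice.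

Restarts. With uniform convexity each round halves the distance to the minimiser
(`catdRestarts_spec`). After logarithmically many rounds the distance is so small that a gradient
above `δ` is impossible, so the method has stopped at a small gradient; convexity converts this into
a small function gap.

Nesting. The subproblem is uniformly convex of degree `p + 1` through its regulariser, and of degree
`r` because the model minus `f` is convex. Its `p`-th derivative has a dimension-free Lipschitz
constant of order `2 * Lf + Lg`, and the analysis of exact steps bounds the distance from `x̃` to
its minimiser. With `e = 2 / (3 p + 1)`, outer and inner rounds cost `(Lf R ^ (p + 1 - r) / σ) ^ e`
and `(Lg / Lf) ^ e` when the first quantity is at least one, and `Lf` cancels in the product;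
otherwise outer rounds have bounded length and degree `r` gives the inner cost directly
(`exists_inner_round_bound`). -/

theorem norm_sub_le_of_norm_fderiv_le_pow {Ψ : E → G} (hΨ : Differentiable ℝ Ψ) {c : E} {M : ℝ}
    {m : ℕ} (h : ∀ z, ‖fderiv ℝ Ψ z‖ ≤ M * ‖z - c‖ ^ m) (z : E) :
    ‖Ψ z - Ψ c‖ ≤ M / (m + 1) * ‖z - c‖ ^ (m + 1) := by
  set u := z - c with hu
  have hline : ∀ t : ℝ, HasDerivAt (fun t : ℝ => Ψ (c + t • u) - Ψ c)
      (fderiv ℝ Ψ (c + t • u) u) t := by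
    intro t
    have h1 : HasDerivAt (fun t : ℝ => c + t • u) u t := by
      simpa using ((hasDerivAt_id t).smul_const u).const_add c
    exact ((hΨ (c + t • u)).hasFDerivAt.comp_hasDerivAt t h1).sub_const _
  have hB : ∀ t : ℝ, HasDerivAt (fun t : ℝ => M / (m + 1) * ‖u‖ ^ (m + 1) * t ^ (m + 1))
      (M * ‖u‖ ^ (m + 1) * t ^ m) t := by
    intro t
    have := (hasDerivAt_pow (m + 1) t).const_mul (M / (m + 1) * ‖u‖ ^ (m + 1))
    convert! this using 1
    have : (m : ℝ) + 1 ≠ 0 := by positivity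
    push_cast
    field_simp
  have := image_norm_le_of_norm_deriv_right_le_deriv_boundary (a := 0) (b := 1)
    (f := fun t : ℝ => Ψ (c + t • u) - Ψ c) (f' := fun t => fderiv ℝ Ψ (c + t • u) u)
    (fun t _ => (hline t).continuousAt.continuousWithinAt)
    (fun t _ => (hline t).hasDerivWithinAt) (by simp) hB
    (fun t ht => by
      calc ‖fderiv ℝ Ψ (c + t • u) u‖ ≤ ‖fderiv ℝ Ψ (c + t • u)‖ * ‖u‖ :=
            ContinuousLinearMap.le_opNorm _ _
        _ ≤ M * ‖c + t • u - c‖ ^ m * ‖u‖ := by gcongr; exact h _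
        _ = M * ‖u‖ ^ (m + 1) * t ^ m := by
          rw [add_sub_cancel_left, norm_smul, Real.norm_of_nonneg ht.1]; ring)
    (Set.right_mem_Icc.2 zero_le_one)
  simpa [hu] using this

theorem norm_le_of_norm_fderiv_le_closedBall {Ψ : E → G} (hΨ : Differentiable ℝ Ψ) {c : E}
    {M A B : ℝ} (hA : ‖Ψ c‖ ≤ A) (h : ∀ z, ‖z - c‖ ≤ B → ‖fderiv ℝ Ψ z‖ ≤ M) {z : E}
    (hz : ‖z - c‖ ≤ B) : ‖Ψ z‖ ≤ A + M * B := by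
  have hM : 0 ≤ M := (norm_nonneg _).trans (h z hz)
  have hB : 0 ≤ B := (norm_nonneg _).trans hz
  have h1 := (convex_closedBall c B).norm_image_sub_le_of_norm_fderiv_le (f := Ψ) (𝕜 := ℝ)
    (fun x _ => hΨ x) (fun x hx => h x (by simpa [dist_eq_norm] using hx))
    (Metric.mem_closedBall_self hB) (by simpa [dist_eq_norm] using hz : z ∈ Metric.closedBall c B)
  have h2 : ‖Ψ z‖ ≤ ‖Ψ c‖ + ‖Ψ z - Ψ c‖ := by
    simpa using norm_add_le (Ψ c) (Ψ z - Ψ c)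
  nlinarith [mul_le_mul_of_nonneg_left hz hM]

/-- Downward in the order: as the derivative one order lower vanishes at `c`, integrating from `c`
gains one power of the distance and one factor of the factorial. -/
theorem norm_iteratedFDeriv_le_of_vanishing {p : ℕ} {e : E → G} (he : ContDiff ℝ p e) {c : E}
    {M : ℝ} (h0 : ∀ k ≤ p, iteratedFDeriv ℝ k e c = 0)
    (hM : ∀ z, ‖iteratedFDeriv ℝ p e z‖ ≤ M * ‖z - c‖) {j : ℕ} (hj : j ≤ p) (z : E) :
    ‖iteratedFDeriv ℝ (p - j) e z‖ ≤ M / (j + 1)! * ‖z - c‖ ^ (j + 1) := by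
  induction j generalizing z with
  | zero => simpa using hM z
  | succ j ih =>
    have hlt : p - (j + 1) < p := by omega
    have hd : Differentiable ℝ (iteratedFDeriv ℝ (p - (j + 1)) e) :=
      he.differentiable_iteratedFDeriv (by exact_mod_cast hlt)
    have := norm_sub_le_of_norm_fderiv_le_pow hd (c := c) (M := M / (j + 1)!) (m := j + 1)
      (fun z => by
        rw [norm_fderiv_iteratedFDeriv, show p - (j + 1) + 1 = p - j by omega]
        exact ih (by omega) z) z
    rw [h0 _ hlt.le, sub_zero] at this
    refine this.trans (le_of_eq ?_)
    rw [Nat.factorial_succ (j + 1)]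
    push_cast
    field_simp

end MeanValue

/-! ### Derivatives of finite power series -/

section Polynomial

variable {E F : Type} [NormedAddCommGroup E] [NormedSpace ℝ E]
  [NormedAddCommGroup F] [NormedSpace ℝ F]

theorem norm_iteratedFDeriv_eq_zero_of_hasFiniteFPowerSeries {n : ℕ} {F : Type}
    [NormedAddCommGroup F] [NormedSpace ℝ F] {f : E → F}
    {q : FormalMultilinearSeries ℝ E F} {x : E}
    (h : HasFiniteFPowerSeriesOnBall f q x n ⊤) (y : E) : ‖iteratedFDeriv ℝ n f y‖ = 0 := by
  induction n generalizing F with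
  | zero => simpa using h.eq_zero_of_bound_zero y (by simp)
  | succ n ih => rw [← norm_iteratedFDeriv_fderiv]; exact ih h.fderiv

end Polynomial

/-! ### Symmetry of higher derivatives of `C^n` maps -/

section Symmetric

variable {E F : Type*} [NormedAddCommGroup E] [NormedSpace ℝ E]
  [NormedAddCommGroup F] [NormedSpace ℝ F]

theorem fderiv_continuousMultilinearMap_apply {n : ℕ}
    {Ψ : E → ContinuousMultilinearMap ℝ (fun _ : Fin n => E) F} {x : E}
    (hd : DifferentiableAt ℝ Ψ x) (w : Fin n → E) (u : E) :
    fderiv ℝ Ψ x u w = fderiv ℝ (fun y => Ψ y w) x u := by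
  have h : fderiv ℝ (fun y => Ψ y w) x = _ :=
    ((ContinuousMultilinearMap.apply ℝ (fun _ : Fin n => E) F w).hasFDerivAt.comp x
      hd.hasFDerivAt).fderiv
  rw [h]
  rfl

theorem iteratedFDeriv_add_two_apply {f : E → F} {n : ℕ} (hf : ContDiff ℝ (n + 2 : ℕ) f) (x : E)
    (v : Fin (n + 2) → E) :
    iteratedFDeriv ℝ (n + 2) f x v =
      fderiv ℝ (fderiv ℝ (iteratedFDeriv ℝ n f)) x (v 0) (v 1) (Fin.tail (Fin.tail v)) := by
  have hd : DifferentiableAt ℝ (iteratedFDeriv ℝ (n + 1) f) x :=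
    hf.differentiable_iteratedFDeriv (by exact_mod_cast Nat.lt_succ_self (n + 1)) x
  have hC : ContDiff ℝ 2 (iteratedFDeriv ℝ n f) := hf.iteratedFDeriv_right (by norm_cast; omega)
  have hd1 : Differentiable ℝ (iteratedFDeriv ℝ n f) := hC.differentiable (by simp)
  have hd2 : DifferentiableAt ℝ (fderiv ℝ (iteratedFDeriv ℝ n f)) x :=
    (hC.fderiv_right (m := 1) (by norm_num)).differentiable (by simp) x
  have hd3 : DifferentiableAt ℝ (fun y => fderiv ℝ (iteratedFDeriv ℝ n f) y (v 1)) x :=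
    hd2.clm_apply (differentiableAt_const _)
  rw [iteratedFDeriv_succ_apply_left, fderiv_continuousMultilinearMap_apply hd]
  have h1 : (fun y => iteratedFDeriv ℝ (n + 1) f y (Fin.tail v)) =
      fun y => fderiv ℝ (iteratedFDeriv ℝ n f) y (v 1) (Fin.tail (Fin.tail v)) := by
    funext y
    rw [iteratedFDeriv_succ_apply_left]
    rfl
  rw [h1, ← fderiv_continuousMultilinearMap_apply hd3,
    fderiv_clm_apply hd2 (differentiableAt_const _)]
  simp

/-- A swap of the first two slots is the symmetry of the second derivative, applied to a lower
iterated derivative. Any later swap leaves the outermost differentiation alone and can be made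
before it, which is the induction hypothesis. -/
theorem iteratedFDeriv_comp_swap {f : E → F} {n : ℕ} (hf : ContDiff ℝ n f) (x : E)
    (v : Fin n → E) (i : ℕ) (hi : i + 1 < n) :
    iteratedFDeriv ℝ n f x (v ∘ Equiv.swap ⟨i, by omega⟩ ⟨i + 1, hi⟩) =
      iteratedFDeriv ℝ n f x v := by
  induction n generalizing x i with
  | zero => omega
  | succ n ih =>
    rcases i with _ | i
    · obtain ⟨n, rfl⟩ : ∃ m, n = m + 1 := ⟨n - 1, by omega⟩
      rw [iteratedFDeriv_add_two_apply hf, iteratedFDeriv_add_two_apply hf]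
      have hC : ContDiff ℝ 2 (iteratedFDeriv ℝ n f) :=
        hf.iteratedFDeriv_right (by norm_cast; omega)
      have hs : IsSymmSndFDerivAt ℝ (iteratedFDeriv ℝ n f) x :=
        hC.contDiffAt.isSymmSndFDerivAt (by simp)
      have h0 : (v ∘ Equiv.swap (⟨0, by omega⟩ : Fin (n + 1 + 1)) ⟨0 + 1, hi⟩) 0 = v 1 := by
        simp [Equiv.swap_apply_left (0 : Fin (n + 1 + 1)) 1]
      have h1 : (v ∘ Equiv.swap (⟨0, by omega⟩ : Fin (n + 1 + 1)) ⟨0 + 1, hi⟩) 1 = v 0 := by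
        simp [Equiv.swap_apply_right (0 : Fin (n + 1 + 1)) 1]
      have h2 : Fin.tail (Fin.tail
          (v ∘ Equiv.swap (⟨0, by omega⟩ : Fin (n + 1 + 1)) ⟨0 + 1, hi⟩)) =
          Fin.tail (Fin.tail v) := by
        ext j
        simp only [Fin.tail, Function.comp]
        rw [Equiv.swap_apply_of_ne_of_ne] <;> simp [Fin.ext_iff]
      rw [h0, h1, h2, hs.eq]
    · have hd : DifferentiableAt ℝ (iteratedFDeriv ℝ n f) x :=
        hf.differentiable_iteratedFDeriv (by exact_mod_cast Nat.lt_succ_self n) x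
      rw [iteratedFDeriv_succ_apply_left, iteratedFDeriv_succ_apply_left,
        fderiv_continuousMultilinearMap_apply hd, fderiv_continuousMultilinearMap_apply hd]
      have h0 : (v ∘ Equiv.swap (⟨i + 1, by omega⟩ : Fin (n + 1)) ⟨i + 1 + 1, hi⟩) 0 = v 0 := by
        simp only [Function.comp]
        rw [Equiv.swap_apply_of_ne_of_ne] <;> simp [Fin.ext_iff]
      have h1 : Fin.tail (v ∘ Equiv.swap (⟨i + 1, by omega⟩ : Fin (n + 1)) ⟨i + 1 + 1, hi⟩) =
          Fin.tail v ∘ Equiv.swap (⟨i, by omega⟩ : Fin n) ⟨i + 1, by omega⟩ := by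
        ext j
        simp only [Fin.tail, Function.comp]
        congr 1
        rw [Equiv.swap_apply_def, Equiv.swap_apply_def]
        simp only [Fin.ext_iff, Fin.val_succ]
        split_ifs <;> simp_all
      have h2 : (fun y => iteratedFDeriv ℝ n f y
            (Fin.tail v ∘ Equiv.swap (⟨i, by omega⟩ : Fin n) ⟨i + 1, by omega⟩)) =
          fun y => iteratedFDeriv ℝ n f y (Fin.tail v) :=
        funext fun y => ih (hf.of_le (by exact_mod_cast Nat.le_succ n)) y _ i (by omega)
      rw [h0, h1, h2]

theorem iteratedFDeriv_comp_perm_of_contDiff {f : E → F} {n : ℕ} (hf : ContDiff ℝ n f) (x : E)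
    (v : Fin n → E) (σ : Equiv.Perm (Fin n)) :
    iteratedFDeriv ℝ n f x (v ∘ σ) = iteratedFDeriv ℝ n f x v := by
  rcases n with _ | n
  · congr 1
    ext i
    exact i.elim0
  have hσ : σ ∈ Submonoid.closure
      (Set.range fun i : Fin n => Equiv.swap i.castSucc i.succ) := by
    rw [Equiv.Perm.mclosure_swap_castSucc_succ]; trivial
  induction hσ using Submonoid.closure_induction generalizing v with
  | mem τ hτ =>
    obtain ⟨i, rfl⟩ := hτ
    exact iteratedFDeriv_comp_swap hf x v i (by omega)
  | one => rfl
  | mul τ τ' _ _ h1 h2 =>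
    rw [Equiv.Perm.coe_mul, ← Function.comp_assoc, h2, h1]

end Symmetric

/-! ### The Taylor polynomial and the derivatives of its error -/

section Taylor

variable {E : Type} [NormedAddCommGroup E] [InnerProductSpace ℝ E]

theorem hasFiniteFPowerSeriesOnBall_taylor (p : ℕ) (f : E → ℝ) (x : E) :
    HasFiniteFPowerSeriesOnBall (fun y => (jet p f x).taylor p x y)
      (fun k => (1 / (k ! : ℝ)) • jet p f x k) x (p + 1) ⊤ := by
  refine HasFiniteFPowerSeriesOnBall.mk' (fun m hm => ?_) (by simp) (fun y _ => ?_)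
  · simp [jet, show ¬ m ≤ p by omega]
  · simp [Jet.taylor]

theorem contDiff_taylor (p : ℕ) (f : E → ℝ) (x : E) {n : WithTop ℕ∞} :
    ContDiff ℝ n (fun y => (jet p f x).taylor p x y) := by
  refine contDiff_iff_contDiffAt.2 fun z => ?_
  have h := hasFiniteFPowerSeriesOnBall_taylor p f x
  exact (h.toHasFPowerSeriesOnBall.analyticAt_of_mem (by simp)).contDiffAt

/-- At the centre of a power series the `k`-th derivative is the sum of the `k`-th coefficient over
all permutations of its arguments. By symmetry the `k !` summands agree and cancel the factor `1 / k
!`. -/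
theorem iteratedFDeriv_taylor_self {p : ℕ} {f : E → ℝ} (hf : ContDiff ℝ p f) (x : E) {k : ℕ}
    (hk : k ≤ p) :
    iteratedFDeriv ℝ k (fun y => (jet p f x).taylor p x y) x = iteratedFDeriv ℝ k f x := by
  ext v
  have h := (hasFiniteFPowerSeriesOnBall_taylor p f x).toHasFPowerSeriesOnBall
  rw [h.iteratedFDeriv_eq_sum_of_completeSpace]
  have hs : ∀ σ : Equiv.Perm (Fin k),
      ((1 / (k ! : ℝ)) • jet p f x k) (fun i => v (σ i)) =
        1 / (k ! : ℝ) * iteratedFDeriv ℝ k f x v := by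
    intro σ
    have := iteratedFDeriv_comp_perm_of_contDiff (n := k) (hf.of_le (by exact_mod_cast hk)) x v σ
    simp only [smul_apply, jet, hk, if_true, smul_eq_mul]
    rw [← this]
    rfl
  rw [Finset.sum_congr rfl fun σ _ => hs σ]
  have : (k ! : ℝ) ≠ 0 := by positivity
  simp [Fintype.card_perm]
  field_simp

theorem iteratedFDeriv_taylor_const (p : ℕ) (f : E → ℝ) (x y z : E) :
    iteratedFDeriv ℝ p (fun y => (jet p f x).taylor p x y) y =
      iteratedFDeriv ℝ p (fun y => (jet p f x).taylor p x y) z := by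
  have hd : Differentiable ℝ (iteratedFDeriv ℝ p (fun y => (jet p f x).taylor p x y)) :=
    (contDiff_taylor p f x (n := (p + 1 : ℕ))).differentiable_iteratedFDeriv
      (by exact_mod_cast Nat.lt_succ_self p)
  refine is_const_of_fderiv_eq_zero hd (fun w => ?_) y z
  rw [← norm_eq_zero, norm_fderiv_iteratedFDeriv]
  exact norm_iteratedFDeriv_eq_zero_of_hasFiniteFPowerSeries
    (hasFiniteFPowerSeriesOnBall_taylor p f x) w

/-- The error of the Taylor polynomial of order `p` of `f` at `x`. -/
def taylorError (p : ℕ) (f : E → ℝ) (x y : E) : ℝ := f y - (jet p f x).taylor p x y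

variable {p : ℕ} {L : ℝ} {f : E → ℝ}

theorem contDiff_taylorError (hf : ContDiff ℝ p f) (x : E) : ContDiff ℝ p (taylorError p f x) :=
  hf.sub (contDiff_taylor p f x)

theorem iteratedFDeriv_taylorError (hf : ContDiff ℝ p f) (x y : E) {k : ℕ} (hk : k ≤ p) :
    iteratedFDeriv ℝ k (taylorError p f x) y =
      iteratedFDeriv ℝ k f y - iteratedFDeriv ℝ k (fun y => (jet p f x).taylor p x y) y := by
  have h1 : ContDiffAt ℝ k f y := (hf.of_le (by exact_mod_cast hk)).contDiffAt
  have h2 : ContDiffAt ℝ k (fun y => (jet p f x).taylor p x y) y :=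
    (contDiff_taylor p f x).contDiffAt
  exact iteratedFDeriv_sub_apply h1 h2

/-- All derivatives of the error up to order `p` vanish at `x`, and the one of order `p` is a
difference of two values of the `p`-th derivative of `f`, since that of the polynomial is constant.
-/
theorem norm_iteratedFDeriv_taylorError_le (hf : ContDiff ℝ p f)
    (hL : ∀ x y, ‖iteratedFDeriv ℝ p f x - iteratedFDeriv ℝ p f y‖ ≤ L * ‖x - y‖) (x z : E)
    {j : ℕ} (hj : j ≤ p) :
    ‖iteratedFDeriv ℝ (p - j) (taylorError p f x) z‖ ≤ L / (j + 1)! * ‖z - x‖ ^ (j + 1) := by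
  refine norm_iteratedFDeriv_le_of_vanishing (contDiff_taylorError hf x) (fun k hk => ?_)
    (fun z => ?_) hj z
  · rw [iteratedFDeriv_taylorError hf x x hk, iteratedFDeriv_taylor_self hf x hk, sub_self]
  · rw [iteratedFDeriv_taylorError hf x z le_rfl, iteratedFDeriv_taylor_const p f x z x,
      iteratedFDeriv_taylor_self hf x le_rfl]
    exact hL z x

theorem norm_fderiv_taylorError_le (hp : 1 ≤ p) (hf : ContDiff ℝ p f)
    (hL : ∀ x y, ‖iteratedFDeriv ℝ p f x - iteratedFDeriv ℝ p f y‖ ≤ L * ‖x - y‖) (x z : E) :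
    ‖fderiv ℝ (taylorError p f x) z‖ ≤ L / p ! * ‖z - x‖ ^ p := by
  have := norm_iteratedFDeriv_taylorError_le hf hL x z (j := p - 1) (by omega)
  rw [show p - (p - 1) = 0 + 1 by omega, ← norm_fderiv_iteratedFDeriv,
    show p - 1 + 1 = p by omega] at this
  rw [norm_fderiv_iteratedFDeriv, ← norm_iteratedFDeriv_fderiv, norm_iteratedFDeriv_zero] at this
  exact this

theorem norm_fderiv_taylorError_sub_le (hp : 1 ≤ p) (hf : ContDiff ℝ p f)
    (hL : ∀ x y, ‖iteratedFDeriv ℝ p f x - iteratedFDeriv ℝ p f y‖ ≤ L * ‖x - y‖) (x y z : E)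
    {B : ℝ} (hy : ‖y - x‖ ≤ B) (hz : ‖z - x‖ ≤ B) (hL0 : 0 ≤ L) :
    ‖fderiv ℝ (taylorError p f x) y - fderiv ℝ (taylorError p f x) z‖ ≤
      L / (p - 1)! * B ^ (p - 1) * ‖y - z‖ := by
  -- For `p = 1` a second derivative need not exist. There the derivative of the error differs from
  -- that of `f` by a constant, so the Lipschitz assumption applies directly; for larger `p` the
  -- second derivative of the error is bounded on the ball.
  rcases hp.eq_or_lt with rfl | hp2
  · have key : ∀ w, fderiv ℝ (taylorError 1 f x) w =
        continuousMultilinearCurryFin1 ℝ E ℝ (iteratedFDeriv ℝ 1 (taylorError 1 f x) w) := by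
      intro w; ext v; simp
    rw [key, key, ← map_sub, LinearIsometryEquiv.norm_map,
      iteratedFDeriv_taylorError hf x y le_rfl, iteratedFDeriv_taylorError hf x z le_rfl,
      iteratedFDeriv_taylor_const 1 f x y z, sub_sub_sub_cancel_right]
    simpa using hL y z
  · have hd : Differentiable ℝ (fderiv ℝ (taylorError p f x)) :=
      ((contDiff_taylorError hf x).fderiv_right (m := 1) (by norm_cast)).differentiable (by simp)
    have hB : 0 ≤ B := (norm_nonneg _).trans hy
    refine (convex_closedBall x B).norm_image_sub_le_of_norm_fderiv_le (𝕜 := ℝ)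
      (fun w _ => hd w) (fun w hw => ?_) (by simpa [dist_eq_norm] using hz)
      (by simpa [dist_eq_norm] using hy)
    rw [← norm_iteratedFDeriv_zero (𝕜 := ℝ) (f := fderiv ℝ (fderiv ℝ (taylorError p f x))),
      norm_iteratedFDeriv_fderiv, norm_iteratedFDeriv_fderiv]
    have := norm_iteratedFDeriv_taylorError_le hf hL x w (j := p - 2) (by omega)
    rw [show p - (p - 2) = 0 + 1 + 1 by omega, show p - 2 + 1 = p - 1 by omega] at this
    refine this.trans ?_
    have hw' : ‖w - x‖ ≤ B := by simpa [dist_eq_norm] using hw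
    gcongr

/-- The function `f` drops out, leaving a difference `q` of two Taylor polynomials. At `x'` the
derivatives of `q` are, up to sign, those of the Taylor error at `x`, hence proportional to `‖x -
x'‖`; integrating from `x'`, one order at a time, carries this to `y`. It controls how a tensor step
depends on its base point. -/
theorem norm_fderiv_taylorError_sub_base_le (hp : 1 ≤ p) (hf : ContDiff ℝ p f)
    (hL : ∀ x y, ‖iteratedFDeriv ℝ p f x - iteratedFDeriv ℝ p f y‖ ≤ L * ‖x - y‖) (x x' y : E)
    {B : ℝ} (hy : ‖y - x‖ ≤ B) (hy' : ‖y - x'‖ ≤ B) (hL0 : 0 ≤ L) :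
    ‖fderiv ℝ (taylorError p f x) y - fderiv ℝ (taylorError p f x') y‖ ≤
      p * L * (2 * B) ^ (p - 1) * ‖x - x'‖ := by
  have hB : 0 ≤ B := (norm_nonneg _).trans hy
  have hΔ : ‖x - x'‖ ≤ 2 * B := by
    have := norm_sub_le (y - x') (y - x)
    rw [sub_sub_sub_cancel_left] at this
    linarith
  set q : E → ℝ := fun y => (jet p f x).taylor p x y - (jet p f x').taylor p x' y with hq
  have hqd : ∀ n : WithTop ℕ∞, ContDiff ℝ n q := fun n =>
    (contDiff_taylor p f x).sub (contDiff_taylor p f x')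
  have hqi : ∀ k z, iteratedFDeriv ℝ k q z =
      iteratedFDeriv ℝ k (fun y => (jet p f x).taylor p x y) z -
        iteratedFDeriv ℝ k (fun y => (jet p f x').taylor p x' y) z := fun k z =>
    iteratedFDeriv_sub_apply (contDiff_taylor p f x).contDiffAt (contDiff_taylor p f x').contDiffAt
  have h0 : ∀ j ≤ p, ‖iteratedFDeriv ℝ (p - j) q x'‖ ≤ L * ‖x - x'‖ * (2 * B) ^ j := by
    intro j hj
    have h1 := norm_iteratedFDeriv_taylorError_le hf hL x x' hj
    rw [iteratedFDeriv_taylorError hf x x' (by omega), norm_sub_rev, norm_sub_rev x' x] at h1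
    rw [hqi, iteratedFDeriv_taylor_self hf x' (by omega : p - j ≤ p)]
    refine h1.trans ?_
    have h2 : L / ((j + 1)! : ℝ) ≤ L :=
      div_le_self hL0 (by exact_mod_cast Nat.succ_le_of_lt (Nat.factorial_pos _))
    calc L / ((j + 1)! : ℝ) * ‖x - x'‖ ^ (j + 1) ≤ L * (‖x - x'‖ * ‖x - x'‖ ^ j) := by
          rw [pow_succ']; gcongr
      _ ≤ L * (‖x - x'‖ * (2 * B) ^ j) := by gcongr
      _ = _ := by ring
  have main : ∀ j ≤ p, ∀ z, ‖z - x'‖ ≤ B →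
      ‖iteratedFDeriv ℝ (p - j) q z‖ ≤ (j + 1) * (L * ‖x - x'‖ * (2 * B) ^ j) := by
    intro j
    induction j with
    | zero =>
      intro _ z _
      have : iteratedFDeriv ℝ p q z = iteratedFDeriv ℝ p q x' := by
        rw [hqi, hqi, iteratedFDeriv_taylor_const p f x z x',
          iteratedFDeriv_taylor_const p f x' z x']
      simpa [this] using h0 0 (by omega)
    | succ j ih =>
      intro hj z hz
      have hd : Differentiable ℝ (iteratedFDeriv ℝ (p - (j + 1)) q) :=
        (hqd p).differentiable_iteratedFDeriv (by exact_mod_cast (by omega : p - (j + 1) < p))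
      have := norm_le_of_norm_fderiv_le_closedBall hd (c := x') (h0 (j + 1) hj)
        (B := B) (M := (j + 1) * (L * ‖x - x'‖ * (2 * B) ^ j)) (fun w hw => by
          rw [norm_fderiv_iteratedFDeriv, show p - (j + 1) + 1 = p - j by omega]
          exact ih (by omega) w hw) hz
      refine this.trans ?_
      have h3 : 0 ≤ L * ‖x - x'‖ * (2 * B) ^ j * B * (j + 1) := by positivity
      push_cast
      rw [pow_succ]
      nlinarith
  have h1 := main (p - 1) (by omega) y hy'
  rw [show p - (p - 1) = 0 + 1 by omega, ← norm_iteratedFDeriv_fderiv,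
    norm_iteratedFDeriv_zero] at h1
  have h2 : fderiv ℝ q y =
      fderiv ℝ (taylorError p f x') y - fderiv ℝ (taylorError p f x) y := by
    have hdf : DifferentiableAt ℝ f y := hf.differentiable (by simp; omega) y
    have hd1 : DifferentiableAt ℝ (fun y => (jet p f x).taylor p x y) y :=
      (contDiff_taylor p f x (n := 1)).differentiable (by simp) y
    have hd2 : DifferentiableAt ℝ (fun y => (jet p f x').taylor p x' y) y :=
      (contDiff_taylor p f x' (n := 1)).differentiable (by simp) y
    unfold taylorError
    rw [hq, fderiv_fun_sub hd1 hd2, fderiv_fun_sub hdf hd1, fderiv_fun_sub hdf hd2]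
    abel
  rw [h2, norm_sub_rev] at h1
  refine h1.trans (le_of_eq ?_)
  rw [Nat.cast_sub hp]
  push_cast
  ring

end Taylor

/-! ## Powers of the norm -/

section NormPow

/-- A bound, independent of the space, for the derivative of order `n` of `‖·‖ ^ m` on the unit
sphere. -/
def normPowConst (n m : ℕ) : ℝ :=
  n ! * (∑ i ∈ Finset.range (n + 1),
    ‖iteratedFDerivWithin ℝ i (fun t : ℝ => t ^ ((m : ℝ) / 2)) (Set.Ioi 0) 1‖) * 2 ^ n

theorem normPowConst_nonneg (n m : ℕ) : 0 ≤ normPowConst n m := by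
  unfold normPowConst; positivity

variable {E : Type*} [NormedAddCommGroup E] [InnerProductSpace ℝ E]

theorem fderiv_norm_sq_eq : fderiv ℝ (fun y : E => ‖y‖ ^ 2) = fun y => (2 : ℝ) • innerSL ℝ y := by
  funext y
  rw [fderiv_norm_sq_apply]
  ext v
  simp

/-- The form `D ^ i` with `D = 2 * c` is what the bound for derivatives of a composition requires of
the inner function; orders above two vanish. -/
theorem norm_iteratedFDeriv_const_mul_norm_sq_le (y : E) {c : ℝ} (hc : 0 ≤ c)
    (hcy : c * ‖y‖ ≤ 1) {i : ℕ} (hi : 1 ≤ i) :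
    ‖iteratedFDeriv ℝ i (fun y : E => c ^ 2 * ‖y‖ ^ 2) y‖ ≤ (2 * c) ^ i := by
  set b : E →L[ℝ] E →L[ℝ] ℝ := (innerₗ E).mkContinuous₂ 1
    (fun v w => by simpa using norm_inner_le_norm (𝕜 := ℝ) v w) with hb
  have hb1 : ‖b‖ ≤ 1 := LinearMap.mkContinuous₂_norm_le _ zero_le_one _
  have h1 : fderiv ℝ (fun y : E => c ^ 2 * ‖y‖ ^ 2) = ⇑((c ^ 2 * 2) • b) := by
    funext y
    have hd : DifferentiableAt ℝ (fun y : E => ‖y‖ ^ 2) y := (differentiableAt_id).norm_sq ℝ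
    rw [fderiv_const_mul hd, fderiv_norm_sq_eq]
    ext v
    simp [mul_assoc, hb]
  have h2 : fderiv ℝ (⇑((c ^ 2 * 2) • b)) = fun _ => (c ^ 2 * 2) • b := by
    funext y
    exact ContinuousLinearMap.fderiv _
  have h3 : ‖(c ^ 2 * 2) • b‖ ≤ c ^ 2 * 2 := by
    refine (ContinuousLinearMap.opNorm_smul_le _ b).trans ?_
    rw [Real.norm_of_nonneg (by positivity)]
    exact mul_le_of_le_one_right (by positivity) hb1
  obtain ⟨j, rfl⟩ : ∃ j, i = j + 1 := ⟨i - 1, by omega⟩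
  rw [← norm_iteratedFDeriv_fderiv, h1]
  rcases j with _ | j
  · rw [norm_iteratedFDeriv_zero]
    refine (ContinuousLinearMap.le_opNorm _ _).trans ?_
    calc _ ≤ c ^ 2 * 2 * ‖y‖ := by gcongr
      _ = 2 * c * (c * ‖y‖) := by ring
      _ ≤ 2 * c * 1 := by gcongr
      _ = _ := by ring
  · rw [← norm_iteratedFDeriv_fderiv, h2]
    rcases j with _ | j
    · rw [norm_iteratedFDeriv_zero]
      refine h3.trans ?_
      norm_num
      nlinarith [sq_nonneg c]
    · rw [iteratedFDeriv_const_of_ne (by omega)]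
      simp
      positivity

/-- Scaling to the unit sphere: `‖z‖ ^ m` is `‖y‖ ^ m` times `t ^ (m / 2)` at `t = ‖z‖ ^ 2 / ‖y‖ ^
2`. At `z = y` the outer function is differentiated at `1`, so the constant depends neither on `y`
nor on the space. -/
theorem norm_iteratedFDeriv_norm_pow_le (n m : ℕ) {y : E} (hy : y ≠ 0) :
    ‖iteratedFDeriv ℝ n (fun y : E => ‖y‖ ^ m) y‖ ≤ normPowConst n m * (‖y‖ ^ m / ‖y‖ ^ n) := by
  have hy0 : 0 < ‖y‖ := norm_pos_iff.2 hy
  set c : ℝ := ‖y‖⁻¹ with hc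
  have hc0 : 0 < c := inv_pos.2 hy0
  set g : ℝ → ℝ := fun t => t ^ ((m : ℝ) / 2)
  set f : E → ℝ := fun y => c ^ 2 * ‖y‖ ^ 2
  have hfy : f y = 1 := by
    change c ^ 2 * ‖y‖ ^ 2 = 1
    rw [hc]; field_simp
  have hfpos : ∀ z : E, z ≠ 0 → 0 < f z := fun z hz => by
    have := norm_pos_iff.2 hz
    change 0 < c ^ 2 * ‖z‖ ^ 2
    positivity
  have hfun : (fun z : E => ‖z‖ ^ m) = fun z => ‖y‖ ^ m • (g ∘ f) z := by
    funext z
    change ‖z‖ ^ m = ‖y‖ ^ m * (c ^ 2 * ‖z‖ ^ 2) ^ ((m : ℝ) / 2)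
    rw [← mul_pow, ← Real.rpow_natCast (c * ‖z‖) 2, ← Real.rpow_mul (by positivity),
      show ((2 : ℕ) : ℝ) * ((m : ℝ) / 2) = m by push_cast; ring, Real.rpow_natCast, ← mul_pow,
      ← mul_assoc, hc, mul_inv_cancel₀ hy0.ne', one_mul]
  have hs : IsOpen ({0}ᶜ : Set E) := isOpen_compl_singleton
  have hg : ContDiffOn ℝ n g (Set.Ioi 0) := fun t ht =>
    (Real.contDiffAt_rpow_const_of_ne (ne_of_gt ht)).contDiffWithinAt
  have hf : ContDiff ℝ n f := contDiff_const.mul (contDiff_norm_sq ℝ)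
  have hmaps : Set.MapsTo f ({0}ᶜ : Set E) (Set.Ioi 0) := fun z hz => hfpos z hz
  have hgf : ContDiffOn ℝ n (g ∘ f) ({0}ᶜ : Set E) := hg.comp hf.contDiffOn hmaps
  have hbound := norm_iteratedFDerivWithin_comp_le (n := n) (x := y) hg
    hf.contDiffOn le_rfl (isOpen_Ioi.uniqueDiffOn) hs.uniqueDiffOn hmaps hy
    (C := ∑ i ∈ Finset.range (n + 1),
      ‖iteratedFDerivWithin ℝ i (fun t : ℝ => t ^ ((m : ℝ) / 2)) (Set.Ioi 0) 1‖) (D := 2 * c)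
    (fun i hi => by
      rw [hfy]
      exact Finset.single_le_sum (f := fun i =>
        ‖iteratedFDerivWithin ℝ i (fun t : ℝ => t ^ ((m : ℝ) / 2)) (Set.Ioi 0) 1‖)
        (fun _ _ => norm_nonneg _) (Finset.mem_range.2 (by omega)))
    (fun i hi _ => by
      rw [iteratedFDerivWithin_of_isOpen i hs hy]
      exact norm_iteratedFDeriv_const_mul_norm_sq_le y hc0.le
        (by rw [hc, inv_mul_cancel₀ hy0.ne']) hi)
  rw [iteratedFDerivWithin_of_isOpen n hs hy] at hbound
  rw [hfun, iteratedFDeriv_const_smul_apply' (hgf.contDiffAt (hs.mem_nhds hy)), norm_smul,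
    Real.norm_of_nonneg (by positivity)]
  calc _ ≤ ‖y‖ ^ m * _ := mul_le_mul_of_nonneg_left hbound (by positivity)
    _ = _ := by
      unfold normPowConst
      rw [mul_pow, hc, inv_pow]
      ring

theorem contDiffAt_norm_pow {y : E} (hy : y ≠ 0) (m : ℕ) {n : WithTop ℕ∞} :
    ContDiffAt ℝ n (fun y : E => ‖y‖ ^ m) y :=
  (contDiffAt_norm ℝ hy).pow m

/-- For `k < p` the bound away from the origin has exponent `p + 1 - k ≥ 2`, so the `k`-th
derivative is `o(‖y‖)` and the next one vanishes at the origin. -/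
theorem iteratedFDeriv_norm_pow_zero {p k : ℕ} (hk : k ≤ p) :
    iteratedFDeriv ℝ k (fun y : E => ‖y‖ ^ (p + 1)) 0 = 0 := by
  induction k with
  | zero =>
    ext v
    simp
  | succ k ih =>
    have h0 := ih (by omega)
    have hd : HasFDerivAt (iteratedFDeriv ℝ k (fun y : E => ‖y‖ ^ (p + 1)))
        (0 : E →L[ℝ] ContinuousMultilinearMap ℝ (fun _ : Fin k => E) ℝ) 0 := by
      refine HasFDerivAt.of_isLittleO ?_
      simp only [h0, sub_zero, zero_apply]
      refine Asymptotics.IsBigO.trans_isLittleO (g := fun y : E => ‖y‖ ^ 2) ?_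
        (by simpa using (Asymptotics.isLittleO_norm_pow_id one_lt_two (E' := E)))
      refine Asymptotics.IsBigO.of_bound (normPowConst k (p + 1)) ?_
      filter_upwards [Metric.ball_mem_nhds (0 : E) one_pos] with y hy
      rcases eq_or_ne y 0 with rfl | hy0
      · simp [h0]
      · have hy1 : ‖y‖ < 1 := by simpa using hy
        have hpos : 0 < ‖y‖ := norm_pos_iff.2 hy0
        refine (norm_iteratedFDeriv_norm_pow_le k (p + 1) hy0).trans ?_
        refine mul_le_mul_of_nonneg_left ?_ (normPowConst_nonneg _ _)
        rw [Real.norm_of_nonneg (by positivity), div_le_iff₀ (by positivity), ← pow_add]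
        exact pow_le_pow_of_le_one hpos.le hy1.le (by omega)
    rw [← norm_eq_zero, ← norm_fderiv_iteratedFDeriv, hd.fderiv]
    exact ContinuousLinearMap.opNorm_zero

theorem norm_iteratedFDeriv_norm_pow_le' (p : ℕ) {k : ℕ} (hk : k ≤ p) (y : E) :
    ‖iteratedFDeriv ℝ k (fun y : E => ‖y‖ ^ (p + 1)) y‖ ≤
      normPowConst k (p + 1) * ‖y‖ ^ (p + 1 - k) := by
  rcases eq_or_ne y 0 with rfl | hy
  · rw [iteratedFDeriv_norm_pow_zero hk]
    simp [show p + 1 - k ≠ 0 by omega]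
  · have hpos : 0 < ‖y‖ := norm_pos_iff.2 hy
    have := norm_iteratedFDeriv_norm_pow_le k (p + 1) hy
    rwa [div_eq_mul_inv, ← pow_sub₀ _ hpos.ne' (by omega)] at this

theorem contDiff_norm_pow (p : ℕ) : ContDiff ℝ p (fun y : E => ‖y‖ ^ (p + 1)) := by
  have hat : ∀ y : E, y ≠ 0 → ∀ k : ℕ,
      DifferentiableAt ℝ (iteratedFDeriv ℝ k (fun y : E => ‖y‖ ^ (p + 1))) y := fun y hy k =>
    (contDiffAt_norm_pow hy (p + 1) (n := (k + 1 : ℕ))).differentiableAt_iteratedFDeriv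
      (by exact_mod_cast Nat.lt_succ_self k)
  have hc : ∀ k : ℕ, k ≤ p → Continuous (iteratedFDeriv ℝ k (fun y : E => ‖y‖ ^ (p + 1))) := by
    intro k hk
    refine continuous_iff_continuousAt.2 fun y => ?_
    rcases eq_or_ne y 0 with rfl | hy
    · rw [ContinuousAt, iteratedFDeriv_norm_pow_zero hk, tendsto_zero_iff_norm_tendsto_zero]
      refine squeeze_zero (fun _ => norm_nonneg _)
        (fun y => norm_iteratedFDeriv_norm_pow_le' p hk y) ?_
      have : Continuous fun y : E => normPowConst k (p + 1) * ‖y‖ ^ (p + 1 - k) := by fun_prop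
      simpa [show p + 1 - k ≠ 0 by omega] using this.tendsto 0
    · exact (hat y hy k).continuousAt
  refine contDiff_iff_continuous_differentiable.2
    ⟨fun k hk => hc k (by exact_mod_cast hk), fun k hk y => ?_⟩
  rcases eq_or_ne y 0 with rfl | hy
  · have hk' : k < p := by exact_mod_cast hk
    have h0 : iteratedFDeriv ℝ k (fun y : E => ‖y‖ ^ (p + 1)) 0 = 0 :=
      iteratedFDeriv_norm_pow_zero hk'.le
    refine HasFDerivAt.differentiableAt
      (f' := (0 : E →L[ℝ] ContinuousMultilinearMap ℝ (fun _ : Fin k => E) ℝ)) ?_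
    refine HasFDerivAt.of_isLittleO ?_
    simp only [h0, sub_zero, zero_apply]
    refine Asymptotics.IsBigO.trans_isLittleO (g := fun y : E => ‖y‖ ^ (p + 1 - k))
      (Asymptotics.IsBigO.of_bound (normPowConst k (p + 1)) (Filter.Eventually.of_forall fun y => ?_))
      (by simpa using (Asymptotics.isLittleO_norm_pow_id (by omega : 1 < p + 1 - k) (E' := E)))
    rw [Real.norm_of_nonneg (by positivity : 0 ≤ ‖y‖ ^ (p + 1 - k))]
    exact norm_iteratedFDeriv_norm_pow_le' p hk'.le y
  · exact hat y hy k

/-- By homogeneity the derivative of order `p + 1` is bounded away from the origin, and the mean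
value inequality applies on segments that avoid it. On a segment through the origin `‖x‖ + ‖y‖ = ‖x
- y‖`, and the linear bound at the two ends suffices. -/
theorem norm_iteratedFDeriv_norm_pow_sub_le (p : ℕ) (x y : E) :
    ‖iteratedFDeriv ℝ p (fun y : E => ‖y‖ ^ (p + 1)) x -
      iteratedFDeriv ℝ p (fun y : E => ‖y‖ ^ (p + 1)) y‖ ≤
      (normPowConst p (p + 1) + normPowConst (p + 1) (p + 1)) * ‖x - y‖ := by
  have hp0 := normPowConst_nonneg p (p + 1)
  have hp1 := normPowConst_nonneg (p + 1) (p + 1)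
  by_cases h0 : (0 : E) ∈ segment ℝ y x
  · obtain ⟨a, b, ha, hb, hab, h⟩ := h0
    have hx := norm_iteratedFDeriv_norm_pow_le' p le_rfl x
    have hy := norm_iteratedFDeriv_norm_pow_le' p le_rfl y
    rw [show p + 1 - p = 1 by omega, pow_one] at hx hy
    have hsum : ‖x‖ + ‖y‖ = ‖x - y‖ := by
      have h1 : x = a • (x - y) := by
        have : x = (a + b) • x := by rw [hab, one_smul]
        rw [smul_sub, eq_sub_iff_add_eq, ← sub_eq_zero]
        calc x + a • y - a • x = (a • y + b • x) + (x - (a + b) • x) := by module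
          _ = 0 := by rw [h, ← this]; simp
      have h2 : y = (-b) • (x - y) := by
        have : y = (a + b) • y := by rw [hab, one_smul]
        rw [← sub_eq_zero]
        calc y - (-b) • (x - y) = (a • y + b • x) + (y - (a + b) • y) := by module
          _ = 0 := by rw [h, ← this]; simp
      have h3 : ‖x‖ = a * ‖x - y‖ := by
        conv_lhs => rw [h1]
        rw [norm_smul, Real.norm_of_nonneg ha]
      have h4 : ‖y‖ = b * ‖x - y‖ := by
        conv_lhs => rw [h2]
        rw [norm_smul, norm_neg, Real.norm_of_nonneg hb]
      rw [h3, h4, ← add_mul, hab, one_mul]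
    calc _ ≤ _ := norm_sub_le _ _
      _ ≤ normPowConst p (p + 1) * ‖x - y‖ := by rw [← hsum, mul_add]; exact add_le_add hx hy
      _ ≤ _ := by gcongr; linarith
  · have hne : ∀ z ∈ segment ℝ y x, z ≠ 0 := fun z hz hz0 => h0 (hz0 ▸ hz)
    refine ((convex_segment y x).norm_image_sub_le_of_norm_fderiv_le (𝕜 := ℝ)
      (C := normPowConst (p + 1) (p + 1)) (fun z hz => ?_) (fun z hz => ?_)
      (left_mem_segment ℝ y x) (right_mem_segment ℝ y x)).trans ?_
    · exact (contDiffAt_norm_pow (hne z hz) (p + 1)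
        (n := (p + 1 : ℕ))).differentiableAt_iteratedFDeriv
        (by exact_mod_cast Nat.lt_succ_self p)
    · rw [norm_fderiv_iteratedFDeriv]
      refine (norm_iteratedFDeriv_norm_pow_le (p + 1) (p + 1) (hne z hz)).trans (le_of_eq ?_)
      rw [div_self (by have := norm_pos_iff.2 (hne z hz); positivity), mul_one]
    · gcongr; linarith

/-- Strong monotonicity of the gradient of a power of the norm. -/
theorem inner_norm_pow_smul_sub_ge (n : ℕ) (x y : E) :
    (1 / 2 : ℝ) * (max ‖x‖ ‖y‖) ^ n * ‖x - y‖ ^ 2 ≤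
      inner ℝ (‖x‖ ^ n • x - ‖y‖ ^ n • y) (x - y) := by
  have h1 : inner ℝ (‖x‖ ^ n • x - ‖y‖ ^ n • y) (x - y) =
      (1 / 2 : ℝ) * (‖x‖ ^ n + ‖y‖ ^ n) * ‖x - y‖ ^ 2 +
        (1 / 2 : ℝ) * ((‖x‖ ^ n - ‖y‖ ^ n) * (‖x‖ ^ 2 - ‖y‖ ^ 2)) := by
    rw [@norm_sub_sq_real]
    simp only [inner_sub_left, inner_sub_right, inner_smul_left, real_inner_self_eq_norm_sq,
      real_inner_comm x y, RCLike.conj_to_real]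
    ring
  have h2 : 0 ≤ (‖x‖ ^ n - ‖y‖ ^ n) * (‖x‖ ^ 2 - ‖y‖ ^ 2) := by
    rcases le_total ‖x‖ ‖y‖ with h | h
    · exact mul_nonneg_of_nonpos_of_nonpos (by simpa using pow_le_pow_left₀ (norm_nonneg x) h n)
        (by simpa using pow_le_pow_left₀ (norm_nonneg x) h 2)
    · exact mul_nonneg (by simpa using pow_le_pow_left₀ (norm_nonneg y) h n)
        (by simpa using pow_le_pow_left₀ (norm_nonneg y) h 2)
  have h3 : (max ‖x‖ ‖y‖) ^ n ≤ ‖x‖ ^ n + ‖y‖ ^ n := by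
    rcases max_choice ‖x‖ ‖y‖ with h | h <;> rw [h]
    · linarith [pow_nonneg (norm_nonneg y) n]
    · linarith [pow_nonneg (norm_nonneg x) n]
  rw [h1]
  have := mul_le_mul_of_nonneg_right h3 (sq_nonneg ‖x - y‖)
  linarith

theorem norm_norm_pow_smul_sub_le (n : ℕ) (x y : E) {B : ℝ} (hx : ‖x‖ ≤ B) (hy : ‖y‖ ≤ B) :
    ‖‖x‖ ^ n • x - ‖y‖ ^ n • y‖ ≤ (n + 1) * B ^ n * ‖x - y‖ := by
  have hB : 0 ≤ B := (norm_nonneg x).trans hx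
  induction n with
  | zero => simp
  | succ n ih =>
    have h : ‖x‖ ^ (n + 1) • x - ‖y‖ ^ (n + 1) • y =
        ‖x‖ • (‖x‖ ^ n • x - ‖y‖ ^ n • y) + (‖x‖ - ‖y‖) • (‖y‖ ^ n • y) := by
      rw [pow_succ, pow_succ]; module
    rw [h]
    refine (norm_add_le _ _).trans ?_
    rw [norm_smul, norm_smul, norm_smul, norm_norm, norm_pow, norm_norm, Real.norm_eq_abs,
      ← pow_succ]
    have h1 := abs_norm_sub_norm_le x y
    calc ‖x‖ * ‖‖x‖ ^ n • x - ‖y‖ ^ n • y‖ + |‖x‖ - ‖y‖| * ‖y‖ ^ (n + 1)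
        ≤ B * ((n + 1) * B ^ n * ‖x - y‖) + ‖x - y‖ * B ^ (n + 1) := by gcongr
      _ = _ := by push_cast; ring

variable [CompleteSpace E]

theorem hasGradientAt_norm_pow {p : ℕ} (hp : 1 ≤ p) (x y : E) :
    HasGradientAt (fun y : E => ‖y - x‖ ^ (p + 1))
      (((p : ℝ) + 1) • ‖y - x‖ ^ (p - 1) • (y - x)) y := by
  have h := hasFDerivAt_norm_rpow (y - x) (p := (p : ℝ) + 1) (by
    have : (1 : ℝ) ≤ p := by exact_mod_cast hp
    linarith)
  have h1 : HasFDerivAt (fun y : E => ‖y - x‖ ^ (p + 1))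
      ((((p : ℝ) + 1) * ‖y - x‖ ^ ((p : ℝ) + 1 - 2)) • innerSL ℝ (y - x)) y := by
    have := h.comp y ((hasFDerivAt_id y).sub_const x)
    rw [ContinuousLinearMap.comp_id] at this
    refine this.congr_of_eventuallyEq (Filter.Eventually.of_forall fun z => ?_)
    change _ = ‖z - x‖ ^ ((p : ℝ) + 1)
    exact_mod_cast (Real.rpow_natCast ‖z - x‖ (p + 1)).symm
  rw [hasGradientAt_iff_hasFDerivAt]
  convert! h1 using 1
  ext v
  have : (p : ℝ) + 1 - 2 = ((p - 1 : ℕ) : ℝ) := by push_cast [hp]; ring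
  rw [this, Real.rpow_natCast]
  simp [mul_assoc]

end NormPow

/-! ## Gradients of regularised Taylor models -/

section ModelGradient

variable {E : Type*} [NormedAddCommGroup E] [InnerProductSpace ℝ E]

/-- The properties of the gradient `Err x y` at `y` of the error of the Taylor polynomial at `x` of
a function whose `p`-th derivative is Lipschitz with constant `H / 2`. -/
structure ModelErr (p : ℕ) (H : ℝ) (Err : E → E → E) : Prop where
  bound : ∀ x y, ‖Err x y‖ ≤ H / 2 / p ! * ‖y - x‖ ^ p
  lip : ∀ x y z B, ‖y - x‖ ≤ B → ‖z - x‖ ≤ B →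
    ‖Err x y - Err x z‖ ≤ H / 2 / (p - 1)! * B ^ (p - 1) * ‖y - z‖
  base : ∀ x x' y B, ‖y - x‖ ≤ B → ‖y - x'‖ ≤ B →
    ‖Err x y - Err x' y‖ ≤ p * (H / 2) * (2 * B) ^ (p - 1) * ‖x - x'‖

/-- The gradient at `y` of the regularised model at `x` plus the composite part, for an objective
with gradient `v`. -/
def modelGrad (p : ℕ) (H : ℝ) (v : E → E) (Err : E → E → E) (x y : E) : E :=
  v y - Err x y + (H * (p + 1) / p !) • ‖y - x‖ ^ (p - 1) • (y - x)

variable {p : ℕ} {H : ℝ} {v : E → E} {Err : E → E → E}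

theorem cast_factorial_eq_mul_pred (hp : 1 ≤ p) : (p ! : ℝ) = p * (p - 1)! := by
  exact_mod_cast (Nat.mul_factorial_pred (by omega)).symm

/-- On the ball of radius `B` the regulariser contributes monotonicity `H (p + 1) / (2 p !) * B ^ (p
- 1)`, while the error has Lipschitz constant `H p / (2 p !) * B ^ (p - 1)`; the difference remains.
-/
theorem modelGrad_inner_ge_max (hp : 1 ≤ p) (hH : 0 ≤ H) (hErr : ModelErr p H Err)
    (hv : ∀ x y, 0 ≤ inner ℝ (v x - v y) (x - y)) (x y z : E) :
    H / (2 * p !) * (max ‖y - x‖ ‖z - x‖) ^ (p - 1) * ‖y - z‖ ^ 2 ≤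
      inner ℝ (modelGrad p H v Err x y - modelGrad p H v Err x z) (y - z) := by
  set B := max ‖y - x‖ ‖z - x‖ with hB
  have h1 := inner_norm_pow_smul_sub_ge (p - 1) (y - x) (z - x)
  have h2 := hErr.lip x y z B (le_max_left _ _) (le_max_right _ _)
  have h3 := hv y z
  have h4 := real_inner_le_norm (Err x y - Err x z) (y - z)
  rw [sub_sub_sub_cancel_right] at h1
  have h5 : inner ℝ (modelGrad p H v Err x y - modelGrad p H v Err x z) (y - z) =
      inner ℝ (v y - v z) (y - z) - inner ℝ (Err x y - Err x z) (y - z) +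
      H * (p + 1) / p ! *
        inner ℝ (‖y - x‖ ^ (p - 1) • (y - x) - ‖z - x‖ ^ (p - 1) • (z - x)) (y - z) := by
    rw [← inner_sub_left, ← real_inner_smul_left, ← inner_add_left]
    congr 1
    unfold modelGrad
    module
  have hf : (0 : ℝ) < p ! := by positivity
  have hp0 : (0 : ℝ) < p := by exact_mod_cast hp
  have h6 : inner ℝ (Err x y - Err x z) (y - z) ≤ H * p / (2 * p !) * B ^ (p - 1) * ‖y - z‖ ^ 2 :=
    calc _ ≤ _ := h4
      _ ≤ H / 2 / (p - 1)! * B ^ (p - 1) * ‖y - z‖ * ‖y - z‖ := by gcongr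
      _ = _ := by
        rw [cast_factorial_eq_mul_pred hp]
        have : ((p - 1)! : ℝ) ≠ 0 := by positivity
        field_simp
  have h7 : H * (p + 1) / p ! * (1 / 2 * B ^ (p - 1) * ‖y - z‖ ^ 2) ≤ H * (p + 1) / p ! *
        inner ℝ (‖y - x‖ ^ (p - 1) • (y - x) - ‖z - x‖ ^ (p - 1) • (z - x)) (y - z) := by
    gcongr
  have h8 : H * (p + 1) / p ! * (1 / 2 * B ^ (p - 1) * ‖y - z‖ ^ 2) =
      H / (2 * p !) * B ^ (p - 1) * ‖y - z‖ ^ 2 +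
        H * p / (2 * p !) * B ^ (p - 1) * ‖y - z‖ ^ 2 := by
    field_simp
    ring
  rw [h5]
  linarith

theorem modelGrad_inner_ge (hp : 1 ≤ p) (hH : 0 ≤ H) (hErr : ModelErr p H Err)
    (hv : ∀ x y, 0 ≤ inner ℝ (v x - v y) (x - y)) (x y z : E) :
    H / (2 ^ p * p !) * ‖y - z‖ ^ (p + 1) ≤
      inner ℝ (modelGrad p H v Err x y - modelGrad p H v Err x z) (y - z) := by
  refine le_trans ?_ (modelGrad_inner_ge_max hp hH hErr hv x y z)
  have h1 : ‖y - z‖ ≤ 2 * max ‖y - x‖ ‖z - x‖ := by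
    have := norm_sub_le (y - x) (z - x)
    rw [sub_sub_sub_cancel_right] at this
    linarith [le_max_left ‖y - x‖ ‖z - x‖, le_max_right ‖y - x‖ ‖z - x‖]
  have h2 := pow_le_pow_left₀ (norm_nonneg _) h1 (p - 1)
  rw [mul_pow] at h2
  have h3 : ‖y - z‖ ^ (p + 1) = ‖y - z‖ ^ (p - 1) * ‖y - z‖ ^ 2 := by
    rw [← pow_add]; congr 1; omega
  have h4 : (2 : ℝ) ^ p = 2 ^ (p - 1) * 2 := by rw [← pow_succ]; congr 1; omega
  rw [h3]
  calc _ ≤ H / (2 ^ p * p !) *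
        (2 ^ (p - 1) * (max ‖y - x‖ ‖z - x‖) ^ (p - 1) * ‖y - z‖ ^ 2) := by gcongr
    _ = _ := by rw [h4]; field_simp

/-- The stability estimate behind everything that is said about inexact steps: it compares a step
with the minimiser, and the steps from two base points. -/
theorem norm_sub_pow_le_of_modelGrad (hp : 1 ≤ p) (hH : 0 < H) (hErr : ModelErr p H Err)
    (hv : ∀ x y, 0 ≤ inner ℝ (v x - v y) (x - y)) (x y z : E) :
    ‖y - z‖ ^ p ≤ 2 ^ p * p ! / H * ‖modelGrad p H v Err x y - modelGrad p H v Err x z‖ := by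
  have h1 := (modelGrad_inner_ge hp hH.le hErr hv x y z).trans (real_inner_le_norm _ _)
  rcases (norm_nonneg (y - z)).eq_or_lt with h | h
  · rw [← h, zero_pow (by omega)]
    positivity
  · rw [pow_succ, ← mul_assoc] at h1
    have h2 := le_of_mul_le_mul_right h1 h
    have : (0 : ℝ) < 2 ^ p * p ! := by positivity
    rw [div_mul_eq_mul_div, div_mul_eq_mul_div, div_le_iff₀ this] at *
    rw [le_div_iff₀ hH]
    linarith

theorem norm_regularizer_eq (hp : 1 ≤ p) (hH : 0 ≤ H) (x y : E) :
    ‖(H * (p + 1) / p !) • ‖y - x‖ ^ (p - 1) • (y - x)‖ =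
      H * (p + 1) / p ! * ‖y - x‖ ^ p := by
  rw [norm_smul, norm_smul, Real.norm_of_nonneg (by positivity), norm_pow, norm_norm, ← pow_succ]
  congr 3
  omega

theorem norm_modelGrad_sub_le (hp : 1 ≤ p) (hH : 0 ≤ H) (hErr : ModelErr p H Err) (x y : E) :
    ‖modelGrad p H v Err x y - v y‖ ≤ H * (p + 2) * ‖y - x‖ ^ p := by
  have h1 := hErr.bound x y
  have h2 := norm_regularizer_eq hp hH x y
  have h3 : modelGrad p H v Err x y - v y =
      (H * (p + 1) / p !) • ‖y - x‖ ^ (p - 1) • (y - x) - Err x y := by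
    unfold modelGrad; abel
  rw [h3]
  refine (norm_sub_le _ _).trans ?_
  rw [h2]
  have hf : (1 : ℝ) ≤ p ! := by exact_mod_cast Nat.succ_le_of_lt (Nat.factorial_pos p)
  have h4 : H / 2 / p ! ≤ H := (div_le_self (by positivity) hf).trans (by linarith)
  have h5 : H * (p + 1) / p ! ≤ H * (p + 1) := div_le_self (by positivity) hf
  have h6 : 0 ≤ ‖y - x‖ ^ p := by positivity
  nlinarith

theorem norm_modelGrad_sub_base_le (hp : 1 ≤ p) (hH : 0 ≤ H) (hErr : ModelErr p H Err)
    (x x' y : E) {B : ℝ} (hx : ‖y - x‖ ≤ B) (hx' : ‖y - x'‖ ≤ B) :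
    ‖modelGrad p H v Err x y - modelGrad p H v Err x' y‖ ≤
      H * (p * 2 ^ p + p * (p + 1)) * B ^ (p - 1) * ‖x - x'‖ := by
  have hB : 0 ≤ B := (norm_nonneg _).trans hx
  have h1 := hErr.base x x' y B hx hx'
  have h2 := norm_norm_pow_smul_sub_le (p - 1) (y - x) (y - x') hx hx'
  rw [sub_sub_sub_cancel_left, norm_sub_rev x' x] at h2
  have h3 : modelGrad p H v Err x y - modelGrad p H v Err x' y =
      (H * (p + 1) / p !) • (‖y - x‖ ^ (p - 1) • (y - x) - ‖y - x'‖ ^ (p - 1) • (y - x')) -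
        (Err x y - Err x' y) := by
    unfold modelGrad; module
  have hf : (1 : ℝ) ≤ p ! := by exact_mod_cast Nat.succ_le_of_lt (Nat.factorial_pos p)
  have h5 : H * (p + 1) / p ! ≤ H * (p + 1) := div_le_self (by positivity) hf
  have h4 : ((p - 1 : ℕ) : ℝ) + 1 = p := by push_cast [hp]; ring
  rw [h4] at h2
  rw [h3]
  refine (norm_sub_le _ _).trans ?_
  rw [norm_smul, Real.norm_of_nonneg (by positivity)]
  have h6 : (2 : ℝ) ^ (p - 1) ≤ 2 ^ p := pow_le_pow_right₀ one_le_two (by omega)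
  calc _ ≤ H * (p + 1) * (p * B ^ (p - 1) * ‖x - x'‖) +
        p * (H / 2) * (2 * B) ^ (p - 1) * ‖x - x'‖ := by gcongr
    _ ≤ H * (p + 1) * (p * B ^ (p - 1) * ‖x - x'‖) +
        p * H * (2 ^ p * B ^ (p - 1)) * ‖x - x'‖ := by
      rw [mul_pow]; gcongr; linarith
    _ = _ := by ring

end ModelGradient

/-! ### Constants of the step-size search -/

section Constants

/-- Distances between trial points and tensor steps, in units of the initial distance. -/
def stepRadius (p : ℕ) : ℝ := 2 * (p ! * (1 + (p + 2) * 3 ^ p)) + 3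

/-- The factor by which the accuracy of tensor steps exceeds the target accuracy. -/
def accuracyFactor (p : ℕ) : ℝ :=
  (16 * p) ^ p * (2 ^ p * p ! * (2 + 4 * (p * 2 ^ p + p * (p + 1)) * stepRadius p ^ (p - 1))) *
    (p + 2) * 2 + (64 * p) ^ p * (p + 2) * 2 + 10 * (p + 2)

theorem three_le_stepRadius (p : ℕ) : 3 ≤ stepRadius p := by
  unfold stepRadius
  have : (0 : ℝ) ≤ 2 * (p ! * (1 + (p + 2) * 3 ^ p)) := by positivity
  linarith

theorem le_accuracyFactor (p : ℕ) : 10 * ((p : ℝ) + 2) ≤ accuracyFactor p := by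
  have := three_le_stepRadius p
  unfold accuracyFactor
  have h1 : (0 : ℝ) ≤ (16 * p) ^ p * (2 ^ p * p ! *
    (2 + 4 * (p * 2 ^ p + p * (p + 1)) * stepRadius p ^ (p - 1))) * (p + 2) * 2 := by positivity
  have h2 : (0 : ℝ) ≤ (64 * (p : ℝ)) ^ p * (p + 2) * 2 := by positivity
  linarith

/-- The relative resolution of the search for step sizes. -/
def resolution (p : ℕ) (H δ D₀ : ℝ) : ℝ := δ / (accuracyFactor p * (δ + H * D₀ ^ p))

end Constants

/-! ## The tensor step of a convex objective -/

section TensorMethod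

variable {E : Type*} [NormedAddCommGroup E] [InnerProductSpace ℝ E]

/-- `Y` is an inexact tensor step for the convex function `Φ` with gradient `v` and minimiser `xs`,
on the ball of radius `3 D₀` around `xs`, where the accuracy `δ'` of the step is small compared to
the target accuracy `δ`. -/
structure TensorMethod (p : ℕ) (H δ δ' D₀ : ℝ) (Φ : E → ℝ) (v : E → E) (xs : E) (Err : E → E → E)
    (Y : E → E) : Prop where
  hp : 1 ≤ p
  H_pos : 0 < H
  δ_pos : 0 < δ
  D_pos : 0 < D₀
  acc_nonneg : 0 ≤ δ'
  acc_le : δ' ≤ δ / accuracyFactor p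
  acc_le' : δ' ≤ H * D₀ ^ p
  convex : ∀ x y, Φ x + inner ℝ (v x) (y - x) ≤ Φ y
  crit : v xs = 0
  err : ModelErr p H Err
  step : ∀ x, ‖x - xs‖ ≤ 3 * D₀ → ‖modelGrad p H v Err x (Y x)‖ ≤ δ'

namespace TensorMethod

variable {p : ℕ} {H δ δ' D₀ : ℝ} {Φ : E → ℝ} {v : E → E} {xs : E} {Err : E → E → E} {Y : E → E}

theorem monotone (h : TensorMethod p H δ δ' D₀ Φ v xs Err Y) (x y : E) :
    0 ≤ inner ℝ (v x - v y) (x - y) := by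
  have h1 := h.convex x y
  have h2 := h.convex y x
  rw [← neg_sub x y, inner_neg_right] at h1
  rw [inner_sub_left]
  linarith

theorem minimal (h : TensorMethod p H δ δ' D₀ Φ v xs Err Y) (y : E) : Φ xs ≤ Φ y := by
  simpa [h.crit] using h.convex xs y

/-- Stability between `Y x` and `xs`: as `v xs = 0`, the model gradient at `xs` is at most `H (p +
2) (3 D₀) ^ p`, and the residual adds at most `H D₀ ^ p`. This is the origin of `stepRadius`; its
summand 3 pays for passing from `xs` to a point of the ball. -/
theorem norm_tensorStep_sub_le (h : TensorMethod p H δ δ' D₀ Φ v xs Err Y) {x : E}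
    (hx : ‖x - xs‖ ≤ 3 * D₀) : ‖Y x - xs‖ ≤ (stepRadius p - 3) * D₀ := by
  have hH := h.H_pos
  have hD := h.D_pos
  have h1 := norm_sub_pow_le_of_modelGrad h.hp h.H_pos h.err h.monotone x (Y x) xs
  have h2 := h.step x hx
  have h3 := norm_modelGrad_sub_le (v := v) h.hp h.H_pos.le h.err x xs
  rw [h.crit, sub_zero, norm_sub_rev] at h3
  have h4 : ‖modelGrad p H v Err x (Y x) - modelGrad p H v Err x xs‖ ≤
      H * D₀ ^ p + H * (p + 2) * (3 * D₀) ^ p := by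
    refine (norm_sub_le _ _).trans (add_le_add (h2.trans h.acc_le') (h3.trans ?_))
    gcongr
  have hf : (1 : ℝ) ≤ p ! := by exact_mod_cast Nat.succ_le_of_lt (Nat.factorial_pos p)
  set u : ℝ := p ! * (1 + (p + 2) * 3 ^ p) with hu
  have hu1 : 1 ≤ u := by
    have : (0 : ℝ) ≤ (p + 2) * 3 ^ p := by positivity
    rw [hu]; nlinarith
  have h0 : ‖Y x - xs‖ ^ p ≤ (2 * u * D₀) ^ p := by
    refine h1.trans ?_
    calc _ ≤ 2 ^ p * p ! / H * (H * D₀ ^ p + H * (p + 2) * (3 * D₀) ^ p) := by gcongr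
      _ = 2 ^ p * u * D₀ ^ p := by rw [hu, mul_pow]; field_simp
      _ ≤ 2 ^ p * u ^ p * D₀ ^ p := by
        gcongr
        exact le_self_pow₀ hu1 (by have := h.hp; omega)
      _ = _ := by rw [mul_pow (2 * u), mul_pow 2]
  have h5 := le_of_pow_le_pow_left₀ (by have := h.hp; omega) (by positivity) h0
  refine h5.trans (le_of_eq ?_)
  rw [stepRadius, hu]; ring

theorem norm_tensorStep_sub_le' (h : TensorMethod p H δ δ' D₀ Φ v xs Err Y) {x x' : E}
    (hx : ‖x - xs‖ ≤ 3 * D₀) (hx' : ‖x' - xs‖ ≤ 3 * D₀) : ‖Y x - x'‖ ≤ stepRadius p * D₀ := by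
  have h1 := h.norm_tensorStep_sub_le hx
  have h2 := norm_sub_le (Y x - xs) (x' - xs)
  rw [sub_sub_sub_cancel_right] at h2
  linarith

/-- At the common point `Y x'` the two model gradients differ only through their base points, and
the residuals account for `2 * δ'`. -/
theorem norm_tensorStep_sub_tensorStep_le (h : TensorMethod p H δ δ' D₀ Φ v xs Err Y) {x x' : E}
    (hx : ‖x - xs‖ ≤ 3 * D₀) (hx' : ‖x' - xs‖ ≤ 3 * D₀) :
    ‖Y x - Y x'‖ ^ p ≤ 2 ^ p * p ! / H * (2 * δ' +
      H * (p * 2 ^ p + p * (p + 1)) * (stepRadius p * D₀) ^ (p - 1) * ‖x - x'‖) := by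
  have hH := h.H_pos
  have h1 := norm_sub_pow_le_of_modelGrad h.hp h.H_pos h.err h.monotone x (Y x) (Y x')
  have h2 := norm_modelGrad_sub_base_le (v := v) h.hp h.H_pos.le h.err x x' (Y x')
    (h.norm_tensorStep_sub_le' hx' hx) (h.norm_tensorStep_sub_le' hx' hx')
  have h3 := h.step x hx
  have h4 := h.step x' hx'
  refine h1.trans (mul_le_mul_of_nonneg_left ?_ (by positivity))
  have h5 : modelGrad p H v Err x (Y x) - modelGrad p H v Err x (Y x') =
      modelGrad p H v Err x (Y x) - modelGrad p H v Err x' (Y x') -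
        (modelGrad p H v Err x (Y x') - modelGrad p H v Err x' (Y x')) := by abel
  rw [h5]
  refine (norm_sub_le _ _).trans (add_le_add ?_ h2)
  exact (norm_sub_le _ _).trans (by linarith)

theorem norm_grad_tensorStep_le (h : TensorMethod p H δ δ' D₀ Φ v xs Err Y) {x : E}
    (hx : ‖x - xs‖ ≤ 3 * D₀) : ‖v (Y x)‖ ≤ δ' + H * (p + 2) * ‖Y x - x‖ ^ p := by
  have h1 := h.step x hx
  have h2 := norm_modelGrad_sub_le (v := v) h.hp h.H_pos.le h.err x (Y x)
  have h3 := norm_sub_le (modelGrad p H v Err x (Y x)) (modelGrad p H v Err x (Y x) - v (Y x))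
  rw [sub_sub_cancel] at h3
  linarith

theorem acc_mul_le (h : TensorMethod p H δ δ' D₀ Φ v xs Err Y) : 10 * (p + 2) * δ' ≤ δ := by
  have h1 := le_accuracyFactor p
  have h2 : (0 : ℝ) < accuracyFactor p := lt_of_lt_of_le (by positivity) h1
  have h3 := (le_div_iff₀ h2).1 h.acc_le
  nlinarith [h.acc_nonneg]

theorem acc_le_tenth (h : TensorMethod p H δ δ' D₀ Φ v xs Err Y) : δ' ≤ δ / 10 := by
  have h1 := h.acc_mul_le
  have h2 : 0 ≤ (p : ℝ) * δ' := mul_nonneg (Nat.cast_nonneg p) h.acc_nonneg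
  have := h.acc_nonneg
  linarith

/-- A large gradient forces a long step, because the model gradient is small there. Both the
bisection and the termination of the last round rest on this. -/
theorem le_norm_tensorStep_sub_pow (h : TensorMethod p H δ δ' D₀ Φ v xs Err Y) {x : E}
    (hx : ‖x - xs‖ ≤ 3 * D₀) (hδ : δ < ‖v (Y x)‖) :
    9 / 10 * δ ≤ H * (p + 2) * ‖Y x - x‖ ^ p := by
  have h1 := h.norm_grad_tensorStep_le hx
  have h2 := h.acc_le_tenth
  linarith

theorem tensorStep_sub_ne_zero (h : TensorMethod p H δ δ' D₀ Φ v xs Err Y) {x : E}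
    (hx : ‖x - xs‖ ≤ 3 * D₀) (hδ : δ < ‖v (Y x)‖) : 0 < ‖Y x - x‖ := by
  have h1 := h.le_norm_tensorStep_sub_pow hx hδ
  rcases (norm_nonneg (Y x - x)).eq_or_lt with h0 | h0
  · rw [← h0, zero_pow (by have := h.hp; omega)] at h1
    linarith [h.δ_pos]
  · exact h0

/-- An accepted step is an approximate proximal step. -/
theorem norm_smul_grad_add_le (h : TensorMethod p H δ δ' D₀ Φ v xs Err Y) {x : E}
    (hx : ‖x - xs‖ ≤ 3 * D₀) (hδ : δ < ‖v (Y x)‖) {l : ℝ} (hl : 0 < l)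
    (h1 : 1 / 2 ≤ l * (H * ‖Y x - x‖ ^ (p - 1) / (p - 1)!))
    (h2 : l * (H * ‖Y x - x‖ ^ (p - 1) / (p - 1)!) ≤ p / (p + 1)) :
    ‖l • v (Y x) + (Y x - x)‖ ≤ 2 / 3 * ‖Y x - x‖ := by
  have hH := h.H_pos
  set y := Y x
  set d := ‖y - x‖ with hd
  set η := l * (H * d ^ (p - 1) / (p - 1)!) with hη
  have hp0 : (0 : ℝ) < p := by exact_mod_cast h.hp
  have hpp : d * d ^ (p - 1) = d ^ p := by
    rw [← pow_succ']; congr 1; have := h.hp; omega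
  have hf := cast_factorial_eq_mul_pred h.hp
  have hf0 : ((p - 1)! : ℝ) ≠ 0 := by positivity
  -- Solve the definition of the model gradient for `v y`; multiplied by `l`, the gradient of the
  -- regulariser is `η (p + 1) / p` times `y - x`. The upper acceptance bound makes the remaining
  -- coefficient nonnegative.
  have e1 : l • v y + (y - x) = l • modelGrad p H v Err x y + l • Err x y +
      (1 - η * (p + 1) / p) • (y - x) := by
    have : η * (p + 1) / p = l * ((H * (p + 1) / p !) * d ^ (p - 1)) := by
      rw [hη, hf]; field_simp
    rw [this]
    unfold modelGrad
    module
  have hη1 : η * (p + 1) / p ≤ 1 := by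
    rw [div_le_one hp0]
    calc η * (p + 1) ≤ p / (p + 1) * (p + 1) := by gcongr
      _ = p := by field_simp
  have e2 : ‖l • modelGrad p H v Err x y‖ ≤ l * ‖v y‖ / 10 := by
    rw [norm_smul, Real.norm_of_nonneg hl.le, mul_div_assoc]
    have := h.step x hx
    have := h.acc_le_tenth
    gcongr
    linarith
  have e3 : ‖l • Err x y‖ ≤ η / (2 * p) * d := by
    rw [norm_smul, Real.norm_of_nonneg hl.le]
    calc _ ≤ l * (H / 2 / p ! * d ^ p) := by gcongr; exact h.err.bound x y
      _ = _ := by rw [hη, hf, ← hpp]; field_simp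
  have e4 : ‖(1 - η * (p + 1) / p) • (y - x)‖ = (1 - η * (p + 1) / p) * d := by
    rw [norm_smul, Real.norm_of_nonneg (by linarith)]
  have e5 : l * ‖v y‖ ≤ ‖l • v y + (y - x)‖ + d := by
    have := norm_sub_le (l • v y + (y - x)) (y - x)
    rwa [add_sub_cancel_right, norm_smul, Real.norm_of_nonneg hl.le] at this
  have e6 : ‖l • v y + (y - x)‖ ≤ l * ‖v y‖ / 10 + η / (2 * p) * d + (1 - η * (p + 1) / p) * d := by
    rw [e1, ← e4]
    exact (norm_add_le _ _).trans (add_le_add ((norm_add_le _ _).trans (add_le_add e2 e3)) le_rfl)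
  -- The lower acceptance bound enters here. With `t` the norm to be bounded, `e5`, `e6` and this
  -- give `t ≤ (t + d) / 10 + d / 2`, that is `t ≤ 2 d / 3`.
  have e7 : η / (2 * p) * d + (1 - η * (p + 1) / p) * d ≤ d / 2 := by
    have : η / (2 * p) + (1 - η * (p + 1) / p) = 1 - η - η / (2 * p) := by field_simp; ring
    have h3 : 0 ≤ η / (2 * p) := by positivity
    have h4 : 0 ≤ d := norm_nonneg _
    nlinarith
  linarith

end TensorMethod
end TensorMethod

/-! ## One step of CATD -/

section Step

/-- The increment `a_{k+1}` of CATD for the step size `l`. -/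
def stepWeight (l A : ℝ) : ℝ := (l + √(l ^ 2 + 4 * l * A)) / 2

variable {l l' A : ℝ}

theorem stepWeight_sq (hl : 0 < l) (hA : 0 ≤ A) :
    stepWeight l A ^ 2 = l * (A + stepWeight l A) := by
  have h := Real.sq_sqrt (show 0 ≤ l ^ 2 + 4 * l * A by positivity)
  unfold stepWeight
  linear_combination h / 4

theorem le_stepWeight (hl : 0 < l) (hA : 0 ≤ A) : l ≤ stepWeight l A := by
  have h : l ≤ √(l ^ 2 + 4 * l * A) := Real.le_sqrt_of_sq_le (by nlinarith [mul_nonneg hl.le hA])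
  unfold stepWeight
  linarith

theorem stepWeight_pos (hl : 0 < l) (hA : 0 ≤ A) : 0 < stepWeight l A :=
  hl.trans_le (le_stepWeight hl hA)

theorem stepWeight_mono (hl : 0 < l) (hll : l ≤ l') (hA : 0 ≤ A) :
    stepWeight l A ≤ stepWeight l' A := by
  unfold stepWeight
  gcongr

theorem stepRatio_mono (hl : 0 < l) (hll : l ≤ l') (hA : 0 ≤ A) :
    stepWeight l A / (A + stepWeight l A) ≤ stepWeight l' A / (A + stepWeight l' A) := by
  have h1 := stepWeight_pos hl hA
  have h2 := stepWeight_mono hl hll hA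
  rw [div_le_div_iff₀ (by positivity) (by linarith)]
  nlinarith

/-- By `stepWeight_sq` the squared ratio is `l / (A + a)`. Its denominator grows with `l`, so the
square grows at most by the factor `l' / l`, and so does the ratio, which is at most one. -/
theorem stepRatio_sub_le (hl : 0 < l) (hll : l ≤ l') (hA : 0 ≤ A) :
    stepWeight l' A / (A + stepWeight l' A) - stepWeight l A / (A + stepWeight l A) ≤
      l' / l - 1 := by
  have hl' : 0 < l' := hl.trans_le hll
  have h1 := stepWeight_pos hl hA
  have h1' := stepWeight_pos hl' hA
  have h2 := stepWeight_mono hl hll hA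
  have h3 := stepRatio_mono hl hll hA
  have hsq : ∀ t : ℝ, 0 < t →
      (stepWeight t A / (A + stepWeight t A)) ^ 2 = t / (A + stepWeight t A) := by
    intro t ht
    have := stepWeight_pos ht hA
    rw [div_pow, stepWeight_sq ht hA]
    field_simp
  have h4 := hsq l hl
  have h4' := hsq l' hl'
  have h5 : 0 < stepWeight l A / (A + stepWeight l A) := by positivity
  have h6 : stepWeight l A / (A + stepWeight l A) ≤ 1 := by
    rw [div_le_one (by positivity)]; linarith
  set θ := stepWeight l A / (A + stepWeight l A)
  set θ' := stepWeight l' A / (A + stepWeight l' A)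
  have h7 : θ' ^ 2 ≤ l' / l * θ ^ 2 := by
    rw [h4, h4', div_mul_div_comm, mul_comm l', mul_div_mul_left _ _ hl.ne']
    gcongr
  have h8 : θ * θ' ≤ l' / l * θ ^ 2 := le_trans (by nlinarith) h7
  have h9 : θ' ≤ l' / l * θ := by
    have : θ * θ' ≤ θ * (l' / l * θ) := h8.trans (le_of_eq (by ring))
    exact le_of_mul_le_mul_left this h5
  have h10 : 1 ≤ l' / l := (one_le_div hl).2 hll
  nlinarith

variable {E : Type*} [NormedAddCommGroup E] [InnerProductSpace ℝ E]

/-- The point `x̃_k` that belongs to the step size `l`. -/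
def trialPoint (s : CATDState E) (l : ℝ) : E :=
  (s.A / (s.A + stepWeight l s.A)) • s.y +
    (stepWeight l s.A / (s.A + stepWeight l s.A)) • s.x

theorem trialPoint_eq (s : CATDState E) (hl : 0 < l) (hA : 0 ≤ s.A) :
    trialPoint s l = s.y + (stepWeight l s.A / (s.A + stepWeight l s.A)) • (s.x - s.y) := by
  have := stepWeight_pos hl hA
  have h : s.A / (s.A + stepWeight l s.A) =
      1 - stepWeight l s.A / (s.A + stepWeight l s.A) := by
    field_simp; ring
  rw [trialPoint, h]
  module

theorem norm_trialPoint_sub_le (s : CATDState E) (hl : 0 < l) (hA : 0 ≤ s.A) {xs : E} {B : ℝ}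
    (hx : ‖s.x - xs‖ ≤ B) (hy : ‖s.y - xs‖ ≤ B) : ‖trialPoint s l - xs‖ ≤ B := by
  have := stepWeight_pos hl hA
  have h := (convex_closedBall xs B) (x := s.y) (by simpa [dist_eq_norm] using hy) (y := s.x)
    (by simpa [dist_eq_norm] using hx) (a := s.A / (s.A + stepWeight l s.A))
    (b := stepWeight l s.A / (s.A + stepWeight l s.A)) (by positivity) (by positivity)
    (by field_simp)
  simpa [dist_eq_norm, trialPoint] using h

theorem norm_trialPoint_sub_trialPoint_le (s : CATDState E) (hl : 0 < l) (hll : l ≤ l')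
    (hA : 0 ≤ s.A) : ‖trialPoint s l - trialPoint s l'‖ ≤ (l' / l - 1) * ‖s.x - s.y‖ := by
  rw [trialPoint_eq s hl hA, trialPoint_eq s (hl.trans_le hll) hA, add_sub_add_left_eq_sub,
    ← sub_smul, norm_smul, Real.norm_eq_abs, abs_sub_comm,
    abs_of_nonneg (sub_nonneg.2 (stepRatio_mono hl hll hA))]
  exact mul_le_mul_of_nonneg_right (stepRatio_sub_le hl hll hA) (norm_nonneg _)

/-- The decrease of the potential in one step. -/
theorem potential_step {Φ : E → ℝ} {v : E → E} (hconv : ∀ x y, Φ x + inner ℝ (v x) (y - x) ≤ Φ y)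
    (s : CATDState E) (hl : 0 < l) (hA : 0 ≤ s.A) (xs y' : E)
    (h : ‖l • v y' + (y' - trialPoint s l)‖ ≤ 2 / 3 * ‖y' - trialPoint s l‖) :
    ‖s.x - stepWeight l s.A • v y' - xs‖ ^ 2 / 2 + (s.A + stepWeight l s.A) * (Φ y' - Φ xs) +
      5 / 18 * ((s.A + stepWeight l s.A) / l * ‖y' - trialPoint s l‖ ^ 2) ≤
    ‖s.x - xs‖ ^ 2 / 2 + s.A * (Φ s.y - Φ xs) := by
  have hsq := stepWeight_sq hl hA
  have hw := stepWeight_pos hl hA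
  set a := stepWeight l s.A
  set xt := trialPoint s l with hxt
  set A' := s.A + a
  have hA' : 0 < A' := by positivity
  have hxt' : A' • xt = s.A • s.y + a • s.x := by
    rw [hxt, trialPoint, smul_add, smul_smul, smul_smul, mul_div_cancel₀ _ hA'.ne',
      mul_div_cancel₀ _ hA'.ne']
  have h1 := hconv y' xs
  have h2 := mul_le_mul_of_nonneg_left (hconv y' s.y) hA
  have h1' := mul_le_mul_of_nonneg_left h1 hw.le
  have e1 : ‖s.x - a • v y' - xs‖ ^ 2 =
      ‖s.x - xs‖ ^ 2 - 2 * a * inner ℝ (v y') (s.x - xs) + a ^ 2 * ‖v y'‖ ^ 2 := by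
    rw [sub_right_comm, norm_sub_sq_real, inner_smul_right, norm_smul, Real.norm_of_nonneg hw.le,
      real_inner_comm]
    ring
  have e2 : ‖l • v y' + (y' - xt)‖ ^ 2 =
      l ^ 2 * ‖v y'‖ ^ 2 + 2 * l * inner ℝ (v y') (y' - xt) + ‖y' - xt‖ ^ 2 := by
    rw [norm_add_sq_real, norm_smul, Real.norm_of_nonneg hl.le, inner_smul_left]
    simp
    ring
  have e3 : A' * inner ℝ (v y') (y' - xt) =
      s.A * inner ℝ (v y') (y' - s.y) + a * inner ℝ (v y') (y' - s.x) := by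
    rw [← inner_smul_right, ← inner_smul_right, ← inner_smul_right, ← inner_add_right, smul_sub,
      hxt']
    congr 1
    module
  have e4 : inner ℝ (v y') (s.y - y') = - inner ℝ (v y') (y' - s.y) := by
    rw [← inner_neg_right, neg_sub]
  have e5 : inner ℝ (v y') (xs - y') =
      - inner ℝ (v y') (s.x - xs) - inner ℝ (v y') (y' - s.x) := by
    rw [← inner_neg_right, ← inner_sub_right]
    congr 1
    module
  -- Squaring the hypothesis leaves `1 - (2 / 3) ^ 2 = 5 / 9`, of which the potential keeps one
  -- half.
  have h3 : l ^ 2 * ‖v y'‖ ^ 2 + 2 * l * inner ℝ (v y') (y' - xt) ≤ -(5 / 9 * ‖y' - xt‖ ^ 2) := by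
    have := pow_le_pow_left₀ (norm_nonneg _) h 2
    rw [e2] at this
    linarith
  have h4 : A' * (l * ‖v y'‖ ^ 2 / 2 + inner ℝ (v y') (y' - xt)) +
      5 / 18 * (A' / l * ‖y' - xt‖ ^ 2) ≤ 0 := by
    have : A' * (l * ‖v y'‖ ^ 2 / 2 + inner ℝ (v y') (y' - xt)) +
      5 / 18 * (A' / l * ‖y' - xt‖ ^ 2) = A' / (2 * l) * (l ^ 2 * ‖v y'‖ ^ 2 +
        2 * l * inner ℝ (v y') (y' - xt) + 5 / 9 * ‖y' - xt‖ ^ 2) := by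
      field_simp
      ring
    rw [this]
    exact mul_nonpos_of_nonneg_of_nonpos (by positivity) (by linarith)
  rw [e4] at h2
  rw [e5] at h1'
  rw [e1, hsq]
  nlinarith

end Step

/-! ## Growth of the weights -/

section Growth

/-- Tangent lines of negative powers. -/
theorem rpow_neg_ge_tangent {γ w ω : ℝ} (hγ : 0 ≤ γ) (hw : 0 < w) (hω : 0 < ω) :
    (1 + γ) * ω ^ (-γ) - γ * ω ^ (-γ) / ω * w ≤ w ^ (-γ) := by
  have h1 : w ^ (-γ) = ω ^ (-γ) * (w / ω) ^ (-γ) := by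
    rw [← Real.mul_rpow hω.le (by positivity), mul_div_cancel₀ _ hω.ne']
  have h2 : 1 - γ * (w / ω - 1) ≤ (w / ω) ^ (-γ) := by
    rw [Real.rpow_def_of_pos (by positivity)]
    have h3 := Real.log_le_sub_one_of_pos (show 0 < w / ω by positivity)
    have h4 := Real.add_one_le_exp (Real.log (w / ω) * -γ)
    nlinarith
  rw [h1]
  have h5 : 0 < ω ^ (-γ) := Real.rpow_pos_of_pos hω _
  calc _ = ω ^ (-γ) * (1 - γ * (w / ω - 1)) := by field_simp; ring
    _ ≤ _ := by gcongr

/-- The exponent `(p - 1) / (2 (p + 1))`. -/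
def growthExponent (p : ℕ) : ℝ := (p - 1) / (2 * (p + 1))

/-- The factor in the growth of `A ^ (1 / (p + 1))`. -/
def growthConst (p : ℕ) (H : ℝ) : ℝ := 1 / (p + 1) * (1 / (2 * H)) ^ (1 / ((p : ℝ) + 1))

/-- Put `q = 1 / (p + 1)`. Concavity of `t ^ q` bounds the increase below by `q a A' ^ (q - 1)`, and
`a = √(l A')`. The exponent `1 / 2 - q` is the one for which the powers of `A'` match; what remains
is a lower bound for `l ^ q`, which the acceptance test supplies. -/
theorem growth_step {p : ℕ} (hp : 1 ≤ p) {H l A d : ℝ} (hH : 0 < H) (hl : 0 < l) (hA : 0 ≤ A)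
    (hd : 0 < d) (hη : 1 / 2 ≤ l * (H * d ^ (p - 1) / (p - 1)!)) :
    growthConst p H * ((A + stepWeight l A) / l * d ^ 2) ^ (-growthExponent p) ≤
      (A + stepWeight l A) ^ (1 / ((p : ℝ) + 1)) - A ^ (1 / ((p : ℝ) + 1)) := by
  have hw := stepWeight_pos hl hA
  have hsq := stepWeight_sq hl hA
  set a := stepWeight l A
  set A' := A + a with hA'
  have hA'0 : 0 < A' := by positivity
  have hp0 : (1 : ℝ) ≤ p := by exact_mod_cast hp
  set q : ℝ := 1 / ((p : ℝ) + 1) with hq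
  have hq0 : 0 < q := by positivity
  have hq1 : q ≤ 1 := by rw [hq, div_le_one (by positivity)]; linarith
  have hγ : growthExponent p = 1 / 2 - q := by
    rw [growthExponent, hq]; field_simp; ring
  have hγ' : 2 * growthExponent p = (p - 1) * q := by
    rw [growthExponent, hq]; field_simp
  have h1 : q * a * A' ^ (q - 1) ≤ A' ^ q - A ^ q := by
    have h2 : (A / A') ^ q ≤ 1 + q * (A / A' - 1) := by
      have := rpow_one_add_le_one_add_mul_self (s := A / A' - 1)
        (by have : 0 ≤ A / A' := by positivity
            linarith) hq0.le hq1
      rwa [add_sub_cancel] at this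
    have h3 : A ^ q = A' ^ q * (A / A') ^ q := by
      rw [← Real.mul_rpow hA'0.le (by positivity), mul_div_cancel₀ _ hA'0.ne']
    have h4 : A' ^ (q - 1) = A' ^ q / A' := Real.rpow_sub_one hA'0.ne' q
    have h5 : A / A' - 1 = - (a / A') := by field_simp; rw [hA']; ring
    have h6 : 0 < A' ^ q := Real.rpow_pos_of_pos hA'0 _
    rw [h3, h4]
    calc q * a * (A' ^ q / A') = A' ^ q - A' ^ q * (1 + q * (A / A' - 1)) := by
          rw [h5]; field_simp; ring
      _ ≤ _ := by gcongr
  refine le_trans ?_ h1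
  have ha : a = l ^ (1 / 2 : ℝ) * A' ^ (1 / 2 : ℝ) := by
    rw [← Real.mul_rpow hl.le hA'0.le, ← hsq, ← Real.sqrt_eq_rpow, Real.sqrt_sq hw.le]
  have e1 : (A' / l * d ^ 2) ^ (-growthExponent p) =
      A' ^ (q - 1 / 2) * l ^ (1 / 2 - q) * (d ^ (-((p - 1) * q))) := by
    rw [Real.mul_rpow (by positivity) (by positivity), Real.div_rpow hA'0.le hl.le,
      ← Real.rpow_natCast d 2, ← Real.rpow_mul hd.le, hγ, Real.rpow_neg hl.le, div_inv_eq_mul,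
      neg_sub]
    congr 2
    rw [← hγ', hγ]; push_cast; ring
  have e2 : q * a * A' ^ (q - 1) = A' ^ (q - 1 / 2) * l ^ (1 / 2 - q) * (q * l ^ q) := by
    have i1 : A' ^ (q - 1 / 2) = A' ^ (1 / 2 : ℝ) * A' ^ (q - 1) := by
      rw [← Real.rpow_add hA'0]; congr 1; ring
    have i2 : l ^ (1 / 2 : ℝ) = l ^ (1 / 2 - q) * l ^ q := by
      rw [← Real.rpow_add hl]; congr 1; ring
    rw [ha, i1, i2]; ring
  rw [e1, e2, mul_left_comm]
  refine mul_le_mul_of_nonneg_left ?_ (by positivity)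
  have hdp : d ^ (((p : ℝ) - 1) * q) = (d ^ (p - 1)) ^ q := by
    rw [← Real.rpow_natCast d (p - 1), ← Real.rpow_mul hd.le, Nat.cast_sub hp]; simp
  rw [Real.rpow_neg hd.le, ← div_eq_mul_inv, div_le_iff₀ (by positivity), hdp, mul_assoc,
    ← Real.mul_rpow hl.le (by positivity), growthConst, ← hq]
  gcongr
  have hf : (1 : ℝ) ≤ (p - 1)! := by exact_mod_cast Nat.succ_le_of_lt (Nat.factorial_pos (p - 1))
  rw [← mul_div_assoc, le_div_iff₀ (by positivity)] at hη
  rw [div_le_iff₀ (by positivity)]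
  nlinarith

/-- The constant in the rate of convergence of CATD. -/
def rateConst (p : ℕ) : ℝ := 2 * ((p : ℝ) + 1) ^ (p + 1) * 2 ^ (p - 1)

theorem growthConst_pow (p : ℕ) {H : ℝ} (hH : 0 < H) :
    growthConst p H ^ (p + 1) = 1 / (((p : ℝ) + 1) ^ (p + 1) * (2 * H)) := by
  rw [growthConst, mul_pow, ← Real.rpow_natCast (_ ^ (1 / ((p : ℝ) + 1))),
    ← Real.rpow_mul (by positivity)]
  have : 1 / ((p : ℝ) + 1) * ((p + 1 : ℕ) : ℝ) = 1 := by push_cast; field_simp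
  rw [this, Real.rpow_one]
  field_simp
  rw [← mul_pow, one_div_mul_cancel (by positivity), one_pow]

/-- The tangent at the mean value `4 D ^ 2 / N` takes the place of Jensen's inequality and keeps the
invariant linear in `W`. Taking the power `p + 1` turns `N ^ (1 + γ)` into `N ^ ((3 p + 1) / 2)`. -/
theorem growth_bound {p : ℕ} (hp : 1 ≤ p) {H A D W : ℝ} {N : ℕ} (hH : 0 < H) (hA : 0 ≤ A)
    (hD : 0 < D) (hN : 1 ≤ N) (hW : W ≤ 4 * D ^ 2)
    (h : growthConst p H * (N * ((1 + growthExponent p) * (4 * D ^ 2 / N) ^ (-growthExponent p)) -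
      growthExponent p * (4 * D ^ 2 / N) ^ (-growthExponent p) / (4 * D ^ 2 / N) * W) ≤
        A ^ (1 / ((p : ℝ) + 1))) :
    (N : ℝ) ^ ((3 * (p : ℝ) + 1) / 2) ≤ rateConst p * H * D ^ (p - 1) * A := by
  have hN0 : (0 : ℝ) < N := by exact_mod_cast hN
  have hp0 : (1 : ℝ) ≤ p := by exact_mod_cast hp
  set γ := growthExponent p with hγ
  have hγ0 : 0 ≤ γ := by rw [hγ, growthExponent]; exact div_nonneg (by linarith) (by positivity)
  set ω : ℝ := 4 * D ^ 2 / N with hω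
  have hω0 : 0 < ω := by positivity
  have hωγ : 0 < ω ^ (-γ) := Real.rpow_pos_of_pos hω0 _
  have hc : 0 < growthConst p H := by unfold growthConst; positivity
  have h1 : growthConst p H * (N * ω ^ (-γ)) ≤ A ^ (1 / ((p : ℝ) + 1)) := by
    refine le_trans ?_ h
    gcongr
    have : γ * ω ^ (-γ) / ω * W ≤ γ * ω ^ (-γ) * N := by
      calc _ ≤ γ * ω ^ (-γ) / ω * (4 * D ^ 2) := by gcongr
        _ = _ := by rw [hω]; field_simp
    nlinarith
  have h2 := pow_le_pow_left₀ (by positivity) h1 (p + 1)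
  have h3 : (A ^ (1 / ((p : ℝ) + 1))) ^ (p + 1) = A := by
    rw [← Real.rpow_natCast, ← Real.rpow_mul hA]
    have : 1 / ((p : ℝ) + 1) * ((p + 1 : ℕ) : ℝ) = 1 := by push_cast; field_simp
    rw [this, Real.rpow_one]
  have h4 : (N * ω ^ (-γ)) ^ (p + 1) = N ^ ((3 * (p : ℝ) + 1) / 2) / (2 * D) ^ (p - 1) := by
    have i1 : ω ^ (-γ) = N ^ γ / (2 * D) ^ (2 * γ) := by
      rw [hω, Real.rpow_neg (by positivity), ← Real.inv_rpow (by positivity), inv_div,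
        Real.div_rpow hN0.le (by positivity), show 4 * D ^ 2 = (2 * D) ^ (2 : ℝ) by
          norm_cast; ring, ← Real.rpow_mul (by positivity)]
    have i2 : ((2 * D) ^ (2 * γ)) ^ (p + 1) = (2 * D) ^ (p - 1) := by
      rw [← Real.rpow_natCast, ← Real.rpow_mul (by positivity), ← Real.rpow_natCast]
      congr 1
      rw [hγ, growthExponent, Nat.cast_sub hp]; push_cast; field_simp
    have i3 : ((N : ℝ) * N ^ γ) ^ (p + 1) = N ^ ((3 * (p : ℝ) + 1) / 2) := by
      rw [← Real.rpow_one_add' hN0.le (by positivity), ← Real.rpow_natCast,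
        ← Real.rpow_mul hN0.le]
      congr 1
      rw [hγ, growthExponent]; push_cast; field_simp; ring
    rw [i1, ← mul_div_assoc, div_pow, i2, i3]
  rw [mul_pow, growthConst_pow p hH, h4, h3, div_mul_div_comm, one_mul,
    div_le_iff₀ (by positivity)] at h2
  refine h2.trans (le_of_eq ?_)
  rw [rateConst, mul_pow]; ring

end Growth

/-! ## The search for the step size -/

section Search

variable {E : Type*} [NormedAddCommGroup E] [InnerProductSpace ℝ E]

/-- The quantity that decides on the acceptance of the step size `l`. -/
def acceptance (p : ℕ) (H : ℝ) (Y : E → E) (s : CATDState E) (l : ℝ) : ℝ :=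
  l * (H * ‖Y (trialPoint s l) - trialPoint s l‖ ^ (p - 1) / ((p - 1)! : ℝ))

/-- The state of CATD after the step size `l` has been accepted. -/
def nextState (v : E → E) (Y : E → E) (s : CATDState E) (l : ℝ) : CATDState E :=
  ⟨s.A + stepWeight l s.A, s.x - stepWeight l s.A • v (Y (trialPoint s l)), Y (trialPoint s l)⟩

theorem catdStep_succ_val (p : ℕ) (P : CATDParams) (tensorStep grad : E → Tally E)
    (s : CATDState E) (n : ℕ) (lo hi : ℝ) :
    (catdStep p P tensorStep grad s (n + 1) lo hi).val =
      if ‖(grad (tensorStep (trialPoint s √(lo * hi))).val).val‖ ≤ P.δ then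
        Sum.inl (tensorStep (trialPoint s √(lo * hi))).val
      else if acceptance p P.H (fun x => (tensorStep x).val) s √(lo * hi) < 1 / 2 then
        (catdStep p P tensorStep grad s n √(lo * hi) hi).val
      else if (p : ℝ) / (p + 1) < acceptance p P.H (fun x => (tensorStep x).val) s √(lo * hi) then
        (catdStep p P tensorStep grad s n lo √(lo * hi)).val
      else Sum.inr (nextState (fun y => (grad y).val) (fun x => (tensorStep x).val) s
        √(lo * hi)) := by
  simp only [catdStep, bind]
  change Tally.val (ite (‖(grad (tensorStep (trialPoint s √(lo * hi))).val).val‖ ≤ P.δ) _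
    (ite (acceptance p P.H (fun x => (tensorStep x).val) s √(lo * hi) < 1 / 2) _
    (ite ((p : ℝ) / (p + 1) < acceptance p P.H (fun x => (tensorStep x).val) s √(lo * hi)) _ _))) = _
  split_ifs <;> rfl

/-- A correct outcome of the search for a step size: a point of the desired accuracy or the next
state. -/
structure SearchSpec (p : ℕ) (H δ D₀ : ℝ) (v : E → E) (xs : E) (Y : E → E) (s : CATDState E)
    (res : E ⊕ CATDState E) : Prop where
  done : ∀ y, res = Sum.inl y → ‖v y‖ ≤ δ ∧ ‖y - xs‖ ≤ stepRadius p * D₀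
  next : ∀ s', res = Sum.inr s' → ∃ l, 0 < l ∧ s' = nextState v Y s l ∧
    δ < ‖v (Y (trialPoint s l))‖ ∧ 1 / 2 ≤ acceptance p H Y s l ∧
      acceptance p H Y s l ≤ (p : ℝ) / (p + 1)

theorem sqrt_mul_bounds {lo hi τ : ℝ} {n : ℕ} (hlo : 0 < lo) (hlh : lo ≤ hi) (hτ : 0 ≤ τ)
    (h : hi ≤ lo * (1 + τ) ^ 2 ^ (n + 1)) :
    lo ≤ √(lo * hi) ∧ √(lo * hi) ≤ hi ∧ hi ≤ √(lo * hi) * (1 + τ) ^ 2 ^ n ∧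
      √(lo * hi) ≤ lo * (1 + τ) ^ 2 ^ n := by
  have hhi := hlo.trans_le hlh
  have hsq := Real.sq_sqrt (show 0 ≤ lo * hi by positivity)
  have hm : 0 < √(lo * hi) := Real.sqrt_pos.2 (by positivity)
  set m := √(lo * hi)
  have hpow : (1 + τ) ^ 2 ^ (n + 1) = ((1 + τ) ^ 2 ^ n) ^ 2 := by rw [← pow_mul, pow_succ 2 n]
  rw [hpow] at h
  have hc : 0 < (1 + τ) ^ 2 ^ n := by positivity
  set c := (1 + τ) ^ 2 ^ n
  refine ⟨?_, ?_, ?_, ?_⟩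
  · exact le_of_sq_le_sq (by nlinarith) hm.le
  · exact le_of_sq_le_sq (by nlinarith) hhi.le
  · refine le_of_sq_le_sq ?_ (by positivity)
    rw [mul_pow, hsq]; nlinarith
  · refine le_of_sq_le_sq ?_ (by positivity)
    rw [mul_pow, hsq]; nlinarith
where
  le_of_sq_le_sq {a b : ℝ} (h : a ^ 2 ≤ b ^ 2) (hb : 0 ≤ b) : a ≤ b :=
    le_of_pow_le_pow_left₀ two_ne_zero hb h

/-- Bisection succeeds if no two points that are close to each other are an unsuccessful lower and
an unsuccessful upper end. -/
theorem catdStep_spec {p : ℕ} {P : CATDParams} {tensorStep grad : E → Tally E} {D₀ τ : ℝ}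
    {v Y : E → E} {xs : E} {s : CATDState E} (hY : ∀ x, (tensorStep x).val = Y x)
    (hv : ∀ y, (grad y).val = v y) (hτ : 0 ≤ τ)
    (hball : ∀ l, 0 < l → ‖Y (trialPoint s l) - xs‖ ≤ stepRadius p * D₀)
    {Low High : ℝ → Prop}
    (hLow : ∀ l, 0 < l → P.δ < ‖v (Y (trialPoint s l))‖ → acceptance p P.H Y s l < 1 / 2 → Low l)
    (hHigh : ∀ l, 0 < l → P.δ < ‖v (Y (trialPoint s l))‖ →
      (p : ℝ) / (p + 1) < acceptance p P.H Y s l → High l)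
    (hclose : ∀ l l', 0 < l → l ≤ l' → l' ≤ l * (1 + τ) → Low l → High l' → False)
    (n : ℕ) (lo hi : ℝ) (hlo : 0 < lo) (hlh : lo ≤ hi) (hn : hi ≤ lo * (1 + τ) ^ 2 ^ n)
    (h1 : Low lo) (h2 : High hi) :
    SearchSpec p P.H P.δ D₀ v xs Y s (catdStep p P tensorStep grad s n lo hi).val := by
  have hYf : (fun x => (tensorStep x).val) = Y := funext hY
  have hvf : (fun y => (grad y).val) = v := funext hv
  induction n generalizing lo hi with
  -- When the trials are used up, the two ends have ratio at most `1 + τ`, which `hclose` excludes;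
  -- the default value of `catdStep` is never returned.
  | zero => exact (hclose lo hi hlo hlh (by simpa using hn) h1 h2).elim
  | succ n ih =>
    obtain ⟨b1, b2, b3, b4⟩ := sqrt_mul_bounds hlo hlh hτ hn
    have hm : 0 < √(lo * hi) := hlo.trans_le b1
    rw [catdStep_succ_val, hYf, hvf, hY, hv]
    split_ifs with c1 c2 c3
    · refine ⟨fun y hy => ?_, fun s' hs' => by cases hs'⟩
      cases hy
      exact ⟨c1, hball _ hm⟩
    · exact ih _ _ hm b2 b3 (hLow _ hm (not_le.1 c1) c2) h2
    · exact ih _ _ hlo b1 b4 h1 (hHigh _ hm (not_le.1 c1) c3)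
    · exact ⟨fun y hy => (by cases hy), fun s' hs' => ⟨_, hm, (Sum.inr.inj hs').symm, not_le.1 c1,
        not_lt.1 c2, not_lt.1 c3⟩⟩

/-- Parameters for which the search for a step size succeeds. -/
structure SearchParams (p : ℕ) (D₀ : ℝ) (P : CATDParams) : Prop where
  one : p = 1 → P.lo = 1 / (2 * P.H) ∧ P.hi = 1 / (2 * P.H) ∧ 1 ≤ P.T
  lo_eq : 2 ≤ p → P.lo = 1 / (4 * P.H * (stepRadius p * D₀) ^ (p - 1))
  hi_eq : 2 ≤ p → P.hi = (p - 1)! / (P.H * (D₀ * resolution p P.H P.δ D₀) ^ (p - 1))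
  T_ge : 2 ≤ p → P.hi ≤ P.lo * (1 + resolution p P.H P.δ D₀) ^ 2 ^ P.T

/-- Bernoulli for `1 - u` gives `(1 + u) ^ (p - 1) ≤ 8 / 7`, and `11 / 10 * 8 / 7 / 2 < 2 / 3 ≤ p /
(p + 1)` once `p ≥ 2`. -/
theorem pow_ratio_lt {p : ℕ} (hp : 2 ≤ p) {t u : ℝ} (ht : t ≤ 11 / 10)
    (hu : u = 1 / (8 * p)) : t * (1 + u) ^ (p - 1) * (1 / 2) < (p : ℝ) / (p + 1) := by
  have hp0 : (2 : ℝ) ≤ p := by exact_mod_cast hp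
  have hu0 : 0 < u := by rw [hu]; positivity
  have hpu : p * u = 1 / 8 := by rw [hu]; field_simp
  have hu1 : u ≤ 1 := by nlinarith
  have h1 : 1 + ((p - 1 : ℕ) : ℝ) * (-u) ≤ (1 + -u) ^ (p - 1) :=
    one_add_mul_le_pow (by linarith) _
  have h2 : (1 + u) ^ (p - 1) * (1 + -u) ^ (p - 1) ≤ 1 := by
    rw [← mul_pow]
    exact pow_le_one₀ (by nlinarith) (by nlinarith)
  have h3 : (7 / 8 : ℝ) ≤ (1 + -u) ^ (p - 1) := by
    refine le_trans ?_ h1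
    rw [Nat.cast_sub (by omega)]
    push_cast
    nlinarith
  have h4 : 0 < (1 + u) ^ (p - 1) := by positivity
  have h5 : (1 + u) ^ (p - 1) ≤ 8 / 7 := by nlinarith
  have h6 : (2 / 3 : ℝ) ≤ p / (p + 1) := by
    rw [div_le_div_iff₀ (by norm_num) (by positivity)]; linarith
  nlinarith

namespace TensorMethod

variable {p : ℕ} {H δ δ' D₀ : ℝ} {Φ : E → ℝ} {v : E → E} {xs : E} {Err : E → E → E} {Y : E → E}

theorem accuracyFactor_pos (p : ℕ) : 0 < accuracyFactor p :=
  lt_of_lt_of_le (by positivity) (le_accuracyFactor p)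

theorem resolution_pos (h : TensorMethod p H δ δ' D₀ Φ v xs Err Y) : 0 < resolution p H δ D₀ := by
  have := h.H_pos
  have := h.δ_pos
  have := h.D_pos
  have := accuracyFactor_pos p
  unfold resolution
  positivity

theorem accuracyFactor_mul_resolution_le (h : TensorMethod p H δ δ' D₀ Φ v xs Err Y) :
    accuracyFactor p * resolution p H δ D₀ ≤ 1 := by
  have := h.H_pos
  have := h.δ_pos
  have := h.D_pos
  have := accuracyFactor_pos p
  have h1 : accuracyFactor p * resolution p H δ D₀ = δ / (δ + H * D₀ ^ p) := by
    unfold resolution; field_simp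
  rw [h1, div_le_one (by positivity)]
  have : 0 < H * D₀ ^ p := by positivity
  linarith

theorem accuracyFactor_mul_resolution_mul_le (h : TensorMethod p H δ δ' D₀ Φ v xs Err Y) :
    accuracyFactor p * (H * D₀ ^ p * resolution p H δ D₀) ≤ δ := by
  have := h.H_pos
  have := h.δ_pos
  have := h.D_pos
  have := accuracyFactor_pos p
  have h1 : accuracyFactor p * (H * D₀ ^ p * resolution p H δ D₀) =
      δ * (H * D₀ ^ p) / (δ + H * D₀ ^ p) := by
    unfold resolution; field_simp
  rw [h1, div_le_iff₀ (by positivity)]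
  nlinarith

theorem resolution_le (h : TensorMethod p H δ δ' D₀ Φ v xs Err Y) :
    resolution p H δ D₀ ≤ 1 / 20 := by
  have h1 := h.accuracyFactor_mul_resolution_le
  have h2 := le_accuracyFactor p
  have h3 := h.resolution_pos
  have hp0 : (0 : ℝ) ≤ p := Nat.cast_nonneg p
  nlinarith [mul_nonneg hp0 h3.le]

theorem min_step_le (h : TensorMethod p H δ δ' D₀ Φ v xs Err Y) {x : E}
    (hx : ‖x - xs‖ ≤ 3 * D₀) (hδ : δ < ‖v (Y x)‖) :
    D₀ * resolution p H δ D₀ ≤ ‖Y x - x‖ := by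
  have h1 := h.le_norm_tensorStep_sub_pow hx hδ
  have h2 := h.accuracyFactor_mul_resolution_mul_le
  have h3 := le_accuracyFactor p
  have h4 := h.resolution_pos
  have h5 := h.resolution_le
  have hH := h.H_pos
  have hD := h.D_pos
  refine le_of_pow_le_pow_left₀ (show p ≠ 0 by have := h.hp; omega) (norm_nonneg _) ?_
  rw [mul_pow]
  have h6 : resolution p H δ D₀ ^ p ≤ resolution p H δ D₀ :=
    pow_le_of_le_one h4.le (by linarith) (by have := h.hp; omega)
  have h7 : H * (p + 2) * (D₀ ^ p * resolution p H δ D₀ ^ p) ≤ H * (p + 2) * ‖Y x - x‖ ^ p := by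
    refine le_trans ?_ h1
    have h8 : 10 * ((p : ℝ) + 2) * (H * D₀ ^ p * resolution p H δ D₀) ≤ δ :=
      le_trans (by gcongr) h2
    have h9 : H * (p + 2) * (D₀ ^ p * resolution p H δ D₀ ^ p) ≤
        H * (p + 2) * (D₀ ^ p * resolution p H δ D₀) := by gcongr
    have := h.δ_pos
    nlinarith
  exact le_of_mul_le_mul_left h7 (by positivity)

/-- Step sizes that are close to each other cannot be too small and too large, respectively. -/
theorem not_low_high (h : TensorMethod p H δ δ' D₀ Φ v xs Err Y) (hp : 2 ≤ p) {s : CATDState E}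
    (hA : 0 ≤ s.A) (hx : ‖s.x - xs‖ ≤ D₀) (hy : ‖s.y - xs‖ ≤ 3 * D₀) {l l' : ℝ} (hl : 0 < l)
    (hll : l ≤ l') (hlτ : l' ≤ l * (1 + resolution p H δ D₀))
    (hδ : δ < ‖v (Y (trialPoint s l))‖) (h1 : acceptance p H Y s l < 1 / 2)
    (h2 : (p : ℝ) / (p + 1) < acceptance p H Y s l') : False := by
  have hH := h.H_pos
  have hD := h.D_pos
  have hδ0 := h.δ_pos
  have hτ := h.resolution_pos
  have hτ1 := h.resolution_le
  have hτ2 := h.accuracyFactor_mul_resolution_mul_le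
  have hb := three_le_stepRadius p
  have hacc := h.acc_le
  rw [le_div_iff₀ (accuracyFactor_pos p)] at hacc
  have hacc0 := h.acc_nonneg
  have hl' : 0 < l' := hl.trans_le hll
  have hx3 : ‖s.x - xs‖ ≤ 3 * D₀ := by linarith
  have b1 := norm_trialPoint_sub_le s hl hA hx3 hy
  have b2 := norm_trialPoint_sub_le s hl' hA hx3 hy
  have hβ : accuracyFactor p = (16 * p) ^ p * (2 ^ p * p ! * (2 + 4 * (p * 2 ^ p + p * (p + 1)) *
      stepRadius p ^ (p - 1))) * (p + 2) * 2 + (64 * p) ^ p * (p + 2) * 2 + 10 * (p + 2) := rfl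
  set x := trialPoint s l
  set x' := trialPoint s l'
  set τ := resolution p H δ D₀
  set β := accuracyFactor p
  set c : ℝ := p * 2 ^ p + p * (p + 1) with hc
  set b := stepRadius p
  have hxy : ‖s.x - s.y‖ ≤ 4 * D₀ := by
    have := norm_sub_le (s.x - xs) (s.y - xs)
    rw [sub_sub_sub_cancel_right] at this
    linarith
  have hxx : ‖x - x'‖ ≤ 4 * D₀ * τ := by
    refine (norm_trialPoint_sub_trialPoint_le s hl hll hA).trans ?_
    have h3 : l' / l - 1 ≤ τ := by
      rw [sub_le_iff_le_add, div_le_iff₀ hl]; linarith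
    calc _ ≤ τ * (4 * D₀) := by gcongr
      _ = _ := by ring
  have hd := h.le_norm_tensorStep_sub_pow b1 hδ
  have hd0 := h.tensorStep_sub_ne_zero b1 hδ
  set d := ‖Y x - x‖ with hd_def
  have hp0 : (2 : ℝ) ≤ p := by exact_mod_cast hp
  have hppos : (0 : ℝ) < p := by linarith
  have hHp : 0 < H * ((p : ℝ) + 2) := by positivity
  have hT1 : 0 ≤ (16 * (p : ℝ)) ^ p * (2 ^ p * p ! * (2 + 4 * c * b ^ (p - 1))) * (p + 2) * 2 := by
    positivity
  have hT2 : 0 ≤ (64 * (p : ℝ)) ^ p * (p + 2) * 2 := by positivity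
  -- The `p`-th power of the left side is a small multiple of `δ / H`, whereas `d ^ p` is at least
  -- of that order; the first summand of `accuracyFactor` is chosen for this comparison.
  have hYY : ‖Y x - Y x'‖ ≤ d / (16 * p) := by
    have h3 := h.norm_tensorStep_sub_tensorStep_le b1 b2
    refine le_of_pow_le_pow_left₀ (show p ≠ 0 by omega) (by positivity) (h3.trans ?_)
    rw [div_pow, le_div_iff₀ (by positivity)]
    refine le_of_mul_le_mul_left ?_ hHp
    refine le_trans ?_ hd
    have hDp : D₀ ^ p = D₀ ^ (p - 1) * D₀ := by rw [← pow_succ]; congr 1; omega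
    have h4 : 2 * δ' + H * c * (b * D₀) ^ (p - 1) * ‖x - x'‖ ≤
        (2 + 4 * c * b ^ (p - 1)) * (δ / β) := by
      have h5 : δ' ≤ δ / β := h.acc_le
      have h6 : H * D₀ ^ p * τ ≤ δ / β := by
        rw [le_div_iff₀ (accuracyFactor_pos p)]; linarith
      calc _ ≤ 2 * δ' + H * c * (b * D₀) ^ (p - 1) * (4 * D₀ * τ) := by gcongr
        _ = 2 * δ' + 4 * c * b ^ (p - 1) * (H * D₀ ^ p * τ) := by rw [mul_pow, hDp]; ring
        _ ≤ 2 * (δ / β) + 4 * c * b ^ (p - 1) * (δ / β) := by gcongr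
        _ = _ := by ring
    calc H * (p + 2) * (2 ^ p * p ! / H * (2 * δ' + H * c * (b * D₀) ^ (p - 1) * ‖x - x'‖) *
          (16 * p) ^ p)
        ≤ H * (p + 2) * (2 ^ p * p ! / H * ((2 + 4 * c * b ^ (p - 1)) * (δ / β)) *
          (16 * p) ^ p) := by gcongr
      _ = ((16 * p) ^ p * (2 ^ p * p ! * (2 + 4 * c * b ^ (p - 1))) * (p + 2)) * δ / β := by
        field_simp
      _ ≤ 9 / 10 * δ := by
        rw [div_le_iff₀ (accuracyFactor_pos p)]
        have h8 : (16 * (p : ℝ)) ^ p * (2 ^ p * p ! * (2 + 4 * c * b ^ (p - 1))) * (p + 2) * 2 ≤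
            β := by rw [hβ]; linarith
        have h9 := mul_le_mul_of_nonneg_right h8 hδ0.le
        have h10 : 0 ≤ β * δ := mul_nonneg (accuracyFactor_pos p).le hδ0.le
        generalize (16 * (p : ℝ)) ^ p * (2 ^ p * p ! * (2 + 4 * c * b ^ (p - 1))) * (p + 2) = q
          at h9 ⊢
        linarith
  -- Here the second summand of `accuracyFactor` is used. Together the two estimates change the step
  -- length by at most the fraction `1 / (8 p)`.
  have hxx' : ‖x - x'‖ ≤ d / (16 * p) := by
    refine hxx.trans ?_
    refine le_of_pow_le_pow_left₀ (show p ≠ 0 by omega) (by positivity) ?_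
    rw [div_pow, le_div_iff₀ (by positivity)]
    refine le_of_mul_le_mul_left ?_ hHp
    refine le_trans ?_ hd
    have h6 : τ ^ p ≤ τ := pow_le_of_le_one hτ.le (by linarith) (by omega)
    calc H * (p + 2) * ((4 * D₀ * τ) ^ p * (16 * p) ^ p)
        = (64 * p) ^ p * (p + 2) * (H * D₀ ^ p * τ ^ p) := by
          have e : (4 * D₀ * τ) ^ p * (16 * p) ^ p = (64 * p) ^ p * (D₀ ^ p * τ ^ p) := by
            rw [← mul_pow, ← mul_pow, ← mul_pow]; congr 1; ring
          rw [e]; generalize (64 * (p : ℝ)) ^ p = q; ring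
      _ ≤ (64 * p) ^ p * (p + 2) * (H * D₀ ^ p * τ) := by gcongr
      _ ≤ 9 / 10 * δ := by
        have h7 : 0 ≤ H * D₀ ^ p * τ := by positivity
        have h8 : (64 * (p : ℝ)) ^ p * (p + 2) * 2 ≤ β := by rw [hβ]; linarith
        have h9 := (mul_le_mul_of_nonneg_right h8 h7).trans hτ2
        generalize (64 * (p : ℝ)) ^ p * (p + 2) = q at h9 ⊢
        linarith
  have hd' : ‖Y x' - x'‖ ≤ d * (1 + 1 / (8 * p)) := by
    have h3 : Y x' - x' = (Y x - x) - (Y x - Y x') + (x - x') := by abel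
    have h4 : ‖Y x' - x'‖ ≤ d + ‖Y x - Y x'‖ + ‖x - x'‖ := by
      rw [h3]
      exact (norm_add_le _ _).trans (add_le_add (norm_sub_le _ _) le_rfl)
    have h5 : d * (1 + 1 / (8 * (p : ℝ))) = d + d / (16 * p) + d / (16 * p) := by
      field_simp; ring
    linarith
  have h3 : acceptance p H Y s l' ≤
      (l' / l) * (1 + 1 / (8 * p)) ^ (p - 1) * acceptance p H Y s l := by
    have e1 : acceptance p H Y s l = l * (H * d ^ (p - 1) / (p - 1)!) := rfl
    have e2 : acceptance p H Y s l' = l' * (H * ‖Y x' - x'‖ ^ (p - 1) / (p - 1)!) := rfl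
    rw [e1, e2]
    clear_value d x x' τ β b
    calc l' * (H * ‖Y x' - x'‖ ^ (p - 1) / (p - 1)!)
        ≤ l' * (H * (d * (1 + 1 / (8 * p))) ^ (p - 1) / (p - 1)!) := by gcongr
      _ = _ := by
        rw [mul_pow]
        generalize (1 + 1 / (8 * (p : ℝ))) ^ (p - 1) = w
        field_simp
  have h4 : l' / l ≤ 11 / 10 := by
    rw [div_le_iff₀ hl]; nlinarith
  have h5 := pow_ratio_lt hp h4 (rfl : (1 / (8 * p) : ℝ) = _)
  have h6 : (l' / l) * (1 + 1 / (8 * p)) ^ (p - 1) * acceptance p H Y s l ≤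
      (l' / l) * (1 + 1 / (8 * p)) ^ (p - 1) * (1 / 2) := by gcongr
  linarith

end TensorMethod

end Search

/-! ### Success of the step-size search -/

section Rounds

variable {E : Type*} [NormedAddCommGroup E] [InnerProductSpace ℝ E]

namespace TensorMethod

variable {p : ℕ} {δ' D₀ : ℝ} {Φ : E → ℝ} {v : E → E} {xs : E} {Err : E → E → E} {Y : E → E}
  {P : CATDParams} {tensorStep grad : E → Tally E}

theorem catdStep_spec_of_two_le (h : TensorMethod p P.H P.δ δ' D₀ Φ v xs Err Y) (hp : 2 ≤ p)
    (hP : SearchParams p D₀ P) (hY : ∀ x, (tensorStep x).val = Y x)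
    (hv : ∀ y, (grad y).val = v y) {s : CATDState E} (hA : 0 ≤ s.A) (hx : ‖s.x - xs‖ ≤ D₀)
    (hy : ‖s.y - xs‖ ≤ 3 * D₀) :
    SearchSpec p P.H P.δ D₀ v xs Y s (catdStep p P tensorStep grad s P.T P.lo P.hi).val := by
  have hH := h.H_pos
  have hD := h.D_pos
  have hτ := h.resolution_pos
  have hτ1 := h.resolution_le
  have hb := three_le_stepRadius p
  have hx3 : ‖s.x - xs‖ ≤ 3 * D₀ := by linarith
  have hpt : ∀ l, 0 < l → ‖trialPoint s l - xs‖ ≤ 3 * D₀ := fun l hl =>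
    norm_trialPoint_sub_le s hl hA hx3 hy
  have hp0 : (2 : ℝ) ≤ p := by exact_mod_cast hp
  have hpp : (2 / 3 : ℝ) ≤ p / (p + 1) := by
    rw [div_le_div_iff₀ (by norm_num) (by positivity)]; linarith
  have hf : (1 : ℝ) ≤ (p - 1)! := by exact_mod_cast Nat.succ_le_of_lt (Nat.factorial_pos (p - 1))
  have hlo := hP.lo_eq hp
  have hhi := hP.hi_eq hp
  set τ := resolution p P.H P.δ D₀
  have hlo0 : 0 < P.lo := by rw [hlo]; positivity
  have hlh : 4 * P.lo ≤ P.hi := by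
    rw [hlo, hhi]
    have h1 : (D₀ * τ) ^ (p - 1) ≤ (stepRadius p * D₀) ^ (p - 1) := by
      gcongr ?_ ^ (p - 1)
      rw [mul_comm]
      gcongr
      linarith
    calc 4 * (1 / (4 * P.H * (stepRadius p * D₀) ^ (p - 1)))
        = 1 / (P.H * (stepRadius p * D₀) ^ (p - 1)) := by field_simp
      _ ≤ _ := by gcongr
  have hlow : ∀ l, 0 < l → l ≤ 2 * P.lo → acceptance p P.H Y s l ≤ 1 / 2 := by
    intro l hl hl2
    have h1 := h.norm_tensorStep_sub_le' (hpt l hl) (hpt l hl)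
    unfold acceptance
    calc _ ≤ 2 * P.lo * (P.H * (stepRadius p * D₀) ^ (p - 1) / 1) := by gcongr
      _ = 1 / 2 := by rw [hlo]; field_simp; norm_num
  have hhigh : ∀ l, 0 < l → P.hi ≤ 2 * l → P.δ < ‖v (Y (trialPoint s l))‖ →
      1 / 2 ≤ acceptance p P.H Y s l := by
    intro l hl hl2 hδ
    have h1 := h.min_step_le (hpt l hl) hδ
    unfold acceptance
    calc (1 / 2 : ℝ) = P.hi / 2 * (P.H * (D₀ * τ) ^ (p - 1) / (p - 1)!) := by
          rw [hhi]; field_simp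
      _ ≤ _ := by gcongr; linarith
  refine catdStep_spec hY hv hτ.le
    (fun l hl => (h.norm_tensorStep_sub_le (hpt l hl)).trans (by gcongr; linarith))
    -- The two initial ends are never tried and so are admitted by name. Up to `2 * P.lo` the bound
    -- on step lengths keeps the acceptance quantity at most `1 / 2`; from `P.hi / 2` on, while the
    -- gradient is large, the minimal step keeps it at least `1 / 2`. Hence no contrary trial is
    -- close to an initial end.
    (Low := fun l => l = P.lo ∨ (P.δ < ‖v (Y (trialPoint s l))‖ ∧ acceptance p P.H Y s l < 1 / 2))
    (High := fun l => l = P.hi ∨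
      (P.δ < ‖v (Y (trialPoint s l))‖ ∧ (p : ℝ) / (p + 1) < acceptance p P.H Y s l))
    (fun l _ h1 h2 => Or.inr ⟨h1, h2⟩) (fun l _ h1 h2 => Or.inr ⟨h1, h2⟩) ?_
    P.T P.lo P.hi hlo0 (by linarith) (hP.T_ge hp) (Or.inl rfl) (Or.inl rfl)
  rintro l l' hl hll hlτ h1 h2
  have hl2 : l' ≤ 2 * l := by nlinarith
  have hl' := hl.trans_le hll
  rcases h1 with rfl | ⟨h1, h1'⟩
  · rcases h2 with rfl | ⟨h2, h2'⟩
    · linarith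
    · linarith [hlow l' hl' hl2]
  · rcases h2 with rfl | ⟨h2, h2'⟩
    · linarith [hhigh l hl hl2 h1]
    · exact h.not_low_high hp hA hx hy hl hll hlτ h1 h1' h2'

/-- For `p = 1` the acceptance window is the single value `1 / 2` and the tested quantity is `l * H`
whatever the step, so the first trial is never rejected. -/
theorem catdStep_spec_of_eq_one (h : TensorMethod p P.H P.δ δ' D₀ Φ v xs Err Y) (hp : p = 1)
    (hP : SearchParams p D₀ P) (hY : ∀ x, (tensorStep x).val = Y x)
    (hv : ∀ y, (grad y).val = v y) {s : CATDState E} (hA : 0 ≤ s.A) (hx : ‖s.x - xs‖ ≤ D₀)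
    (hy : ‖s.y - xs‖ ≤ 3 * D₀) :
    SearchSpec p P.H P.δ D₀ v xs Y s (catdStep p P tensorStep grad s P.T P.lo P.hi).val := by
  have hH := h.H_pos
  have hD := h.D_pos
  obtain ⟨h1, h2, h3⟩ := hP.one hp
  have hx3 : ‖s.x - xs‖ ≤ 3 * D₀ := by linarith
  have hYf : (fun x => (tensorStep x).val) = Y := funext hY
  have hvf : (fun y => (grad y).val) = v := funext hv
  obtain ⟨T, hT⟩ : ∃ T, P.T = T + 1 := ⟨P.T - 1, by omega⟩
  have hm : √(1 / (2 * P.H) * (1 / (2 * P.H))) = 1 / (2 * P.H) :=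
    Real.sqrt_mul_self (by positivity)
  have hl : 0 < 1 / (2 * P.H) := by positivity
  have hacc : acceptance p P.H Y s (1 / (2 * P.H)) = 1 / 2 := by
    unfold acceptance; subst hp; simp; field_simp
  have hp1 : (p : ℝ) / (p + 1) = 1 / 2 := by subst hp; norm_num
  rw [h1, h2, hT, catdStep_succ_val, hYf, hvf, hY, hv, hm, hacc, hp1]
  simp only [lt_irrefl, if_false]
  split_ifs with c1
  · refine ⟨fun y hy' => ?_, fun s' hs' => by cases hs'⟩
    cases hy'
    exact ⟨c1, (h.norm_tensorStep_sub_le (norm_trialPoint_sub_le s hl hA hx3 hy)).trans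
      (by gcongr; linarith)⟩
  · exact ⟨fun y hy => (by cases hy), fun s' hs' => ⟨_, hl, (Sum.inr.inj hs').symm, not_le.1 c1,
      hacc.ge, (hacc.trans hp1.symm).le⟩⟩

theorem catdStep_searchSpec (h : TensorMethod p P.H P.δ δ' D₀ Φ v xs Err Y)
    (hP : SearchParams p D₀ P) (hY : ∀ x, (tensorStep x).val = Y x)
    (hv : ∀ y, (grad y).val = v y) {s : CATDState E} (hA : 0 ≤ s.A) (hx : ‖s.x - xs‖ ≤ D₀)
    (hy : ‖s.y - xs‖ ≤ 3 * D₀) :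
    SearchSpec p P.H P.δ D₀ v xs Y s (catdStep p P tensorStep grad s P.T P.lo P.hi).val := by
  rcases h.hp.eq_or_lt with hp | hp
  · exact h.catdStep_spec_of_eq_one hp.symm hP hY hv hA hx hy
  · exact h.catdStep_spec_of_two_le hp hP hY hv hA hx hy

end TensorMethod

/-! ## One round of CATD -/

/-- The invariant of CATD after `i` of `N` steps, for a start at distance at most `D`. -/
structure RoundInvariant (p : ℕ) (H δ D : ℝ) (Φ : E → ℝ) (v : E → E) (xs : E) (N i : ℕ)
    (s : CATDState E) : Prop where
  A_nonneg : 0 ≤ s.A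
  dist : ‖s.y - xs‖ ≤ 3 * D
  potential : ∃ W, 0 ≤ W ∧
    ‖s.x - xs‖ ^ 2 / 2 + s.A * (Φ s.y - Φ xs) + 5 / 18 * W ≤ D ^ 2 / 2 ∧
    growthConst p H * (i * ((1 + growthExponent p) * (4 * D ^ 2 / N) ^ (-growthExponent p)) -
      growthExponent p * (4 * D ^ 2 / N) ^ (-growthExponent p) / (4 * D ^ 2 / N) * W) ≤
        s.A ^ (1 / ((p : ℝ) + 1))
  grad : 0 < i → δ < ‖v s.y‖ ∧ 9 / 10 * δ ≤ H * (p + 2) * (2 * D) ^ p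

namespace TensorMethod

variable {p : ℕ} {δ' D₀ D : ℝ} {Φ : E → ℝ} {v : E → E} {xs : E} {Err : E → E → E} {Y : E → E}
  {P : CATDParams} {tensorStep grad : E → Tally E}

theorem roundInvariant_zero {H δ : ℝ} (hD : 0 ≤ D) (hp : 1 ≤ p) {z : E} (hz : ‖z - xs‖ ≤ D)
    (N : ℕ) : RoundInvariant p H δ D Φ v xs N 0 ⟨0, z, z⟩ where
  A_nonneg := le_rfl
  dist := by change ‖z - xs‖ ≤ _; linarith
  potential := by
    refine ⟨0, le_rfl, ?_, ?_⟩
    · have := pow_le_pow_left₀ (norm_nonneg _) hz 2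
      simp only [zero_mul, mul_zero, add_zero]
      linarith
    · simp only [Nat.cast_zero, zero_mul, mul_zero, sub_zero]
      rw [Real.zero_rpow (by positivity)]
  grad := fun h => absurd h (lt_irrefl _)

theorem roundInvariant_norm_x_sub_le {H δ : ℝ} (h : TensorMethod p H δ δ' D₀ Φ v xs Err Y)
    (hD : 0 ≤ D) {N i : ℕ} {s : CATDState E}
    (hs : RoundInvariant p H δ D Φ v xs N i s) : ‖s.x - xs‖ ≤ D := by
  obtain ⟨W, hW, h1, -⟩ := hs.potential
  have h2 : 0 ≤ s.A * (Φ s.y - Φ xs) := mul_nonneg hs.A_nonneg (sub_nonneg.2 (h.minimal _))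
  exact le_of_pow_le_pow_left₀ two_ne_zero hD (by linarith)

theorem roundInvariant_succ {H δ : ℝ} (h : TensorMethod p H δ δ' D₀ Φ v xs Err Y) (hD : 0 < D)
    (hDD : D ≤ D₀) {N i : ℕ} (hN : 1 ≤ N) {s : CATDState E}
    (hs : RoundInvariant p H δ D Φ v xs N i s)
    {l : ℝ} (hl : 0 < l) (hδ : δ < ‖v (Y (trialPoint s l))‖) (h1 : 1 / 2 ≤ acceptance p H Y s l)
    (h2 : acceptance p H Y s l ≤ (p : ℝ) / (p + 1)) :
    RoundInvariant p H δ D Φ v xs N (i + 1) (nextState v Y s l) := by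
  have hH := h.H_pos
  have hA := hs.A_nonneg
  have hxD := h.roundInvariant_norm_x_sub_le hD.le hs
  obtain ⟨W, hW, hpot, hgrow⟩ := hs.potential
  have hw := stepWeight_pos hl hA
  have hwl := le_stepWeight hl hA
  have hwsq := stepWeight_sq hl hA
  have hxt := norm_trialPoint_sub_le s hl hA (xs := xs) (B := 3 * D) (by linarith) hs.dist
  have hxt0 : ‖trialPoint s l - xs‖ ≤ 3 * D₀ := by linarith
  have hms := h.norm_smul_grad_add_le hxt0 hδ hl h1 h2
  have hstep := potential_step h.convex s hl hA xs _ hms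
  have hd0 := h.tensorStep_sub_ne_zero hxt0 hδ
  have hg := growth_step h.hp hH hl hA hd0 h1
  have hd1 := h.le_norm_tensorStep_sub_pow hxt0 hδ
  have hmin := h.minimal (Y (trialPoint s l))
  have hxtdef : (s.A + stepWeight l s.A) • trialPoint s l = s.A • s.y + stepWeight l s.A • s.x := by
    have : s.A + stepWeight l s.A ≠ 0 := by positivity
    rw [trialPoint, smul_add, smul_smul, smul_smul, mul_div_cancel₀ _ this,
      mul_div_cancel₀ _ this]
  set a := stepWeight l s.A
  set xt := trialPoint s l
  set y' := Y xt with hy'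
  set d := ‖y' - xt‖ with hd
  set A' := s.A + a with hA'
  have hA'0 : 0 < A' := by positivity
  set w := A' / l * d ^ 2 with hw_def
  have hw0 : 0 < w := by positivity
  -- The potential only leaves `W + w ≤ 9 / 5 * D ^ 2`; the larger bound is the square of `2 * D`.
  have hWw : W + w ≤ 4 * D ^ 2 := by
    have i1 : 0 ≤ A' * (Φ y' - Φ xs) := mul_nonneg hA'0.le (by linarith)
    have i2 : 0 ≤ ‖s.x - a • v y' - xs‖ ^ 2 := by positivity
    have i3 := sq_nonneg D
    linarith
  have hd2 : d ≤ 2 * D := by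
    refine le_of_pow_le_pow_left₀ two_ne_zero (by positivity) ?_
    have i1 : 1 ≤ A' / l := (one_le_div hl).2 (by linarith)
    have i2 : d ^ 2 ≤ w := le_mul_of_one_le_left (by positivity) i1
    rw [mul_pow]
    linarith
  -- This keeps the iterates within `3 * D` without any growth condition: in the convex combination
  -- that forms `x̃`, the weight `a` belongs to a point at distance at most `D`, and the step adds
  -- at most `2 * D` with the same weight.
  have had : A' * d ≤ a * (2 * D) := by
    refine le_of_pow_le_pow_left₀ two_ne_zero (by positivity) ?_
    have i1 : (A' * d) ^ 2 = a ^ 2 * w := by rw [hw_def, hwsq]; field_simp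
    have i2 : w ≤ (2 * D) ^ 2 := by rw [mul_pow]; linarith
    rw [i1, mul_pow]
    gcongr
  refine ⟨hA'0.le, ?_, ⟨W + w, by positivity, ?_, ?_⟩, fun _ => ⟨hδ, ?_⟩⟩
  · change ‖y' - xs‖ ≤ 3 * D
    have e1 : A' • (y' - xs) = A' • (y' - xt) + (s.A • (s.y - xs) + a • (s.x - xs)) := by
      have : A' • (y' - xs) = A' • (y' - xt) + (A' • xt - A' • xs) := by module
      rw [this, hxtdef, hA']
      module
    have e2 : A' * ‖y' - xs‖ ≤ A' * (3 * D) := by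
      calc A' * ‖y' - xs‖ = ‖A' • (y' - xs)‖ := by rw [norm_smul, Real.norm_of_nonneg hA'0.le]
        _ ≤ A' * d + (s.A * ‖s.y - xs‖ + a * ‖s.x - xs‖) := by
          rw [e1]
          refine (norm_add_le _ _).trans (add_le_add ?_ ((norm_add_le _ _).trans (add_le_add ?_ ?_)))
          · rw [norm_smul, Real.norm_of_nonneg hA'0.le]
          · rw [norm_smul, Real.norm_of_nonneg hA]
          · rw [norm_smul, Real.norm_of_nonneg hw.le]
        _ ≤ a * (2 * D) + (s.A * (3 * D) + a * D) := by
          gcongr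
          exact hs.dist
        _ = A' * (3 * D) := by rw [hA']; ring
    exact le_of_mul_le_mul_left e2 hA'0
  · change ‖s.x - a • v y' - xs‖ ^ 2 / 2 + A' * (Φ y' - Φ xs) + 5 / 18 * (W + w) ≤ D ^ 2 / 2
    linarith
  · change _ ≤ A' ^ (1 / ((p : ℝ) + 1))
    have hγ0 : 0 ≤ growthExponent p := by
      have : (1 : ℝ) ≤ p := by exact_mod_cast h.hp
      exact div_nonneg (by linarith) (by positivity)
    have hN0 : (0 : ℝ) < N := by exact_mod_cast hN
    have hgc : 0 < growthConst p H := by unfold growthConst; positivity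
    have ht := rpow_neg_ge_tangent hγ0 hw0 (show 0 < 4 * D ^ 2 / (N : ℝ) by positivity)
    have ht' := mul_le_mul_of_nonneg_left ht hgc.le
    push_cast
    linarith
  · refine hd1.trans ?_
    gcongr

theorem catd_succ_val (N : ℕ) (s : CATDState E) :
    (catd p P tensorStep grad (N + 1) s).val =
      match (catdStep p P tensorStep grad s P.T P.lo P.hi).val with
      | Sum.inl y => Sum.inl y
      | Sum.inr s' => (catd p P tensorStep grad N s').val := by
  simp only [catd, bind]
  rcases (catdStep p P tensorStep grad s P.T P.lo P.hi).val with y | s' <;> rfl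

theorem catd_spec (h : TensorMethod p P.H P.δ δ' D₀ Φ v xs Err Y) (hP : SearchParams p D₀ P)
    (hY : ∀ x, (tensorStep x).val = Y x) (hv : ∀ y, (grad y).val = v y) (hD : 0 < D)
    (hDD : D ≤ D₀) {N : ℕ} (hN : 1 ≤ N) (n i : ℕ) (hni : i + n = N) (s : CATDState E)
    (hs : RoundInvariant p P.H P.δ D Φ v xs N i s) :
    (∀ y, (catd p P tensorStep grad n s).val = Sum.inl y →
      ‖v y‖ ≤ P.δ ∧ ‖y - xs‖ ≤ stepRadius p * D₀) ∧
    (∀ y, (catd p P tensorStep grad n s).val = Sum.inr y →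
      ∃ s', RoundInvariant p P.H P.δ D Φ v xs N N s' ∧ s'.y = y) := by
  induction n generalizing i s with
  | zero =>
    refine ⟨fun y hy => ?_, fun y hy => ⟨s, ?_, Sum.inr.inj hy⟩⟩
    · cases hy
    · have : i = N := by omega
      rwa [this] at hs
  | succ n ih =>
    have hx := h.roundInvariant_norm_x_sub_le hD.le hs
    have hspec := h.catdStep_searchSpec hP hY hv hs.A_nonneg (hx.trans hDD)
      (hs.dist.trans (by linarith))
    rw [catd_succ_val]
    rcases hres : (catdStep p P tensorStep grad s P.T P.lo P.hi).val with y | s'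
    · refine ⟨fun z hz => ?_, fun z hz => by cases hz⟩
      cases hz
      exact hspec.done y hres
    · obtain ⟨l, hl, rfl, h1, h2, h3⟩ := hspec.next s' hres
      exact ih (i + 1) (by omega) _ (h.roundInvariant_succ hD hDD hN hs hl h1 h2 h3)

theorem rate (h : TensorMethod p P.H P.δ δ' D₀ Φ v xs Err Y) (hD : 0 < D) {N : ℕ} (hN : 1 ≤ N)
    {s : CATDState E} (hs : RoundInvariant p P.H P.δ D Φ v xs N N s) :
    (N : ℝ) ^ ((3 * (p : ℝ) + 1) / 2) * (Φ s.y - Φ xs) ≤ rateConst p * P.H * D ^ (p + 1) := by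
  obtain ⟨W, hW, hpot, hgrow⟩ := hs.potential
  have hΦ : 0 ≤ Φ s.y - Φ xs := sub_nonneg.2 (h.minimal _)
  have hH := h.H_pos
  have h1 : 0 ≤ s.A * (Φ s.y - Φ xs) := mul_nonneg hs.A_nonneg hΦ
  have h2 : 0 ≤ ‖s.x - xs‖ ^ 2 := by positivity
  have h3 := growth_bound h.hp hH hs.A_nonneg hD hN (by nlinarith) hgrow
  have hrc : 0 ≤ rateConst p := by unfold rateConst; positivity
  have h4 : D ^ (p + 1) = D ^ (p - 1) * D ^ 2 := by
    rw [← pow_add]; congr 1; have := h.hp; omega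
  calc _ ≤ rateConst p * P.H * D ^ (p - 1) * s.A * (Φ s.y - Φ xs) := by gcongr
    _ = rateConst p * P.H * D ^ (p - 1) * (s.A * (Φ s.y - Φ xs)) := by ring
    _ ≤ rateConst p * P.H * D ^ (p - 1) * D ^ 2 := by
      have : s.A * (Φ s.y - Φ xs) ≤ D ^ 2 := by nlinarith
      gcongr
    _ = _ := by rw [h4]; ring

/-! ## Restarts -/

theorem catdRestarts_succ_val (N : ℕ → ℕ) (K k : ℕ) (z : E) :
    (catdRestarts p P N tensorStep grad (K + 1) k z).val =
      match (catd p P tensorStep grad (N k) ⟨0, z, z⟩).val with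
      | Sum.inl y => y
      | Sum.inr z' => (catdRestarts p P N tensorStep grad K (k + 1) z').val := by
  simp only [catdRestarts, bind]
  rcases (catd p P tensorStep grad (N k) ⟨0, z, z⟩).val with y | s' <;> rfl

/-- CATD with restarts reaches the desired accuracy, when the rounds are long enough for the
distance to the minimiser to be halved in each of them. -/
theorem catdRestarts_spec (h : TensorMethod p P.H P.δ δ' D₀ Φ v xs Err Y)
    (hP : SearchParams p D₀ P) (hY : ∀ x, (tensorStep x).val = Y x) (hv : ∀ y, (grad y).val = v y)
    {N : ℕ → ℕ} (hN1 : ∀ k, 1 ≤ N k) {s μ : ℝ} (hs : 0 < s) (hμ : 0 < μ)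
    (hgrowth : ∀ y, μ * ‖y - xs‖ ^ s ≤ Φ y - Φ xs)
    (hN : ∀ k, rateConst p * P.H * (D₀ / 2 ^ k) ^ (p + 1) ≤
      (N k : ℝ) ^ ((3 * (p : ℝ) + 1) / 2) * (μ * (D₀ / 2 ^ k / 2) ^ s))
    {Ktot : ℕ} (hK : P.H * (p + 2) * (2 * (D₀ / 2 ^ (Ktot - 1))) ^ p < 9 / 10 * P.δ)
    (K k : ℕ) (hKk : K + 1 + k = Ktot) (z : E) (hz : ‖z - xs‖ ≤ D₀ / 2 ^ k) :
    ‖v (catdRestarts p P N tensorStep grad (K + 1) k z).val‖ ≤ P.δ ∧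
      ‖(catdRestarts p P N tensorStep grad (K + 1) k z).val - xs‖ ≤ stepRadius p * D₀ := by
  induction K generalizing k z with
  | zero =>
    have hD : 0 < D₀ / 2 ^ k := div_pos h.D_pos (by positivity)
    have hDD : D₀ / 2 ^ k ≤ D₀ := div_le_self h.D_pos.le (one_le_pow₀ one_le_two)
    have hspec := h.catd_spec hP hY hv hD hDD (hN1 k) (N k) 0 (by omega) _
      (roundInvariant_zero hD.le h.hp hz (N k))
    rw [catdRestarts_succ_val]
    rcases hres : (catd p P tensorStep grad (N k) ⟨0, z, z⟩).val with y | z'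
    · exact hspec.1 y hres
    · obtain ⟨s', hs', rfl⟩ := hspec.2 z' hres
      -- A completed last round would end with a gradient above `δ`, which `hK` forbids on so small
      -- a ball; the method must have stopped earlier.
      have h1 := (hs'.grad (hN1 k)).2
      have h2 : Ktot - 1 = k := by omega
      rw [h2] at hK
      linarith
  | succ K ih =>
    have hD : 0 < D₀ / 2 ^ k := div_pos h.D_pos (by positivity)
    have hDD : D₀ / 2 ^ k ≤ D₀ := div_le_self h.D_pos.le (one_le_pow₀ one_le_two)
    have hspec := h.catd_spec hP hY hv hD hDD (hN1 k) (N k) 0 (by omega) _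
      (roundInvariant_zero hD.le h.hp hz (N k))
    rw [catdRestarts_succ_val]
    rcases hres : (catd p P tensorStep grad (N k) ⟨0, z, z⟩).val with y | z'
    · exact hspec.1 y hres
    · obtain ⟨s', hs', rfl⟩ := hspec.2 z' hres
      refine ih (k + 1) (by omega) _ ?_
      -- The rate bounds the gap by the growth at half the distance, so the distance is halved.
      have h1 := h.rate hD (hN1 k) hs'
      have hN0 : (0 : ℝ) < (N k : ℝ) ^ ((3 * (p : ℝ) + 1) / 2) :=
        Real.rpow_pos_of_pos (by exact_mod_cast hN1 k) _
      have h2 := le_of_mul_le_mul_left (h1.trans (hN k)) hN0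
      have h3 := le_of_mul_le_mul_left ((hgrowth s'.y).trans h2) hμ
      have h4 := (Real.rpow_le_rpow_iff (norm_nonneg _) (by positivity) hs).1 h3
      rwa [pow_succ, ← div_div]

end TensorMethod

end Rounds

/-! ## Choice of the numerical parameters -/

section Parameters

/-- The parameters of CATD for regularisation `H`, accuracy `δ` and initial distance `D₀`. -/
def searchParams (p : ℕ) (H δ D₀ : ℝ) (T : ℕ) : CATDParams where
  H := H
  δ := δ
  lo := if p = 1 then 1 / (2 * H) else 1 / (4 * H * (stepRadius p * D₀) ^ (p - 1))
  hi := if p = 1 then 1 / (2 * H) else (p - 1)! / (H * (D₀ * resolution p H δ D₀) ^ (p - 1))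
  T := T

/-- The factor in the size of the search space. -/
def searchConst (p : ℕ) : ℝ :=
  4 * (p - 1)! * stepRadius p ^ (p - 1) * accuracyFactor p ^ p + 2 * (p + 2) * 2 ^ p

theorem resolution_eq (p : ℕ) {H δ D₀ : ℝ} (hH : 0 < H) (hδ : 0 < δ) (hD : 0 < D₀) :
    resolution p H δ D₀ = 1 / (accuracyFactor p * (1 + H * D₀ ^ p / δ)) := by
  have := TensorMethod.accuracyFactor_pos p
  unfold resolution
  field_simp

theorem one_le_searchConst (p : ℕ) : 1 ≤ searchConst p := by
  have h1 := three_le_stepRadius p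
  have h2 := TensorMethod.accuracyFactor_pos p
  have h3 : (1 : ℝ) ≤ 2 ^ p := one_le_pow₀ one_le_two
  have h4 : (0 : ℝ) ≤ 4 * (p - 1)! * stepRadius p ^ (p - 1) * accuracyFactor p ^ p := by positivity
  have h5 : (0 : ℝ) ≤ p := Nat.cast_nonneg p
  unfold searchConst
  nlinarith

theorem exists_nat_two_pow_ge {M : ℝ} (hM : 1 ≤ M) :
    ∃ n : ℕ, M ≤ 2 ^ n ∧ (n : ℝ) ≤ 2 * Real.log M + 1 := by
  have hl := Real.log_nonneg hM
  have h2 : (1 / 2 : ℝ) ≤ Real.log 2 := by linarith [Real.log_two_gt_d9]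
  refine ⟨⌈Real.log M / Real.log 2⌉₊, ?_, ?_⟩
  · have h1 := Nat.le_ceil (Real.log M / Real.log 2)
    rw [div_le_iff₀ (by linarith)] at h1
    rw [← Real.log_le_log_iff (by linarith) (by positivity), Real.log_pow]
    exact h1
  · have h1 := Nat.ceil_lt_add_one (show 0 ≤ Real.log M / Real.log 2 by positivity)
    have h3 : Real.log M / Real.log 2 ≤ 2 * Real.log M := by
      rw [div_le_iff₀ (by linarith)]; nlinarith
    linarith

/-- With `1 / u` the resolution, Bernoulli gives `(1 + 1 / u) ^ 2 ^ T ≥ 2 ^ T / u`. It is enough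
that `2 ^ T` exceeds `u * hi / lo`, a polynomial in `1 + H D₀ ^ p / δ`, and so `T` is logarithmic.
-/
theorem searchParams_spec {p : ℕ} (hp : 1 ≤ p) {H δ D₀ : ℝ} (hH : 0 < H) (hδ : 0 < δ)
    (hD : 0 < D₀) {n : ℕ} (hn : searchConst p * (1 + H * D₀ ^ p / δ) ^ p ≤ 2 ^ n) :
    SearchParams p D₀ (searchParams p H δ D₀ (n + 1)) := by
  have hb := three_le_stepRadius p
  have hβ := TensorMethod.accuracyFactor_pos p
  refine ⟨fun h1 => ⟨if_pos h1, if_pos h1, by simp [searchParams]⟩,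
    fun h2 => if_neg (by omega), fun h2 => if_neg (by omega), fun h2 => ?_⟩
  simp only [searchParams, if_neg (show p ≠ 1 by omega)]
  rw [resolution_eq p hH hδ hD]
  set X := H * D₀ ^ p / δ with hX
  have hX0 : 0 < X := by positivity
  set u := accuracyFactor p * (1 + X) with hu
  have hu0 : 0 < u := by positivity
  have h3 : 1 + ((2 ^ (n + 1) : ℕ) : ℝ) * (1 / u) ≤ (1 + 1 / u) ^ 2 ^ (n + 1) :=
    one_add_mul_le_pow (by have : 0 < 1 / u := by positivity
                           linarith) _
  have h4 : 4 * (p - 1)! * stepRadius p ^ (p - 1) * u ^ p ≤ 2 ^ (n + 1) := by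
    have i1 : 4 * (p - 1)! * stepRadius p ^ (p - 1) * u ^ p ≤ searchConst p * (1 + X) ^ p := by
      rw [hu, mul_pow, ← mul_assoc, searchConst]
      gcongr
      have : (0 : ℝ) ≤ 2 * (p + 2) * 2 ^ p := by positivity
      linarith
    have i2 : (2 : ℝ) ^ n ≤ 2 ^ (n + 1) := pow_le_pow_right₀ one_le_two (by omega)
    linarith
  have h5 : u ^ p = u ^ (p - 1) * u := by rw [← pow_succ]; congr 1; omega
  have h6 : 4 * (p - 1)! * (stepRadius p * u) ^ (p - 1) ≤ (1 + 1 / u) ^ 2 ^ (n + 1) := by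
    refine le_trans ?_ h3
    refine le_trans ?_ (le_add_of_nonneg_left zero_le_one)
    rw [mul_one_div, le_div_iff₀ hu0]
    push_cast
    refine le_trans (le_of_eq ?_) h4
    rw [mul_pow, h5]; ring
  rw [one_div_mul_eq_div, le_div_iff₀ (by positivity)]
  refine le_trans (le_of_eq ?_) h6
  rw [mul_pow, mul_pow, mul_pow, div_pow, one_pow]
  field_simp

theorem final_round_le {p : ℕ} (hp : 1 ≤ p) {H δ D₀ : ℝ} (hH : 0 < H) (hδ : 0 < δ)
    (hD : 0 < D₀) {n : ℕ} (hn : searchConst p * (1 + H * D₀ ^ p / δ) ^ p ≤ 2 ^ n) :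
    H * (p + 2) * (2 * (D₀ / 2 ^ (n + 1 - 1))) ^ p < 9 / 10 * δ := by
  have hb := three_le_stepRadius p
  have hβ := TensorMethod.accuracyFactor_pos p
  set X := H * D₀ ^ p / δ with hX
  have hX0 : 0 < X := by positivity
  -- Rounds are numbered from 0, so the last of `n + 1` rounds starts at distance `D₀ / 2 ^ n`.
  rw [Nat.add_sub_cancel, mul_div_assoc', div_pow, mul_pow]
  have h1 : (2 : ℝ) ^ n ≤ (2 ^ n) ^ p := le_self_pow₀ (one_le_pow₀ one_le_two) (by omega)
  have h2 : 2 * (p + 2) * 2 ^ p * X < searchConst p * (1 + X) ^ p := by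
    have i1 : 2 * ((p : ℝ) + 2) * 2 ^ p ≤ searchConst p := by
      rw [searchConst]
      have : (0 : ℝ) ≤ 4 * (p - 1)! * stepRadius p ^ (p - 1) * accuracyFactor p ^ p := by positivity
      linarith
    have i2 : 1 + X ≤ (1 + X) ^ p := le_self_pow₀ (by linarith) (by omega)
    have i3 : X < (1 + X) ^ p := by linarith
    have := one_le_searchConst p
    calc _ ≤ searchConst p * X := by gcongr
      _ < _ := by gcongr
  have h3 : 2 * (p + 2) * 2 ^ p * X < (2 ^ n) ^ p := by linarith
  have h4 : 2 * (p + 2) * 2 ^ p * (H * D₀ ^ p) < (2 ^ n) ^ p * δ := by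
    rw [hX, ← mul_div_assoc, div_lt_iff₀ hδ] at h3
    exact h3
  rw [← mul_div_assoc, div_lt_iff₀ (by positivity)]
  have : 0 < (2 ^ n) ^ p * δ := by positivity
  linarith

/-- The number of trials and of rounds is logarithmic. -/
theorem exists_search_size (p : ℕ) : ∃ C : ℝ, 0 < C ∧ ∀ X B : ℝ, 0 ≤ X → 1 ≤ B →
    Real.log (1 + X) ≤ B → ∃ n : ℕ, searchConst p * (1 + X) ^ p ≤ 2 ^ n ∧
      ((n + 1 : ℕ) : ℝ) ≤ C * B := by
  have hc := one_le_searchConst p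
  have hlc := Real.log_nonneg hc
  refine ⟨2 * Real.log (searchConst p) + 2 * p + 2, by positivity, fun X B hX hB hXB => ?_⟩
  have h1 : (1 : ℝ) ≤ (1 + X) ^ p := one_le_pow₀ (by linarith)
  obtain ⟨n, hn, hn'⟩ := exists_nat_two_pow_ge (M := searchConst p * (1 + X) ^ p)
    (one_le_mul_of_one_le_of_one_le hc h1)
  refine ⟨n, hn, ?_⟩
  rw [Real.log_mul (by linarith) (by linarith), Real.log_pow] at hn'
  push_cast
  have h2 : (p : ℝ) * Real.log (1 + X) ≤ p * B := by gcongr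
  have h3 : Real.log (searchConst p) ≤ Real.log (searchConst p) * B := le_mul_of_one_le_right hlc hB
  nlinarith

/-! ### Lengths of the rounds -/

theorem one_le_restartLength (p : ℕ) (s σ c L R : ℝ) (k : ℕ) : 1 ≤ restartLength p s σ c L R k :=
  le_max_right _ _

/-- The length is the rate of CATD solved for halving the distance. The hypothesis `h` allows a
nominal constant `σ`, corrected by `c`, in place of the growth constant `μ` that is actually
available. -/
theorem restartLength_spec (p : ℕ) {s σ c L R H μ : ℝ} (hs : 0 < s) (hσ : 0 < σ) (hc : 0 < c)
    (hL : 0 < L) (hR : 0 < R) (hμ : 0 < μ)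
    (h : rateConst p * H * σ ≤ s * c * L * μ) (k : ℕ) :
    rateConst p * H * (R / 2 ^ k) ^ (p + 1) ≤
      (restartLength p s σ c L R k : ℝ) ^ ((3 * (p : ℝ) + 1) / 2) *
        (μ * (R / 2 ^ k / 2) ^ s) := by
  set D := R / 2 ^ k with hD
  have hD0 : 0 < D := by positivity
  set Z := s * c * L * 2 ^ s / σ * D ^ ((p : ℝ) + 1 - s) with hZ
  have hZ0 : 0 < Z := by positivity
  have h1 : Z ^ ((2 : ℝ) / (3 * p + 1)) ≤ restartLength p s σ c L R k := by
    refine (Nat.le_ceil _).trans ?_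
    exact Nat.cast_le.2 (le_max_left _ _)
  have h2 : Z ≤ (restartLength p s σ c L R k : ℝ) ^ ((3 * (p : ℝ) + 1) / 2) := by
    have := Real.rpow_le_rpow (by positivity) h1 (show 0 ≤ (3 * (p : ℝ) + 1) / 2 by positivity)
    rw [← Real.rpow_mul hZ0.le] at this
    rwa [show (2 : ℝ) / (3 * p + 1) * ((3 * p + 1) / 2) = 1 by field_simp, Real.rpow_one] at this
  refine le_trans ?_ (mul_le_mul_of_nonneg_right h2 (by positivity))
  have h3 : D ^ ((p : ℝ) + 1 - s) * D ^ s = D ^ (p + 1) := by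
    rw [← Real.rpow_add hD0, sub_add_cancel]; norm_cast
  have h4 : Z * (μ * (D / 2) ^ s) = s * c * L * μ / σ * D ^ (p + 1) := by
    rw [hZ, Real.div_rpow hD0.le zero_le_two, ← h3]
    field_simp
  rw [h4]
  gcongr
  rw [le_div_iff₀ hσ]
  exact h

theorem restartLength_le {p : ℕ} {s σ c L R : ℝ} (hs : 0 < s) (hsp : s ≤ (p : ℝ) + 1) (hσ : 0 < σ)
    (hc : 0 < c) (hL : 0 < L) (hR : 0 < R) (k : ℕ) :
    (restartLength p s σ c L R k : ℝ) ≤ 1 + (s * c * 2 ^ s) ^ ((2 : ℝ) / (3 * p + 1)) *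
      (L * R ^ ((p : ℝ) + 1 - s) / σ) ^ ((2 : ℝ) / (3 * p + 1)) := by
  have h0 : R / 2 ^ k ≤ R := div_le_self hR.le (one_le_pow₀ one_le_two)
  have h1 : s * c * L * 2 ^ s / σ * (R / 2 ^ k) ^ ((p : ℝ) + 1 - s) ≤
      (s * c * 2 ^ s) * (L * R ^ ((p : ℝ) + 1 - s) / σ) := by
    have : (R / 2 ^ k) ^ ((p : ℝ) + 1 - s) ≤ R ^ ((p : ℝ) + 1 - s) :=
      Real.rpow_le_rpow (by positivity) h0 (by linarith)
    calc _ ≤ s * c * L * 2 ^ s / σ * R ^ ((p : ℝ) + 1 - s) := by gcongr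
      _ = _ := by ring
  have h2 := Real.rpow_le_rpow (by positivity) h1 (show 0 ≤ (2 : ℝ) / (3 * p + 1) by positivity)
  rw [Real.mul_rpow (x := s * c * 2 ^ s) (by positivity) (by positivity)] at h2
  have h3 := Nat.ceil_lt_add_one (show 0 ≤
    (s * c * L * 2 ^ s / σ * (R / 2 ^ k) ^ ((p : ℝ) + 1 - s)) ^ ((2 : ℝ) / (3 * p + 1)) by positivity)
  have h4 : (0 : ℝ) ≤ (s * c * 2 ^ s) ^ ((2 : ℝ) / (3 * p + 1)) *
      (L * R ^ ((p : ℝ) + 1 - s) / σ) ^ ((2 : ℝ) / (3 * p + 1)) := by positivity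
  unfold restartLength
  rw [Nat.cast_max, Nat.cast_one]
  exact max_le (by linarith) (by linarith)

end Parameters

/-! ## Counting oracle calls -/

section Counting

variable {E : Type*} [NormedAddCommGroup E] [InnerProductSpace ℝ E]
  {p : ℕ} {P : CATDParams} {tensorStep grad : E → Tally E} {a b a' b' : ℕ}

theorem catdStep_calls (h1 : ∀ x, (tensorStep x).nf ≤ a ∧ (tensorStep x).ng ≤ a')
    (h2 : ∀ y, (grad y).nf ≤ b ∧ (grad y).ng ≤ b') (s : CATDState E) (n : ℕ) (lo hi : ℝ) :
    (catdStep p P tensorStep grad s n lo hi).nf ≤ n * (a + b) ∧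
      (catdStep p P tensorStep grad s n lo hi).ng ≤ n * (a' + b') := by
  induction n generalizing lo hi with
  | zero => exact ⟨Nat.zero_le _, Nat.zero_le _⟩
  | succ n ih =>
    set x := trialPoint s √(lo * hi) with hx
    set y := (tensorStep x).val with hy
    obtain ⟨t, ht, ht1, ht2⟩ : ∃ t : Tally (E ⊕ CATDState E),
        ((catdStep p P tensorStep grad s (n + 1) lo hi).nf =
            (tensorStep x).nf + ((grad y).nf + t.nf) ∧
          (catdStep p P tensorStep grad s (n + 1) lo hi).ng =
            (tensorStep x).ng + ((grad y).ng + t.ng)) ∧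
        t.nf ≤ n * (a + b) ∧ t.ng ≤ n * (a' + b') := by
      refine ⟨_, ⟨rfl, rfl⟩, ?_⟩
      dsimp only
      split_ifs
      · exact ⟨Nat.zero_le _, Nat.zero_le _⟩
      · exact ih _ _
      · exact ih _ _
      · exact ⟨Nat.zero_le _, Nat.zero_le _⟩
    have := h1 x
    have := h2 y
    rw [ht.1, ht.2]
    constructor <;> nlinarith

theorem catd_calls (h1 : ∀ x, (tensorStep x).nf ≤ a ∧ (tensorStep x).ng ≤ a')
    (h2 : ∀ y, (grad y).nf ≤ b ∧ (grad y).ng ≤ b') (N : ℕ) (s : CATDState E) :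
    (catd p P tensorStep grad N s).nf ≤ N * (P.T * (a + b)) ∧
      (catd p P tensorStep grad N s).ng ≤ N * (P.T * (a' + b')) := by
  induction N generalizing s with
  | zero => exact ⟨Nat.zero_le _, Nat.zero_le _⟩
  | succ N ih =>
    have hs := catdStep_calls (p := p) (P := P) h1 h2 s P.T P.lo P.hi
    simp only [catd, bind]
    rcases (catdStep p P tensorStep grad s P.T P.lo P.hi).val with y | s'
    · constructor
      · change _ + 0 ≤ _
        nlinarith
      · change _ + 0 ≤ _
        nlinarith
    · have := ih s'
      constructor
      · nlinarith
      · nlinarith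

theorem catdRestarts_calls (h1 : ∀ x, (tensorStep x).nf ≤ a ∧ (tensorStep x).ng ≤ a')
    (h2 : ∀ y, (grad y).nf ≤ b ∧ (grad y).ng ≤ b') {N : ℕ → ℕ} {M : ℕ} (hN : ∀ k, N k ≤ M)
    (K k : ℕ) (z : E) :
    (catdRestarts p P N tensorStep grad K k z).nf ≤ K * (M * (P.T * (a + b))) ∧
      (catdRestarts p P N tensorStep grad K k z).ng ≤ K * (M * (P.T * (a' + b'))) := by
  induction K generalizing k z with
  | zero => exact ⟨Nat.zero_le _, Nat.zero_le _⟩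
  | succ K ih =>
    have hs := catd_calls (p := p) (P := P) h1 h2 (N k) ⟨0, z, z⟩
    have hM1 := Nat.mul_le_mul_right (P.T * (a + b)) (hN k)
    have hM2 := Nat.mul_le_mul_right (P.T * (a' + b')) (hN k)
    simp only [catdRestarts, bind]
    rcases (catd p P tensorStep grad (N k) ⟨0, z, z⟩).val with y | z'
    · constructor
      · change _ + 0 ≤ _
        nlinarith
      · change _ + 0 ≤ _
        nlinarith
    · have := ih (k + 1) z'
      constructor
      · nlinarith
      · nlinarith

theorem plainCatdRestarts_calls {o : E → Tally (Jet E)}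
    [CompleteSpace E] (ho : ∀ y, (o y).nf ≤ 0 ∧ (o y).ng ≤ 1) {N : ℕ → ℕ} {M : ℕ}
    (hN : ∀ k, N k ≤ M) (K : ℕ) (z : E) :
    (plainCatdRestarts p P N o K z).nf ≤ 0 ∧
      (plainCatdRestarts p P N o K z).ng ≤ K * (M * (P.T * 2)) := by
  have := catdRestarts_calls (p := p) (P := P) (a := 0) (b := 0) (a' := 1) (b' := 1)
    (tensorStep := fun xt => do
      let J ← o xt
      pure (argmin fun y => J.model p P.H xt y))
    (grad := fun y => do
      let J ← o y
      pure J.grad)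
    (fun x => ho x) (fun y => ho y) hN K 0 z
  simpa [plainCatdRestarts] using this

/-- Each outer trial queries `f` once for the model and once for the stopping test. The inner run
differentiates the stored model at no cost and queries `g` twice per inner trial; the stopping test
of the outer trial adds one query of `g`. -/
theorem framework_calls [CompleteSpace E] (p : ℕ) (P : FrameworkParams) (f g : E → ℝ) {M M' : ℕ}
    (hM : ∀ k, P.outerN k ≤ M) (hM' : ∀ k, P.innerN k ≤ M') (z : E) :
    (framework p P (callF p f) (callG p g) z).nf ≤ P.outerK * (M * (P.outer.T * 2)) ∧
      (framework p P (callF p f) (callG p g) z).ng ≤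
        P.outerK * (M * (P.outer.T * (P.innerK * (M' * (P.inner.T * 2)) + 1))) := by
  refine catdRestarts_calls (a := 1) (b := 1) (fun x => ?_)
    (fun y => by constructor <;> exact le_of_eq rfl) hM _ _ _
  have h := plainCatdRestarts_calls (p := p) (P := P.inner) (N := P.innerN)
    (o := fun w => do
      let Jg ← callG p g w
      pure (jet p ((jet p f x).model p P.outer.H x) w + Jg))
    (fun y => ⟨le_rfl, le_rfl⟩) hM' P.innerK x
  constructor
  · change 1 + _ ≤ 1
    exact Nat.add_le_add_left h.1 1
  · change 0 + _ ≤ _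
    rw [zero_add]
    exact h.2

end Counting

/-! ## Gradients -/

section Gradients

variable {E : Type*} [NormedAddCommGroup E] [InnerProductSpace ℝ E] [CompleteSpace E]
  {u w : E → ℝ} {a b x : E}

theorem norm_gradient (u : E → ℝ) (x : E) : ‖gradient u x‖ = ‖fderiv ℝ u x‖ :=
  LinearIsometryEquiv.norm_map _ _

theorem norm_gradient_sub (u w : E → ℝ) (x y : E) :
    ‖gradient u x - gradient w y‖ = ‖fderiv ℝ u x - fderiv ℝ w y‖ := by
  unfold gradient
  rw [← map_sub]
  exact LinearIsometryEquiv.norm_map _ _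

theorem hasGradientAt_add (hu : HasGradientAt u a x) (hw : HasGradientAt w b x) :
    HasGradientAt (fun y => u y + w y) (a + b) x := by
  rw [hasGradientAt_iff_hasFDerivAt, map_add]
  exact hu.hasFDerivAt.add hw.hasFDerivAt

theorem hasGradientAt_sub (hu : HasGradientAt u a x) (hw : HasGradientAt w b x) :
    HasGradientAt (fun y => u y - w y) (a - b) x := by
  rw [hasGradientAt_iff_hasFDerivAt, map_sub]
  exact hu.hasFDerivAt.sub hw.hasFDerivAt

theorem hasGradientAt_const_mul (c : ℝ) (hu : HasGradientAt u a x) :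
    HasGradientAt (fun y => c * u y) (c • a) x := by
  have h := hu.hasFDerivAt.const_mul c
  rw [hasGradientAt_iff_hasFDerivAt]
  simpa using h

theorem gradient_eq_zero_of_minimal (h : ∀ y, u x ≤ u y) : gradient u x = 0 := by
  have : fderiv ℝ u x = 0 := IsLocalMin.fderiv_eq_zero (Filter.Eventually.of_forall h)
  simp [gradient, this]

/-- A function whose gradient is strongly monotone of degree `n + 1` is uniformly convex. -/
theorem add_inner_add_pow_le_of_gradient_monotone {Ψ : E → ℝ} {G : E → E}
    (hG : ∀ y, HasGradientAt Ψ (G y) y) {c : ℝ} {n : ℕ}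
    (hmono : ∀ x y, c * ‖x - y‖ ^ (n + 1) ≤ inner ℝ (G x - G y) (x - y)) (x y : E) :
    Ψ x + inner ℝ (G x) (y - x) + c / (n + 1) * ‖y - x‖ ^ (n + 1) ≤ Ψ y := by
  set d := y - x with hd
  -- The claim is `k 0 ≤ k 1` for the restriction of `Ψ` to the segment minus its tangent minus the
  -- asserted excess; monotonicity of the gradient makes `k` increasing.
  set k : ℝ → ℝ := fun t => Ψ (x + t • d) - t * inner ℝ (G x) d -
    c / (n + 1) * ‖d‖ ^ (n + 1) * t ^ (n + 1) with hk
  have hderiv : ∀ t, HasDerivAt k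
      (inner ℝ (G (x + t • d)) d - inner ℝ (G x) d - c * ‖d‖ ^ (n + 1) * t ^ n) t := by
    intro t
    have h1 : HasDerivAt (fun t : ℝ => x + t • d) d t := by
      simpa using ((hasDerivAt_id t).smul_const d).const_add x
    have h2 : HasDerivAt (fun t : ℝ => Ψ (x + t • d)) (inner ℝ (G (x + t • d)) d) t := by
      exact (hG (x + t • d)).hasFDerivAt.comp_hasDerivAt t h1
    have h3 : HasDerivAt (fun t : ℝ => t * inner ℝ (G x) d) (inner ℝ (G x) d) t := by
      simpa using (hasDerivAt_id t).mul_const (inner ℝ (G x) d)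
    have h4 := (hasDerivAt_pow (n + 1) t).const_mul (c / (n + 1) * ‖d‖ ^ (n + 1))
    have h5 := (h2.sub h3).sub h4
    convert! h5 using 1
    have : (n : ℝ) + 1 ≠ 0 := by positivity
    push_cast
    field_simp
  have hmon : MonotoneOn k (Set.Icc 0 1) := by
    refine monotoneOn_of_deriv_nonneg (convex_Icc 0 1)
      (fun t _ => (hderiv t).continuousAt.continuousWithinAt)
      (fun t _ => (hderiv t).differentiableAt.differentiableWithinAt) (fun t ht => ?_)
    rw [interior_Icc] at ht
    rw [(hderiv t).deriv]
    have h1 := hmono (x + t • d) x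
    rw [add_sub_cancel_left, norm_smul, Real.norm_of_nonneg ht.1.le, inner_smul_right,
      inner_sub_left] at h1
    have h2 : t * (c * ‖d‖ ^ (n + 1) * t ^ n) ≤
        t * (inner ℝ (G (x + t • d)) d - inner ℝ (G x) d) := by
      refine le_trans (le_of_eq ?_) h1
      ring
    linarith [le_of_mul_le_mul_left h2 ht.1]
  have := hmon (Set.left_mem_Icc.2 zero_le_one) (Set.right_mem_Icc.2 zero_le_one) zero_le_one
  simp only [hk, zero_smul, add_zero, one_smul, zero_mul, one_pow, mul_one, one_mul] at this
  rw [zero_pow (by omega), mul_zero, hd, add_sub_cancel, ← hd] at this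
  linarith

/-- Continuous functions with superlinear growth have minimisers. -/
theorem exists_minimizer [FiniteDimensional ℝ E] {q : E → ℝ} (hq : Continuous q) (a u : E)
    {c s : ℝ} (hc : 0 < c) (hs : 2 ≤ s)
    (h : ∀ y, q a + inner ℝ u (y - a) + c * ‖y - a‖ ^ s ≤ q y) : ∃ x, ∀ y, q x ≤ q y := by
  have : ProperSpace E := FiniteDimensional.proper_real E
  set B := max 1 (‖u‖ / c) with hB
  refine hq.exists_forall_le' a ?_
  filter_upwards [(isCompact_closedBall a B).compl_mem_cocompact] with y hy
  have hyB : B < ‖y - a‖ := by simpa [dist_eq_norm] using hy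
  have h1 : 1 ≤ ‖y - a‖ := (le_max_left _ _).trans hyB.le
  have h2 : ‖u‖ ≤ c * ‖y - a‖ := by
    rw [← div_le_iff₀' hc]; exact (le_max_right _ _).trans hyB.le
  have h3 : ‖y - a‖ ^ 2 ≤ ‖y - a‖ ^ s := by
    rw [← Real.rpow_two]; exact Real.rpow_le_rpow_of_exponent_le h1 hs
  have h4 := abs_le.1 (abs_real_inner_le_norm u (y - a))
  have h5 : ‖u‖ * ‖y - a‖ ≤ c * ‖y - a‖ * ‖y - a‖ := by gcongr
  have h6 : c * ‖y - a‖ ^ 2 ≤ c * ‖y - a‖ ^ s := by gcongr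
  have := h y
  linarith [h4.1]

theorem argmin_spec {q : E → ℝ} (h : ∃ x, ∀ y, q x ≤ q y) (y : E) : q (argmin q) ≤ q y :=
  Classical.epsilon_spec h y

theorem grad_jet {p : ℕ} (hp : 1 ≤ p) (u : E → ℝ) (x : E) : (jet p u x).grad = gradient u x := by
  unfold Jet.grad gradient jet
  rw [if_pos hp]
  congr 1
  ext d
  simp

theorem jet_add {p : ℕ} (hu : ContDiff ℝ p u) (hw : ContDiff ℝ p w) (x : E) :
    jet p u x + jet p w x = jet p (fun y => u y + w y) x := by
  funext k
  simp only [jet, Pi.add_apply]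
  split_ifs with hk
  · exact (iteratedFDeriv_add_apply (hu.of_le (by exact_mod_cast hk)).contDiffAt
      (hw.of_le (by exact_mod_cast hk)).contDiffAt).symm
  · simp

end Gradients

/-! ## Regularised Taylor models -/

section Models

variable {E : Type} [NormedAddCommGroup E] [InnerProductSpace ℝ E] [CompleteSpace E]
  {p : ℕ} {f g : E → ℝ} {H M : ℝ}

theorem modelErr_taylorError (hp : 1 ≤ p) (hf : ContDiff ℝ p f) (hM : 0 ≤ M)
    (hL : ∀ x y, ‖iteratedFDeriv ℝ p f x - iteratedFDeriv ℝ p f y‖ ≤ M * ‖x - y‖)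
    (hMH : M ≤ H / 2) : ModelErr p H (fun x y => gradient (taylorError p f x) y) where
  bound x y := by
    rw [norm_gradient]
    refine (norm_fderiv_taylorError_le hp hf hL x y).trans ?_
    gcongr
  lip x y z B hy hz := by
    have : 0 ≤ B := (norm_nonneg _).trans hy
    rw [norm_gradient_sub]
    refine (norm_fderiv_taylorError_sub_le hp hf hL x y z hy hz hM).trans ?_
    gcongr
  base x x' y B hx hx' := by
    have : 0 ≤ B := (norm_nonneg _).trans hx
    rw [norm_gradient_sub]
    refine (norm_fderiv_taylorError_sub_base_le hp hf hL x x' y hx hx' hM).trans ?_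
    gcongr

theorem hasGradientAt_model (hp : 1 ≤ p) (hf : ContDiff ℝ p f) (H : ℝ) (x y : E) :
    HasGradientAt (fun y => (jet p f x).model p H x y)
      (modelGrad p H (gradient f) (fun x y => gradient (taylorError p f x) y) x y) y := by
  have hp' : (p : WithTop ℕ∞) ≠ 0 := by simp; omega
  have h1 := (hf.differentiable hp' y).hasGradientAt
  have h2 := ((contDiff_taylorError hf x).differentiable hp' y).hasGradientAt
  have h3 := hasGradientAt_const_mul (H / p !) (hasGradientAt_norm_pow hp x y)
  have h4 := hasGradientAt_add (hasGradientAt_sub h1 h2) h3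
  convert! h4 using 1
  · funext z
    simp [Jet.model, taylorError]
  · rw [modelGrad, smul_smul (H / _)]
    congr 2
    ring

/-- The gradient of the subproblem of a tensor step. -/
theorem hasGradientAt_subproblem (hp : 1 ≤ p) (hf : ContDiff ℝ p f) (hg : Differentiable ℝ g)
    (H : ℝ) (x y : E) :
    HasGradientAt (fun y => (jet p f x).model p H x y + g y)
      (modelGrad p H (fun y => gradient f y + gradient g y)
        (fun x y => gradient (taylorError p f x) y) x y) y := by
  have h := hasGradientAt_add (hasGradientAt_model hp hf H x y) (hg y).hasGradientAt
  convert! h using 1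
  simp only [modelGrad]
  abel

theorem hasGradientAt_model_sub (hp : 1 ≤ p) (hf : ContDiff ℝ p f) (H : ℝ) (x y : E) :
    HasGradientAt (fun y => (jet p f x).model p H x y - f y)
      (modelGrad p H (fun _ => 0) (fun x y => gradient (taylorError p f x) y) x y) y := by
  have hp' : (p : WithTop ℕ∞) ≠ 0 := by simp; omega
  have h := hasGradientAt_sub (hasGradientAt_model hp hf H x y)
    (hf.differentiable hp' y).hasGradientAt
  convert! h using 1
  simp only [modelGrad]
  abel

/-- The factor between the regularisation and the Lipschitz constant that it contributes. -/
def regularizerConst (p : ℕ) : ℝ := normPowConst p (p + 1) + normPowConst (p + 1) (p + 1)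

theorem regularizerConst_nonneg (p : ℕ) : 0 ≤ regularizerConst p :=
  add_nonneg (normPowConst_nonneg _ _) (normPowConst_nonneg _ _)

theorem contDiff_model (p : ℕ) (f : E → ℝ) (H : ℝ) (x : E) :
    ContDiff ℝ p (fun y => (jet p f x).model p H x y) :=
  (contDiff_taylor p f x).add
    (contDiff_const.mul ((contDiff_norm_pow p).comp (contDiff_id.sub contDiff_const)))

/-- Only the regulariser contributes, since the `p`-th derivative of the Taylor polynomial is
constant. -/
theorem norm_iteratedFDeriv_model_sub_le (p : ℕ) (f : E → ℝ) (hH : 0 ≤ H) (x y z : E) :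
    ‖iteratedFDeriv ℝ p (fun y => (jet p f x).model p H x y) y -
      iteratedFDeriv ℝ p (fun y => (jet p f x).model p H x y) z‖ ≤
      H * regularizerConst p * ‖y - z‖ := by
  set q : E → ℝ := fun y => ‖y‖ ^ (p + 1) with hq
  have hqc : ContDiff ℝ p q := contDiff_norm_pow p
  have hqx : ContDiff ℝ p (fun y => q (y - x)) := hqc.comp (contDiff_id.sub contDiff_const)
  have key : ∀ w, iteratedFDeriv ℝ p (fun y => (jet p f x).model p H x y) w =
      iteratedFDeriv ℝ p (fun y => (jet p f x).taylor p x y) w +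
        (H / p !) • iteratedFDeriv ℝ p q (w - x) := by
    intro w
    have h1 : (fun y => (jet p f x).model p H x y) =
        (fun y => (jet p f x).taylor p x y) + ((H / p !) • fun y => q (y - x)) := rfl
    rw [h1, iteratedFDeriv_add_apply (contDiff_taylor p f x).contDiffAt
      (show ContDiffAt ℝ p ((H / (p ! : ℝ)) • fun y => q (y - x)) w from
        (hqx.const_smul (H / (p ! : ℝ))).contDiffAt),
      iteratedFDeriv_const_smul_apply hqx.contDiffAt, iteratedFDeriv_comp_sub]
  have h2 := norm_iteratedFDeriv_norm_pow_sub_le p (y - x) (z - x)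
  rw [sub_sub_sub_cancel_right] at h2
  rw [key, key, iteratedFDeriv_taylor_const p f x y z, add_sub_add_left_eq_sub, ← smul_sub,
    norm_smul, Real.norm_of_nonneg (by positivity)]
  have hf1 : (1 : ℝ) ≤ p ! := by exact_mod_cast Nat.succ_le_of_lt (Nat.factorial_pos p)
  have hc := regularizerConst_nonneg p
  calc _ ≤ H / p ! * (regularizerConst p * ‖y - z‖) := by gcongr; exact h2
    _ ≤ H * (regularizerConst p * ‖y - z‖) := by gcongr; exact div_le_self hH hf1
    _ = _ := by ring

end Models

/-! ### Admissibility of the search intervals -/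

section Parameters

theorem resolution_le_one (p : ℕ) {H δ D₀ : ℝ} (hH : 0 < H) (hδ : 0 < δ) (hD : 0 < D₀) :
    resolution p H δ D₀ ≤ 1 := by
  have h1 := le_accuracyFactor p
  have h2 : (0 : ℝ) ≤ p := Nat.cast_nonneg p
  have h3 : 0 ≤ H * D₀ ^ p / δ := by positivity
  have h4 : 1 ≤ accuracyFactor p * (1 + H * D₀ ^ p / δ) :=
    one_le_mul_of_one_le_of_one_le (by linarith) (by linarith)
  rw [resolution_eq p hH hδ hD]
  exact div_le_one_of_le₀ h4 (by linarith)

theorem resolution_pos (p : ℕ) {H δ D₀ : ℝ} (hH : 0 < H) (hδ : 0 < δ) (hD : 0 < D₀) :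
    0 < resolution p H δ D₀ := by
  have := TensorMethod.accuracyFactor_pos p
  unfold resolution
  positivity

theorem searchParams_lo_pos (p : ℕ) {H δ D₀ : ℝ} (hH : 0 < H) (hD : 0 < D₀) (T : ℕ) :
    0 < (searchParams p H δ D₀ T).lo := by
  have := three_le_stepRadius p
  simp only [searchParams]
  split_ifs <;> positivity

theorem searchParams_lo_le_hi (p : ℕ) {H δ D₀ : ℝ} (hH : 0 < H) (hδ : 0 < δ) (hD : 0 < D₀) (T : ℕ) :
    (searchParams p H δ D₀ T).lo ≤ (searchParams p H δ D₀ T).hi := by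
  have h1 := three_le_stepRadius p
  have h2 := resolution_le_one p hH hδ hD
  have h3 := resolution_pos p hH hδ hD
  simp only [searchParams]
  split_ifs
  · rfl
  · have h4 : D₀ * resolution p H δ D₀ ≤ stepRadius p * D₀ := by nlinarith
    have h5 : (1 : ℝ) ≤ (p - 1)! := by exact_mod_cast Nat.succ_le_of_lt (Nat.factorial_pos _)
    refine div_le_div₀ (by linarith) h5 (by positivity) ?_
    gcongr
    linarith

end Parameters

/-! ### Correctness of the inner method and of the nested framework -/

section Methods

variable {E : Type} [NormedAddCommGroup E] [InnerProductSpace ℝ E] [FiniteDimensional ℝ E]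
  [CompleteSpace E] {p : ℕ}

/-- CATD with restarts for a convex function given by an oracle reaches the desired accuracy. -/
theorem plainCatdRestarts_spec (hp : 1 ≤ p) {h : E → ℝ} (hh : ContDiff ℝ p h) {H M δ D₀ : ℝ}
    (hM : 0 ≤ M) (hL : ∀ x y, ‖iteratedFDeriv ℝ p h x - iteratedFDeriv ℝ p h y‖ ≤ M * ‖x - y‖)
    (hH : 0 < H) (hMH : M ≤ H / 2) (hδ : 0 < δ) (hD : 0 < D₀)
    (hconv : ∀ x y, h x + inner ℝ (gradient h x) (y - x) ≤ h y) {xs : E} (hxs : ∀ y, h xs ≤ h y)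
    {s μ : ℝ} (hs : 0 < s) (hμ : 0 < μ) (hgrowth : ∀ y, μ * ‖y - xs‖ ^ s ≤ h y - h xs)
    {N : ℕ → ℕ} (hN1 : ∀ k, 1 ≤ N k)
    (hN : ∀ k, rateConst p * H * (D₀ / 2 ^ k) ^ (p + 1) ≤
      (N k : ℝ) ^ ((3 * (p : ℝ) + 1) / 2) * (μ * (D₀ / 2 ^ k / 2) ^ s))
    {n : ℕ} (hn : searchConst p * (1 + H * D₀ ^ p / δ) ^ p ≤ 2 ^ n)
    {o : E → Tally (Jet E)} (ho : ∀ w, (o w).val = jet p h w) {z : E} (hz : ‖z - xs‖ ≤ D₀) :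
    ‖gradient h (plainCatdRestarts p (searchParams p H δ D₀ (n + 1)) N o (n + 1) z).val‖ ≤ δ := by
  set Err : E → E → E := fun x y => gradient (taylorError p h x) y with hErr
  have herr : ModelErr p H Err := modelErr_taylorError hp hh hM hL hMH
  have hmono : ∀ x y, 0 ≤ inner ℝ (gradient h x - gradient h y) (x - y) := by
    intro x y
    have h1 := hconv x y
    have h2 := hconv y x
    rw [← neg_sub x y, inner_neg_right] at h1
    rw [inner_sub_left]
    linarith
  have hgrad : ∀ x y, HasGradientAt (fun y => (jet p h x).model p H x y)
      (modelGrad p H (gradient h) Err x y) y := fun x y => hasGradientAt_model hp hh H x y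
  have hmin : ∀ x w, (jet p h x).model p H x (argmin fun y => (jet p h x).model p H x y) ≤
      (jet p h x).model p H x w := by
    intro x
    refine argmin_spec (q := fun y => (jet p h x).model p H x y)
      (exists_minimizer (contDiff_model p h H x).continuous x (modelGrad p H (gradient h) Err x x)
        (c := H / (2 ^ p * p !) / (p + 1)) (s := (p : ℝ) + 1) (by positivity) ?_ fun y => ?_)
    · have : (1 : ℝ) ≤ p := by exact_mod_cast hp
      linarith
    · have := add_inner_add_pow_le_of_gradient_monotone (hgrad x)
        (fun y z => modelGrad_inner_ge hp hH.le herr hmono x y z) x y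
      rwa [← Real.rpow_natCast _ (p + 1), Nat.cast_add, Nat.cast_one] at this
  have hT : TensorMethod p H δ 0 D₀ h (gradient h) xs Err
      (fun x => argmin fun y => (jet p h x).model p H x y) := by
    have := TensorMethod.accuracyFactor_pos p
    refine ⟨hp, hH, hδ, hD, le_rfl, by positivity, by positivity, hconv,
      gradient_eq_zero_of_minimal hxs, herr, fun x _ => ?_⟩
    rw [← (hgrad x _).gradient, gradient_eq_zero_of_minimal (hmin x), norm_zero]
  refine (TensorMethod.catdRestarts_spec (P := searchParams p H δ D₀ (n + 1)) hT
    (searchParams_spec hp hH hδ hD hn) (fun x => ?_) (fun y => ?_) hN1 hs hμ hgrowth hN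
    (final_round_le hp hH hδ hD hn) n 0 rfl z (by simpa using hz)).1
  · change (argmin fun y => (o x).val.model p H x y) = _
    rw [ho]
  · change (o y).val.grad = _
    rw [ho, grad_jet hp]

variable {f g : E → ℝ} {r σ H : ℝ} {V : E → E} {Err : E → E → E}

/-- The subproblem inherits uniform convexity from the objective. -/
theorem subproblem_uniformlyConvex (hp : 1 ≤ p) (hf : ContDiff ℝ p f) (hH : 0 ≤ H)
    (herr : ModelErr p H fun x y => gradient (taylorError p f x) y)
    (hV : ∀ x y, f x + g x + inner ℝ (V x) (y - x) + σ / r * ‖y - x‖ ^ r ≤ f y + g y) (x z y : E) :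
    (jet p f x).model p H x z + g z +
      inner ℝ (modelGrad p H V (fun x y => gradient (taylorError p f x) y) x z) (y - z) +
      σ / r * ‖y - z‖ ^ r ≤ (jet p f x).model p H x y + g y := by
  -- With `c = 0` this is plain convexity of the model minus `f`; the gradient of that difference is
  -- `modelGrad` with `v = 0`.
  have h1 := add_inner_add_pow_le_of_gradient_monotone (c := 0) (n := 0)
    (fun y => hasGradientAt_model_sub hp hf H x y) (fun y w => by
      rw [zero_mul]
      exact le_trans (by positivity) (modelGrad_inner_ge hp hH herr
        (v := fun _ => 0) (by simp) x y w)) z y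
  have h2 := hV z y
  have h3 : modelGrad p H V (fun x y => gradient (taylorError p f x) y) x z =
      modelGrad p H (fun _ => 0) (fun x y => gradient (taylorError p f x) y) x z + V z := by
    simp only [modelGrad]; abel
  rw [h3, inner_add_left]
  simp only [zero_div, zero_mul, add_zero] at h1
  linarith

/-- The growth of the subproblem that comes from the regulariser. -/
theorem subproblem_growth (hp : 1 ≤ p) (hf : ContDiff ℝ p f) (hg : Differentiable ℝ g)
    (hH : 0 ≤ H) (herr : ModelErr p H fun x y => gradient (taylorError p f x) y)
    (hmono : ∀ x y, 0 ≤ inner ℝ ((gradient f x + gradient g x) - (gradient f y + gradient g y))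
      (x - y)) {x xs : E}
    (hxs : ∀ y, (jet p f x).model p H x xs + g xs ≤ (jet p f x).model p H x y + g y) (y : E) :
    H / (2 ^ p * p !) / (p + 1) * ‖y - xs‖ ^ ((p : ℝ) + 1) ≤
      ((jet p f x).model p H x y + g y) - ((jet p f x).model p H x xs + g xs) := by
  have h1 := add_inner_add_pow_le_of_gradient_monotone
    (fun y => hasGradientAt_subproblem hp hf hg H x y)
    (fun y z => modelGrad_inner_ge hp hH herr (v := fun y => gradient f y + gradient g y)
      hmono x y z) xs y
  rw [← (hasGradientAt_subproblem hp hf hg H x xs).gradient, gradient_eq_zero_of_minimal hxs,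
    inner_zero_left, ← Real.rpow_natCast _ (p + 1), Nat.cast_add, Nat.cast_one] at h1
  linarith

/-- The factor between the regularisation of the inner method and `2 L_f + L_g`. -/
def innerReg (p : ℕ) : ℝ := 2 * (regularizerConst p + 1)

theorem innerReg_pos (p : ℕ) : 0 < innerReg p := by
  have := regularizerConst_nonneg p
  unfold innerReg
  linarith

/-- The factor `c` in the lengths of the rounds of the inner method. -/
def innerFactor (p : ℕ) : ℝ := (p + 1) * innerReg p * rateConst p

/-- The parameters of the nested framework for the accuracies `δ` and `δ'` of the outer and the
inner method. -/
def frameworkParams (p : ℕ) (r Lf Lg σ R δ δ' : ℝ) (n m : ℕ) : FrameworkParams where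
  outer := searchParams p (2 * Lf) δ R (n + 1)
  outerN := restartLength p r σ (2 * rateConst p) Lf R
  outerK := n + 1
  inner := searchParams p (innerReg p * (2 * Lf + Lg)) δ' (stepRadius p * R) (m + 1)
  innerN := restartLength p (innerDegree p r Lf σ R) (innerConst p r Lf σ R) (innerFactor p)
    (2 * Lf + Lg) (stepRadius p * R)
  innerK := m + 1

theorem innerDegree_pos (p : ℕ) {r : ℝ} (hr : 0 < r) (Lf σ R : ℝ) : 0 < innerDegree p r Lf σ R := by
  unfold innerDegree
  split_ifs <;> positivity

theorem innerConst_pos (p : ℕ) {r Lf σ : ℝ} (hLf : 0 < Lf) (hσ : 0 < σ) (R : ℝ) :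
    0 < innerConst p r Lf σ R := by
  unfold innerConst
  split_ifs <;> positivity

theorem rateConst_pos (p : ℕ) : 0 < rateConst p := by
  unfold rateConst
  positivity

/-- Both choices of the degree of uniform convexity of the subproblem are justified. -/
theorem exists_inner_growth (hp : 1 ≤ p) (hr : 2 ≤ r) {Lf Lg R : ℝ} (hLf : 0 < Lf) (hLg : 0 < Lg)
    (hσ : 0 < σ) {h : E → ℝ} {xs : E}
    (h1 : ∀ y, 2 * Lf / (2 ^ p * p !) / (p + 1) * ‖y - xs‖ ^ ((p : ℝ) + 1) ≤ h y - h xs)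
    (h2 : ∀ y, σ / r * ‖y - xs‖ ^ r ≤ h y - h xs) :
    ∃ μ, 0 < μ ∧ (∀ y, μ * ‖y - xs‖ ^ innerDegree p r Lf σ R ≤ h y - h xs) ∧
      rateConst p * (innerReg p * (2 * Lf + Lg)) * innerConst p r Lf σ R ≤
        innerDegree p r Lf σ R * innerFactor p * (2 * Lf + Lg) * μ := by
  have hκ := innerReg_pos p
  have hρ := rateConst_pos p
  have hp0 : (1 : ℝ) ≤ p := by exact_mod_cast hp
  unfold innerDegree innerConst innerFactor
  split_ifs
  -- Here `(p + 1) * μ` equals `Lf * 2 ^ (1 - p) / p !`, so `innerConst` is larger by the factor `p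
  -- + 1`, which `innerFactor` makes up for.
  · refine ⟨_, by positivity, h1, le_of_eq ?_⟩
    rw [Real.rpow_sub zero_lt_two, Real.rpow_one, Real.rpow_natCast]
    field_simp
  · refine ⟨_, by positivity, h2, ?_⟩
    have : rateConst p * (innerReg p * (2 * Lf + Lg)) * σ * 1 ≤
        rateConst p * (innerReg p * (2 * Lf + Lg)) * σ * (p + 1) := by
      gcongr; linarith
    refine le_trans (by linarith) (this.trans (le_of_eq ?_))
    field_simp

/-- The nested framework reaches the accuracy `δ (stepRadius p) R`. -/
theorem framework_spec (hp : 1 ≤ p) (hr : 2 ≤ r) {Lf Lg R δ δ' : ℝ} (hLf : 0 < Lf)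
    (hLg : 0 < Lg) (hσ : 0 < σ) (hR : 0 < R) (hδ : 0 < δ) (hδ' : 0 < δ')
    (hacc : δ' ≤ δ / accuracyFactor p) (hacc' : δ' ≤ 2 * Lf * R ^ p)
    {n m : ℕ} (hn : searchConst p * (1 + 2 * Lf * R ^ p / δ) ^ p ≤ 2 ^ n)
    (hm : searchConst p *
      (1 + innerReg p * (2 * Lf + Lg) * (stepRadius p * R) ^ p / δ') ^ p ≤ 2 ^ m)
    (hf : ConvexLipschitzDeriv p Lf f) (hg : ConvexLipschitzDeriv p Lg g)
    (hF : UniformlyConvex r σ fun x => f x + g x) {xs z : E}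
    (hxs : ∀ y, f xs + g xs ≤ f y + g y) (hz : ‖z - xs‖ ≤ R) :
    let y := (framework p (frameworkParams p r Lf Lg σ R δ δ' n m) (callF p f) (callG p g) z).val
    (f y + g y) - (f xs + g xs) ≤ δ * (stepRadius p * R) := by
  intro y
  have hb := three_le_stepRadius p
  have hβ := TensorMethod.accuracyFactor_pos p
  have hκ := innerReg_pos p
  have hrate := rateConst_pos p
  have hif : 0 < innerFactor p := by unfold innerFactor; positivity
  have hp' : (p : WithTop ℕ∞) ≠ 0 := by simp; omega
  have hfd := hf.contDiff.differentiable hp'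
  have hgd := hg.contDiff.differentiable hp'
  have hVgrad : ∀ x, HasGradientAt (fun x => f x + g x) (gradient f x + gradient g x) x := fun x =>
    hasGradientAt_add (hfd x).hasGradientAt (hgd x).hasGradientAt
  set V : E → E := fun x => gradient f x + gradient g x with hV
  set Err : E → E → E := fun x y => gradient (taylorError p f x) y with hErr
  have herr : ModelErr p (2 * Lf) Err :=
    modelErr_taylorError hp hf.contDiff hLf.le hf.lipschitz (by linarith)
  have hUC : ∀ x y, f x + g x + inner ℝ (V x) (y - x) + σ / r * ‖y - x‖ ^ r ≤ f y + g y := by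
    intro x y
    have := hF.2 x y
    rwa [(hVgrad x).gradient] at this
  have hconv : ∀ x y, (f x + g x) + inner ℝ (V x) (y - x) ≤ f y + g y := by
    intro x y
    have h1 := hUC x y
    have h2 : 0 ≤ σ / r * ‖y - x‖ ^ r := by positivity
    linarith
  have hmono : ∀ x y, 0 ≤ inner ℝ (V x - V y) (x - y) := by
    intro x y
    have h1 := hconv x y
    have h2 := hconv y x
    rw [← neg_sub x y, inner_neg_right] at h1
    rw [inner_sub_left]
    linarith
  have hcrit : V xs = 0 := by
    exact (hVgrad xs).gradient.symm.trans (gradient_eq_zero_of_minimal hxs)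
  set h : E → E → ℝ := fun x y => (jet p f x).model p (2 * Lf) x y + g y with hh
  have hhgrad : ∀ x y, HasGradientAt (h x) (modelGrad p (2 * Lf) V Err x y) y := fun x y =>
    hasGradientAt_subproblem hp hf.contDiff hgd (2 * Lf) x y
  have hhUC : ∀ x z y, h x z + inner ℝ (modelGrad p (2 * Lf) V Err x z) (y - z) +
      σ / r * ‖y - z‖ ^ r ≤ h x y := fun x z y =>
    subproblem_uniformlyConvex hp hf.contDiff (by positivity) herr hUC x z y
  have hhc : ∀ x, ContDiff ℝ p (h x) := fun x => (contDiff_model p f (2 * Lf) x).add hg.contDiff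
  have hmin : ∀ x w, h x (argmin (h x)) ≤ h x w := fun x =>
    argmin_spec (exists_minimizer (hhc x).continuous x _ (by positivity) hr (hhUC x x))
  have hcritx : ∀ x, modelGrad p (2 * Lf) V Err x (argmin (h x)) = 0 := fun x => by
    rw [← (hhgrad x _).gradient]; exact gradient_eq_zero_of_minimal (hmin x)
  -- Exact steps serve only to bound the distance from `x` to the minimiser of its subproblem, that
  -- is, the initial distance of the inner method. This fixes the radius `stepRadius p * R` of the
  -- inner restarts.
  have hexact : TensorMethod p (2 * Lf) δ 0 R (fun x => f x + g x) V xs Err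
      (fun x => argmin (h x)) :=
    ⟨hp, by positivity, hδ, hR, le_rfl, by positivity, by positivity, hconv, hcrit, herr,
      fun x _ => by rw [hcritx, norm_zero]⟩
  set P := frameworkParams p r Lf Lg σ R δ δ' n m with hP
  set Y : E → E := fun x => (plainCatdRestarts p P.inner P.innerN (fun w => do
          let Jg ← callG p g w
          pure (jet p ((jet p f x).model p P.outer.H x) w + Jg)) P.innerK x).val with hY
  have hstep : ∀ x, ‖x - xs‖ ≤ 3 * R → ‖modelGrad p (2 * Lf) V Err x (Y x)‖ ≤ δ' := by
    intro x hx
    have hd : ‖x - argmin (h x)‖ ≤ stepRadius p * R := by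
      rw [norm_sub_rev]; exact hexact.norm_tensorStep_sub_le' hx hx
    have hcx := hhUC x (argmin (h x))
    simp only [hcritx, inner_zero_left, add_zero] at hcx
    obtain ⟨μ, hμ, hgrowth, hμc⟩ := exists_inner_growth (R := R) hp hr hLf hLg hσ
      (subproblem_growth hp hf.contDiff hgd (by positivity) herr hmono (hmin x))
      (fun y => by have := hcx y; linarith)
    have hK := regularizerConst_nonneg p
    -- The regulariser of the model contributes `2 * Lf * regularizerConst p` to the Lipschitz
    -- constant and `g` contributes `Lg`; `innerReg` makes the inner regularisation at least twice
    -- their sum.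
    have key := plainCatdRestarts_spec (M := 2 * Lf * regularizerConst p + Lg)
      (H := innerReg p * (2 * Lf + Lg)) (D₀ := stepRadius p * R) (N := P.innerN) (z := x)
      (o := fun w => do
          let Jg ← callG p g w
          pure (jet p ((jet p f x).model p P.outer.H x) w + Jg))
      hp (hhc x) (by positivity) (fun y w => ?_) (by positivity) ?_ hδ' (by positivity)
      (fun y w => ?_) (hmin x) (innerDegree_pos p (by linarith) Lf σ R) hμ hgrowth
      (fun k => one_le_restartLength _ _ _ _ _ _ k)
      (restartLength_spec p (innerDegree_pos p (by linarith) Lf σ R) (innerConst_pos p hLf hσ R)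
        hif (by positivity) (by positivity) hμ hμc) hm (fun w => ?_) hd
    · rwa [(hhgrad x _).gradient] at key
    · have e : ∀ y, iteratedFDeriv ℝ p (h x) y =
          iteratedFDeriv ℝ p (fun y => (jet p f x).model p (2 * Lf) x y) y +
            iteratedFDeriv ℝ p g y := fun y =>
        iteratedFDeriv_add_apply (contDiff_model p f (2 * Lf) x).contDiffAt hg.contDiff.contDiffAt
      rw [e, e, add_sub_add_comm]
      refine (norm_add_le _ _).trans ?_
      have := norm_iteratedFDeriv_model_sub_le p f (H := 2 * Lf) (by positivity) x y w
      have := hg.lipschitz y w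
      linarith
    · unfold innerReg
      nlinarith
    · have h1 := hhUC x y w
      have h2 : 0 ≤ σ / r * ‖w - y‖ ^ r := by positivity
      rw [(hhgrad x _).gradient]
      linarith
    · change jet p ((jet p f x).model p (2 * Lf) x) w + jet p g w = jet p (h x) w
      exact jet_add (contDiff_model p f (2 * Lf) x) hg.contDiff w
  have hT : TensorMethod p (2 * Lf) δ δ' R (fun x => f x + g x) V xs Err Y :=
    ⟨hp, by positivity, hδ, hR, hδ'.le, hacc, hacc', hconv, hcrit, herr, hstep⟩
  have hgr : ∀ y, σ / r * ‖y - xs‖ ^ r ≤ (f y + g y) - (f xs + g xs) := by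
    intro y
    have := hUC xs y
    rw [hcrit, inner_zero_left] at this
    linarith
  have hspec := TensorMethod.catdRestarts_spec (P := P.outer) (N := P.outerN)
    (tensorStep := fun xt => do
      let J ← callF p f xt
      plainCatdRestarts p P.inner P.innerN
        (fun w => do
          let Jg ← callG p g w
          pure (jet p (J.model p P.outer.H xt) w + Jg))
        P.innerK xt)
    (grad := fun y => do
      let Jf ← callF p f y
      let Jg ← callG p g y
      pure (Jf.grad + Jg.grad)) hT (searchParams_spec hp (by positivity) hδ hR hn)
    (fun x => rfl) (fun y => ?_) (fun k => one_le_restartLength _ _ _ _ _ _ k)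
    (by linarith : 0 < r) (by positivity : 0 < σ / r) hgr
    (restartLength_spec p (by linarith) hσ (by positivity) hLf hR (by positivity)
      (le_of_eq (show rateConst p * (2 * Lf) * σ = r * (2 * rateConst p) * Lf * (σ / r) by
        field_simp)))
    (final_round_le (H := 2 * Lf) hp (by positivity) hδ hR hn) n 0 rfl z
      (by simpa using hz)
  · have h1 : ‖V y‖ ≤ δ := hspec.1
    have h2 : ‖y - xs‖ ≤ stepRadius p * R := hspec.2
    -- By convexity the function gap is at most gradient norm times distance.
    have h3 := hconv y xs
    have h4 := (abs_le.1 (abs_real_inner_le_norm (V y) (xs - y))).1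
    rw [norm_sub_rev xs y] at h4
    have h5 : ‖V y‖ * ‖y - xs‖ ≤ δ * (stepRadius p * R) := by gcongr
    linarith
  · change (jet p f y).grad + (jet p g y).grad = V y
    rw [grad_jet hp, grad_jet hp]

end Methods

/-! ### Round lengths, logarithmic factors and parameter choice -/

section Complexity

theorem rpow_le_of_le_mul {x c y e : ℝ} (hx : 0 ≤ x) (hc : 0 ≤ c) (hy : 0 ≤ y) (he : 0 ≤ e)
    (h : x ≤ c * y) : x ^ e ≤ c ^ e * y ^ e := by
  rw [← Real.mul_rpow hc hy]
  exact Real.rpow_le_rpow hx h he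

theorem innerDegree_le {p : ℕ} {r : ℝ} (hrp : r ≤ (p : ℝ) + 1) (Lf σ R : ℝ) :
    innerDegree p r Lf σ R ≤ (p : ℝ) + 1 := by
  unfold innerDegree
  split_ifs
  · rfl
  · exact hrp

theorem innerFactor_pos (p : ℕ) : 0 < innerFactor p := by
  have := innerReg_pos p
  have := rateConst_pos p
  unfold innerFactor
  positivity

/-- The factor in the bound for the lengths of the rounds. -/
def roundFactor (p : ℕ) (s c : ℝ) : ℝ := (s * c * 2 ^ s) ^ ((2 : ℝ) / (3 * p + 1))

/-- The lengths of the inner and the outer rounds, in the two cases for the degree of uniform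
convexity of the subproblem. -/
theorem exists_inner_round_bound (p : ℕ) {r : ℝ} (hr : 2 ≤ r) {a : ℝ} (ha : 0 ≤ a) : ∃ C : ℝ, 0 < C ∧
      ∀ Lf Lg σ R : ℝ, 0 < Lf → Lf < Lg → 0 < σ → 0 < R →
        (1 + a * (Lf * R ^ ((p : ℝ) + 1 - r) / σ) ^ ((2 : ℝ) / (3 * p + 1))) *
        (1 + roundFactor p (innerDegree p r Lf σ R) (innerFactor p) *
          ((2 * Lf + Lg) * (stepRadius p * R) ^ ((p : ℝ) + 1 - innerDegree p r Lf σ R) /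
            innerConst p r Lf σ R) ^ ((2 : ℝ) / (3 * p + 1))) ≤
        C * (1 + (Lg * R ^ ((p : ℝ) + 1 - r) / σ) ^ ((2 : ℝ) / (3 * p + 1))) := by
  have hb := three_le_stepRadius p
  have hif := innerFactor_pos p
  set e : ℝ := (2 : ℝ) / (3 * p + 1) with he
  have he0 : 0 < e := by positivity
  have hr0 : 0 < r := by linarith
  set c₁ : ℝ := 3 * (p ! * 2 ^ p) / (2 * (p + 1)) with hc₁
  set c₂ : ℝ := 3 * stepRadius p ^ ((p : ℝ) + 1 - r) with hc₂
  have hc₁0 : 0 < c₁ := by positivity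
  have hc₂0 : 0 < c₂ := by positivity
  set b₁ := roundFactor p ((p : ℝ) + 1) (innerFactor p) with hb₁
  set b₂ := roundFactor p r (innerFactor p) with hb₂
  have hb₁0 : 0 < b₁ := by unfold b₁ roundFactor; positivity
  have hb₂0 : 0 < b₂ := by unfold b₂ roundFactor; positivity
  refine ⟨(1 + a) * (1 + b₁ * c₁ ^ e) + (1 + a) * (1 + b₂ * c₂ ^ e), by positivity,
    fun Lf Lg σ R hLf hLfg hσ hR => ?_⟩
  have hLg : 0 < Lg := hLf.trans hLfg
  set ζf := Lf * R ^ ((p : ℝ) + 1 - r) / σ with hζf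
  set ζg := Lg * R ^ ((p : ℝ) + 1 - r) / σ with hζg
  have hζf0 : 0 < ζf := by positivity
  have hζg0 : 0 < ζg := by positivity
  have h1 : 0 ≤ (1 + a) * (1 + b₁ * c₁ ^ e) := by positivity
  have h2 : 0 ≤ (1 + a) * (1 + b₂ * c₂ ^ e) := by positivity
  -- In the first case `ζf` and `Lg / Lf` are at least one and absorb the additive constants; their
  -- product is `ζg`. In the second case `ζf < 1`, the outer factor is bounded, and the inner one is
  -- of order `1 + ζg ^ e`.
  by_cases hcase : σ ≤ Lf * R ^ ((p : ℝ) + 1 - r)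
  · have hd : innerDegree p r Lf σ R = (p : ℝ) + 1 := if_pos hcase
    have hc : innerConst p r Lf σ R = ((p : ℝ) + 1) * Lf * 2 ^ (1 - (p : ℝ)) / p ! := if_pos hcase
    rw [hd, hc, sub_self, Real.rpow_zero, mul_one]
    have hζ1 : 1 ≤ ζf ^ e := Real.one_le_rpow ((one_le_div hσ).2 hcase) he0.le
    have hq1 : 1 ≤ (Lg / Lf) ^ e := Real.one_le_rpow ((one_le_div hLf).2 hLfg.le) he0.le
    have h3 : ((2 * Lf + Lg) / (((p : ℝ) + 1) * Lf * 2 ^ (1 - (p : ℝ)) / p !)) ^ e ≤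
        c₁ ^ e * (Lg / Lf) ^ e := by
      refine rpow_le_of_le_mul (by positivity) hc₁0.le (by positivity) he0.le ?_
      rw [Real.rpow_sub zero_lt_two, Real.rpow_one, Real.rpow_natCast, hc₁]
      have h4 : 2 * Lf + Lg ≤ 3 * Lg := by linarith
      calc _ ≤ 3 * Lg / (((p : ℝ) + 1) * Lf * (2 / 2 ^ p) / p !) := by gcongr
        _ = _ := by field_simp
    have h4 : ζf ^ e * (Lg / Lf) ^ e = ζg ^ e := by
      rw [← Real.mul_rpow hζf0.le (by positivity)]
      congr 1
      rw [hζf, hζg]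
      field_simp
    have h5 : 1 + a * ζf ^ e ≤ (1 + a) * ζf ^ e := by linarith
    have h6 : 1 + b₁ * (c₁ ^ e * (Lg / Lf) ^ e) ≤ (1 + b₁ * c₁ ^ e) * (Lg / Lf) ^ e := by linarith
    calc _ ≤ ((1 + a) * ζf ^ e) * (1 + b₁ * (c₁ ^ e * (Lg / Lf) ^ e)) := by gcongr
      _ ≤ ((1 + a) * ζf ^ e) * ((1 + b₁ * c₁ ^ e) * (Lg / Lf) ^ e) := by gcongr
      _ = (1 + a) * (1 + b₁ * c₁ ^ e) * ζg ^ e := by rw [← h4]; ring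
      _ ≤ _ := by
        have : 0 ≤ ζg ^ e := by positivity
        gcongr <;> linarith
  · have hd : innerDegree p r Lf σ R = r := if_neg hcase
    have hc : innerConst p r Lf σ R = σ := if_neg hcase
    rw [hd, hc]
    have hζ1 : ζf ^ e ≤ 1 :=
      Real.rpow_le_one hζf0.le ((div_le_one hσ).2 (not_le.1 hcase).le) he0.le
    have h3 : ((2 * Lf + Lg) * (stepRadius p * R) ^ ((p : ℝ) + 1 - r) / σ) ^ e ≤
        c₂ ^ e * ζg ^ e := by
      refine rpow_le_of_le_mul (by positivity) hc₂0.le hζg0.le he0.le ?_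
      rw [Real.mul_rpow (by linarith) hR.le]
      have h4 : 2 * Lf + Lg ≤ 3 * Lg := by linarith
      calc _ ≤ 3 * Lg * (stepRadius p ^ ((p : ℝ) + 1 - r) * R ^ ((p : ℝ) + 1 - r)) / σ := by gcongr
        _ = _ := by rw [hc₂, hζg]; ring
    have h5 : 1 + a * ζf ^ e ≤ 1 + a := by nlinarith
    have h6 : 1 + b₂ * (c₂ ^ e * ζg ^ e) ≤ (1 + b₂ * c₂ ^ e) * (1 + ζg ^ e) := by
      have i1 : 0 ≤ ζg ^ e := by positivity
      have i2 : 0 ≤ b₂ * c₂ ^ e := by positivity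
      linarith
    calc _ ≤ (1 + a) * (1 + b₂ * (c₂ ^ e * ζg ^ e)) := by gcongr
      _ ≤ (1 + a) * ((1 + b₂ * c₂ ^ e) * (1 + ζg ^ e)) := by gcongr
      _ = (1 + a) * (1 + b₂ * c₂ ^ e) * (1 + ζg ^ e) := by ring
      _ ≤ _ := by
        have : 0 ≤ ζg ^ e := by positivity
        gcongr
        linarith

/-- Bounds for the lengths of the rounds of the nested framework. -/
theorem exists_round_bounds (p : ℕ) {r : ℝ} (hr : 2 ≤ r) (hrp : r ≤ (p : ℝ) + 1) :
    ∃ C : ℝ, 0 < C ∧ ∀ Lf Lg σ R δ δ' : ℝ, 0 < Lf → Lf < Lg → 0 < σ → 0 < R → ∀ n m : ℕ,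
      ∃ M M' : ℕ, (∀ k, (frameworkParams p r Lf Lg σ R δ δ' n m).outerN k ≤ M) ∧
        (∀ k, (frameworkParams p r Lf Lg σ R δ δ' n m).innerN k ≤ M') ∧ 1 ≤ M' ∧
        (M : ℝ) ≤ C * (1 + (Lf * R ^ ((p : ℝ) + 1 - r) / σ) ^ ((2 : ℝ) / (3 * p + 1))) ∧
        (M : ℝ) * M' ≤ C * (1 + (Lg * R ^ ((p : ℝ) + 1 - r) / σ) ^ ((2 : ℝ) / (3 * p + 1))) := by
  have hr0 : 0 < r := by linarith
  have hrate := rateConst_pos p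
  have hif := innerFactor_pos p
  have hb := three_le_stepRadius p
  have ha : 0 < roundFactor p r (2 * rateConst p) := by unfold roundFactor; positivity
  obtain ⟨C, hC, h⟩ := exists_inner_round_bound p hr ha.le
  refine ⟨C + (1 + roundFactor p r (2 * rateConst p)), by positivity,
    fun Lf Lg σ R δ δ' hLf hLfg hσ hR n m => ?_⟩
  have hLg : 0 < Lg := hLf.trans hLfg
  have hs := innerDegree_pos p hr0 Lf σ R
  have hc := innerConst_pos p (r := r) hLf hσ R
  have h1 := fun k => restartLength_le (p := p) hr0 hrp hσ
    (by positivity : 0 < 2 * rateConst p) hLf hR k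
  have h2 := fun k => restartLength_le (p := p) hs (innerDegree_le hrp Lf σ R) hc hif
    (by positivity : 0 < 2 * Lf + Lg) (by positivity : 0 < stepRadius p * R) k
  have h3 := h Lf Lg σ R hLf hLfg hσ hR
  have hζf : 0 ≤ (Lf * R ^ ((p : ℝ) + 1 - r) / σ) ^ ((2 : ℝ) / (3 * p + 1)) := by positivity
  have hζg : 0 ≤ (Lg * R ^ ((p : ℝ) + 1 - r) / σ) ^ ((2 : ℝ) / (3 * p + 1)) := by positivity
  have hB : 0 ≤ 1 + roundFactor p r (2 * rateConst p) *
      (Lf * R ^ ((p : ℝ) + 1 - r) / σ) ^ ((2 : ℝ) / (3 * p + 1)) := by positivity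
  have hB' : 0 ≤ roundFactor p (innerDegree p r Lf σ R) (innerFactor p) *
      ((2 * Lf + Lg) * (stepRadius p * R) ^ ((p : ℝ) + 1 - innerDegree p r Lf σ R) /
        innerConst p r Lf σ R) ^ ((2 : ℝ) / (3 * p + 1)) := by unfold roundFactor; positivity
  refine ⟨_, _, fun k => Nat.le_floor (h1 k), fun k => Nat.le_floor (h2 k), ?_, ?_, ?_⟩
  · exact Nat.le_floor (by rw [Nat.cast_one]; exact le_add_of_nonneg_right hB')
  · refine (Nat.floor_le hB).trans ?_
    nlinarith
  · refine (mul_le_mul (Nat.floor_le hB) (Nat.floor_le (add_nonneg zero_le_one hB')) (by positivity) hB).trans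
      (h3.trans ?_)
    gcongr
    linarith

theorem log_one_add_le {X c W : ℝ} (hc : 0 ≤ c) (hX : 0 ≤ X) (hW : 1 ≤ W)
    (h : X ≤ c * Real.exp W ^ 2) : Real.log (1 + X) ≤ (Real.log (1 + c) + 2) * W := by
  have h1 : 1 ≤ Real.exp W ^ 2 := one_le_pow₀ (Real.one_le_exp (by linarith))
  have h2 : 1 + X ≤ (1 + c) * Real.exp W ^ 2 := by linarith
  have h3 := Real.log_le_log (by linarith) h2
  rw [Real.log_mul (by linarith) (by positivity), Real.log_pow, Real.log_exp] at h3
  have h4 : Real.log (1 + c) ≤ Real.log (1 + c) * W :=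
    le_mul_of_one_le_right (Real.log_nonneg (by linarith)) hW
  push_cast at h3
  linarith

theorem le_exp_of_abs_log_le {x W : ℝ} (hx : 0 < x) (h : |Real.log x| ≤ W) :
    x ≤ Real.exp W ∧ 1 / x ≤ Real.exp W := by
  have h1 := abs_le.1 h
  constructor
  · rw [← Real.log_le_iff_le_exp hx]; exact h1.2
  · rw [← Real.log_le_iff_le_exp (by positivity), one_div, Real.log_inv]; linarith

/-- Admissible accuracies and numbers of trials and rounds of the nested framework. -/
theorem exists_search_parameters (p : ℕ) (r : ℝ) : ∃ C : ℝ, 0 < C ∧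
    ∀ Lf Lg σ R ε : ℝ, 0 < Lf → 0 < Lg → 0 < R → 0 < ε →
      ∃ (δ δ' : ℝ) (n m : ℕ), 0 < δ ∧ 0 < δ' ∧ δ * (stepRadius p * R) = ε ∧
        δ' ≤ δ / accuracyFactor p ∧ δ' ≤ 2 * Lf * R ^ p ∧
        searchConst p * (1 + 2 * Lf * R ^ p / δ) ^ p ≤ 2 ^ n ∧
        searchConst p *
          (1 + innerReg p * (2 * Lf + Lg) * (stepRadius p * R) ^ p / δ') ^ p ≤ 2 ^ m ∧
        ((n + 1 : ℕ) : ℝ) ≤ C * logFactor p r Lf Lg σ R ε ∧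
        ((m + 1 : ℕ) : ℝ) ≤ C * logFactor p r Lf Lg σ R ε := by
  obtain ⟨C, hC, h⟩ := exists_search_size p
  set b := stepRadius p with hb
  set β := accuracyFactor p with hβ
  set κ := innerReg p with hκ
  have hb0 : 3 ≤ b := three_le_stepRadius p
  have hβ0 : 0 < β := TensorMethod.accuracyFactor_pos p
  have hκ0 : 0 < κ := innerReg_pos p
  set c : ℝ := 2 * b + κ * b ^ p * (3 * β * b + 2) with hc
  have hc0 : 0 ≤ c := by positivity
  have hlog : 0 ≤ Real.log (1 + c) := Real.log_nonneg (by linarith)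
  refine ⟨C * (Real.log (1 + c) + 2), by positivity, fun Lf Lg σ R ε hLf hLg hR hε => ?_⟩
  set W := logFactor p r Lf Lg σ R ε with hW
  set u := Lf * R ^ (p + 1) / ε with hu
  set v := Lg * R ^ (p + 1) / ε with hv
  have hu0 : 0 < u := by positivity
  have hv0 : 0 < v := by positivity
  have hWdef : W = 1 + |Real.log u| + |Real.log v| + |Real.log (σ * R ^ r / ε)| := rfl
  have i1 := abs_nonneg (Real.log u)
  have i2 := abs_nonneg (Real.log v)
  have i3 := abs_nonneg (Real.log (σ * R ^ r / ε))
  have hW1 : 1 ≤ W := by linarith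
  obtain ⟨hu1, hu2⟩ := le_exp_of_abs_log_le hu0 (W := W) (by linarith)
  obtain ⟨hv1, -⟩ := le_exp_of_abs_log_le hv0 (W := W) (by linarith)
  have hE1 : 1 ≤ Real.exp W := Real.one_le_exp (by linarith)
  have hE2 : Real.exp W ≤ Real.exp W ^ 2 := le_self_pow₀ hE1 two_ne_zero
  set δ := ε / (b * R) with hδ
  have hδ0 : 0 < δ := by positivity
  -- Half the harmonic mean of the two upper bounds required of `δ'`: it lies below both, and its
  -- reciprocal is a sum that is easy to estimate.
  set δ' := 1 / (β / δ + 1 / (2 * Lf * R ^ p)) with hδ'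
  have hδ'0 : 0 < δ' := by positivity
  have hX1 : 2 * Lf * R ^ p / δ = 2 * b * u := by
    rw [hδ, hu]; field_simp; ring
  -- The quotient `v / u` is `Lg / Lf`. Bounding it takes the logarithms of both `u` and `v`, hence
  -- the square of `Real.exp W` below.
  have hX2 : κ * (2 * Lf + Lg) * (b * R) ^ p / δ' =
      κ * b ^ p * ((2 * u + v) * β * b + 1 + v * (1 / u) / 2) := by
    rw [hδ', hδ, hu, hv, mul_pow]; field_simp; ring
  have hX1' : 2 * b * u ≤ c * Real.exp W ^ 2 := by
    have : 2 * b * u ≤ 2 * b * Real.exp W ^ 2 := by gcongr; linarith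
    have : 0 ≤ κ * b ^ p * (3 * β * b + 2) * Real.exp W ^ 2 := by positivity
    rw [hc, add_mul]
    linarith
  have hX2' : κ * b ^ p * ((2 * u + v) * β * b + 1 + v * (1 / u) / 2) ≤ c * Real.exp W ^ 2 := by
    have h1 : (2 * u + v) * β * b ≤ 3 * Real.exp W ^ 2 * β * b := by gcongr; linarith
    have h2 : v * (1 / u) ≤ Real.exp W * Real.exp W := by gcongr
    have h3 : (2 * u + v) * β * b + 1 + v * (1 / u) / 2 ≤ (3 * β * b + 2) * Real.exp W ^ 2 := by
      nlinarith
    have h4 : 0 ≤ 2 * b * Real.exp W ^ 2 := by positivity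
    calc _ ≤ κ * b ^ p * ((3 * β * b + 2) * Real.exp W ^ 2) := by gcongr
      _ ≤ _ := by rw [hc, add_mul]; linarith
  have hB : 1 ≤ (Real.log (1 + c) + 2) * W := one_le_mul_of_one_le_of_one_le (by linarith) hW1
  obtain ⟨n, hn, hn'⟩ := h (2 * Lf * R ^ p / δ) _ (by positivity) hB
    (log_one_add_le hc0 (by positivity) hW1 (hX1 ▸ hX1'))
  obtain ⟨m, hm, hm'⟩ := h (κ * (2 * Lf + Lg) * (b * R) ^ p / δ') _ (by positivity) hB
    (log_one_add_le hc0 (by positivity) hW1 (hX2 ▸ hX2'))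
  refine ⟨δ, δ', n, m, hδ0, hδ'0, by rw [hδ]; field_simp, ?_, ?_, hn, hm,
    by rw [mul_assoc]; exact hn', by rw [mul_assoc]; exact hm'⟩
  · rw [← one_div_div β δ]
    exact one_div_le_one_div_of_le (by positivity) (le_add_of_nonneg_right (by positivity))
  · rw [← one_div_one_div (2 * Lf * R ^ p)]
    exact one_div_le_one_div_of_le (by positivity) (le_add_of_nonneg_left (by positivity))

theorem one_le_logFactor (p : ℕ) (r Lf Lg σ R ε : ℝ) : 1 ≤ logFactor p r Lf Lg σ R ε := by
  unfold logFactor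
  have := abs_nonneg (Real.log (Lf * R ^ (p + 1) / ε))
  have := abs_nonneg (Real.log (Lg * R ^ (p + 1) / ε))
  have := abs_nonneg (Real.log (σ * R ^ r / ε))
  linarith

end Complexity

end TensorSliding

end

/-! ### The main theorem -/

open TensorSliding
theorem mainTheorem1 (p : ℕ) (hp : 1 ≤ p) (r : ℝ) (hr : 2 ≤ r) (hrp : r ≤ (p : ℝ) + 1) :
    ∃ (cOut cIn κ ρ C : ℝ) (m : ℕ), 0 < cOut ∧ 0 < cIn ∧ 0 < κ ∧ 0 < ρ ∧ 0 < C ∧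
      ∀ Lf Lg σ R ε : ℝ, 0 < Lf → Lf < Lg → 0 < σ → 0 < R → 0 < ε →
        ∃ P : TensorSliding.FrameworkParams,
          P.outer.H = 2 * Lf ∧
          P.outerN = TensorSliding.restartLength p r σ cOut Lf R ∧
          P.inner.H = κ * (2 * Lf + Lg) ∧
          P.innerN = TensorSliding.restartLength p (TensorSliding.innerDegree p r Lf σ R)
            (TensorSliding.innerConst p r Lf σ R) cIn (2 * Lf + Lg) (ρ * R) ∧
          0 < P.outer.δ ∧ 0 < P.outer.lo ∧ P.outer.lo ≤ P.outer.hi ∧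
          0 < P.inner.δ ∧ 0 < P.inner.lo ∧ P.inner.lo ≤ P.inner.hi ∧
          ∀ (d : ℕ) (f g : EuclideanSpace ℝ (Fin d) → ℝ) (x₀ xs : EuclideanSpace ℝ (Fin d)),
            TensorSliding.ConvexLipschitzDeriv p Lf f →
            TensorSliding.ConvexLipschitzDeriv p Lg g →
            TensorSliding.UniformlyConvex r σ (fun x => f x + g x) →
            (∀ y, f xs + g xs ≤ f y + g y) →
            ‖x₀ - xs‖ ≤ R →
            let out := TensorSliding.framework p P (TensorSliding.callF p f)
              (TensorSliding.callG p g) x₀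
            (f out.val + g out.val) - (f xs + g xs) ≤ ε ∧
            (out.nf : ℝ) ≤ C * TensorSliding.logFactor p r Lf Lg σ R ε ^ m *
              (1 + (Lf * R ^ ((p : ℝ) + 1 - r) / σ) ^ ((2 : ℝ) / (3 * p + 1))) ∧
            (out.ng : ℝ) ≤ C * TensorSliding.logFactor p r Lf Lg σ R ε ^ m *
              (1 + (Lg * R ^ ((p : ℝ) + 1 - r) / σ) ^ ((2 : ℝ) / (3 * p + 1))) := by
  obtain ⟨C₁, hC₁, hlen⟩ := exists_round_bounds p hr hrp
  obtain ⟨C₂, hC₂, hsearch⟩ := exists_search_parameters p r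
  have hb := three_le_stepRadius p
  have hrate := rateConst_pos p
  -- The exponent 4 counts the logarithmic factors: rounds and trials, of the outer and of the inner
  -- method. The value of `C` comes from the count for `g` and also covers that for `f`.
  refine ⟨2 * rateConst p, innerFactor p, innerReg p, stepRadius p,
    C₁ * C₂ ^ 2 * (2 * C₂ ^ 2 + 2), 4, by positivity, innerFactor_pos p, innerReg_pos p,
    by positivity, by positivity, fun Lf Lg σ R ε hLf hLfg hσ hR hε => ?_⟩
  have hLg : 0 < Lg := hLf.trans hLfg
  have hκ := innerReg_pos p
  obtain ⟨δ, δ', n, m, hδ, hδ', hδε, hacc, hacc', hn, hm, hnW, hmW⟩ :=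
    hsearch Lf Lg σ R ε hLf hLg hR hε
  refine ⟨frameworkParams p r Lf Lg σ R δ δ' n m, rfl, rfl, rfl, rfl, hδ,
    searchParams_lo_pos p (by positivity) hR _,
    searchParams_lo_le_hi p (by positivity) hδ hR _, hδ',
    searchParams_lo_pos p (by positivity) (by positivity) _,
    searchParams_lo_le_hi p (by positivity) hδ' (by positivity) _,
    fun d f g x₀ xs hf hg hF hxs hx₀ => ?_⟩
  obtain ⟨M, M', hM, hM', hM'1, hMf, hMg⟩ := hlen Lf Lg σ R δ δ' hLf hLfg hσ hR n m
  have hcalls := framework_calls p (frameworkParams p r Lf Lg σ R δ δ' n m) f g hM hM' x₀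
  have hspec := framework_spec hp hr hLf hLg hσ hR hδ hδ' hacc hacc' hn hm hf hg hF hxs hx₀
  intro out
  set W := logFactor p r Lf Lg σ R ε with hW
  have hW1 : 1 ≤ W := one_le_logFactor p r Lf Lg σ R ε
  set zf := (Lf * R ^ ((p : ℝ) + 1 - r) / σ) ^ ((2 : ℝ) / (3 * p + 1)) with hzf
  set zg := (Lg * R ^ ((p : ℝ) + 1 - r) / σ) ^ ((2 : ℝ) / (3 * p + 1)) with hzg
  have hzf0 : 0 ≤ zf := by positivity
  have hzg0 : 0 ≤ zg := by positivity
  have hW24 : W ^ 2 ≤ W ^ 4 := pow_le_pow_right₀ hW1 (by norm_num)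
  have hnf : (out.nf : ℝ) ≤ ((n + 1 : ℕ) : ℝ) * (M * (((n + 1 : ℕ) : ℝ) * 2)) := by
    exact_mod_cast hcalls.1
  have hng : (out.ng : ℝ) ≤ ((n + 1 : ℕ) : ℝ) * (M * (((n + 1 : ℕ) : ℝ) *
      (((m + 1 : ℕ) : ℝ) * (M' * (((m + 1 : ℕ) : ℝ) * 2)) + 1))) := by
    exact_mod_cast hcalls.2
  refine ⟨hδε ▸ hspec, hnf.trans ?_, hng.trans ?_⟩
  · calc _ ≤ (C₂ * W) * ((C₁ * (1 + zf)) * ((C₂ * W) * 2)) := by gcongr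
      _ = C₁ * C₂ ^ 2 * 2 * W ^ 2 * (1 + zf) := by ring
      _ ≤ _ := by
        gcongr
        nlinarith
  -- Since `M' ≥ 1`, the single query of `g` for the outer stopping test is absorbed into the inner
  -- cost, and the product `M * M'` can be bounded as a whole.
  · have hM'1' : (1 : ℝ) ≤ M' := by exact_mod_cast hM'1
    calc _ ≤ (C₂ * W) * (M * ((C₂ * W) * ((C₂ * W) * (M' * ((C₂ * W) * 2)) + M'))) := by gcongr
      _ = C₂ ^ 2 * (2 * C₂ ^ 2 * W ^ 4 + W ^ 2) * (M * M') := by ring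
      _ ≤ C₂ ^ 2 * (2 * C₂ ^ 2 * W ^ 4 + 2 * W ^ 4) * (C₁ * (1 + zg)) := by
        gcongr
        nlinarith
      _ = _ := by ring
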